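/- Let $T\cong\mathcal O(2)$ be the tangent bundle of $\mathbf P^1$ and $\pi:\mathcal O(2)\to\mathbf P^1$ its total space, with tautological section $w$ of $\pi^*\mathcal O(2)$. A co-Higgs bundle on $\mathbf P^1$ is a holomorphic vector bundle $V$, given by an operator $\bar\partial_V$ on a $C^\infty$ bundle, with a holomorphic section $\phi$ of $\mathrm{End}\,V\otimes T$. For a $(1,1)$-form $B$, its B-field transform is $(\bar\partial_V+i_\phi B,\phi)$ on the same $C^\infty$ bundle; the Nahm flow is $t\mapsto(\bar\partial_V+t\,i_\phi B,\phi)$, where $B$ is the standard form $dz\,d\bar z/(1+z\bar z)^2$. Let $p=w^m+a_1w^{m-1}+\dots+a_m$ with $a_k\in H^0(\mathbf P^1,\mathcal O(2k))$, such that $S=\{p=0\}\subset\mathcal O(2)$ is smooth. Let $$0\to (W_1,\varphi_1)\to(V,\phi)\to(W_2,\varphi_2)\to0$$ be an extension of co-Higgs bundles with $\det(w-\varphi_1)=\det(w-\varphi_2)=p$ (so $\det(w-\phi)=p^2$ and the spectral curve of $V$ is a ribbon on $S$), and suppose that $p(\phi)\not\equiv0$. Let $L_i=\mathrm{coker}(\varphi_i-w)$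 be the line bundle on $S$ with $\pi_*L_i=W_i$. In a $C^\infty$ splitting write $$\bar\partial_V=\begin{pmatrix}\bar\partial_1&\beta\\0&\bar\partial_2\end{pmatrix},\qquad \phi=\begin{pmatrix}\varphi_1&\psi\\0&\varphi_2\end{pmatrix},$$ and let $\varphi_{12}:\mathrm{Hom}(W_2,W_1)\to\mathrm{Hom}(W_2,W_1)(2)$ be $x\mapsto x\varphi_2-\varphi_1x$. Then there is an effective divisor $D$ on $S$ such that: 1. $C^\infty$ splittings exist, and for each of them $\bar\partial\psi+\varphi_{12}\beta=0$, so that the projection of $\psi$ to $\mathrm{coker}\,\varphi_{12}$ is holomorphic. Under the isomorphism $\mathrm{coker}\,\varphi_{12}\cong(\pi_*(L_1^*L_2))^*(2)\cong\pi_*(L_1L_2^*)(2m)$, given by the trace pairing and relative duality for $\pi:S\to\mathbf P^1$ (the pairing of sections $s$ of $L_1L_2^*(2m)$ and $\theta$ of $L_1^*L_2$ being the trace over the fibres of $\pi$ of $s\theta/(\partial p/\partial w)$), it corresponds to a unique holomorphic section $s$ of $L_1L_2^*(2m)$ on $S$; this $s$ is not zero, and its zero divisor is $D$. 2. $D$ is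 conserved by the Nahm flow, and more generally by every B-field transform: for every $(1,1)$-form $B$ and $t\in\mathbf C$, the extension with $(V,\phi)$, $(W_i,\varphi_i)$ replaced by their B-field transforms by $tB$ has the same divisor $D$, and so has every extension of co-Higgs bundles $0\to W_1'\to V'\to W_2'\to0$ with $\det(w-\varphi_1')=\det(w-\varphi_2')=p$ in which $V'$ is isomorphic, as a co-Higgs bundle, to the B-field transform of $V$ by $tB$. 3. At every point $(w=\lambda,z=a)$ of $D$ the $\lambda$-eigenspace of $\phi(a)$ is two-dimensional. -/

import Mathlib

open scoped ContDiff
open Polynomial Complex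

noncomputable section

namespace NahmRibbon

/- The projective line is covered by two affine charts, indexed by `Bool`, each with a coordinate
running over `ℂ`.  The coordinate of chart `!i` is `z⁻¹` when that of chart `i` is `z`.
Every smooth bundle is trivial over a chart, so bundles, operators and sections are described by
matrix-valued functions in the two charts.  The tangent bundle `T = 𝒪(2)` has the frames `d/dz`;
since `d/dz = -z⁻² d/dζ` for `ζ = z⁻¹`, a section `w d/dz` has coordinate `-w z⁻²` in the other
chart, and `𝒪(2k) = T ^ k`. -/

/-! ### Smooth matrix functions and the Cauchy-Riemann operator -/

/-- The operator `∂/∂z̄` on complex functions. -/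
def dbar (f : ℂ → ℂ) (z : ℂ) : ℂ :=
  (1 / 2 : ℂ) * (fderiv ℝ f z 1 + I * fderiv ℝ f z I)

/-- The operator `∂/∂z̄` on matrix-valued functions, entry by entry. -/
def mdbar {k l : ℕ} (M : ℂ → Matrix (Fin k) (Fin l) ℂ) (z : ℂ) : Matrix (Fin k) (Fin l) ℂ :=
  Matrix.of fun a b => dbar (fun x => M x a b) z

/-- Real-smooth matrix-valued functions on a set. -/
def MSmoothOn {k l : ℕ} (M : ℂ → Matrix (Fin k) (Fin l) ℂ) (U : Set ℂ) : Prop :=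
  ∀ a b, ContDiffOn ℝ ∞ (fun z => M z a b) U

/-! ### Co-Higgs bundles on the projective line and B-field transforms -/

/-- A co-Higgs bundle of rank `n` on the projective line: a smooth complex vector bundle with
clutching maps `g i z` from the fibre in chart `i` to the fibre in chart `!i`, a holomorphic
structure given in chart `i` by `u ↦ (∂u/∂z̄ + A i u) dz̄`, and a holomorphic section
`φ i d/dz` of `End V ⊗ T`. -/
structure CoHiggs (n : ℕ) where
  g : Bool → ℂ → Matrix (Fin n) (Fin n) ℂ
  A : Bool → ℂ → Matrix (Fin n) (Fin n) ℂ
  φ : Bool → ℂ → Matrix (Fin n) (Fin n) ℂ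
  g_smooth : ∀ i, MSmoothOn (g i) {0}ᶜ
  g_inv : ∀ i z, z ≠ 0 → g (!i) z⁻¹ * g i z = 1
  A_smooth : ∀ i, MSmoothOn (A i) Set.univ
  A_glue : ∀ i z, z ≠ 0 →
    (-((starRingEnd ℂ z) ^ 2)⁻¹) • (A (!i) z⁻¹ * g i z) = g i z * A i z - mdbar (g i) z
  φ_smooth : ∀ i, MSmoothOn (φ i) Set.univ
  φ_glue : ∀ i z, z ≠ 0 → φ (!i) z⁻¹ * g i z = (-(z ^ 2)⁻¹) • (g i z * φ i z)
  φ_hol : ∀ i z, mdbar (φ i) z + (A i z * φ i z - φ i z * A i z) = 0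

/-- A morphism of co-Higgs bundles: a holomorphic bundle map that intertwines the Higgs fields. -/
structure CoHiggs.Hom {k l : ℕ} (V : CoHiggs k) (W : CoHiggs l) where
  mat : Bool → ℂ → Matrix (Fin l) (Fin k) ℂ
  smooth : ∀ i, MSmoothOn (mat i) Set.univ
  glue : ∀ i z, z ≠ 0 → mat (!i) z⁻¹ * V.g i z = W.g i z * mat i z
  hol : ∀ i z, mdbar (mat i) z + (W.A i z * mat i z - mat i z * V.A i z) = 0
  comm : ∀ i z, W.φ i z * mat i z = mat i z * V.φ i z

/-- A smooth (automatically closed) `(1,1)`-form `b i dz ∧ dz̄` on the projective line. -/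
structure Form11 where
  b : Bool → ℂ → ℂ
  smooth : ∀ i, ContDiff ℝ ∞ (b i)
  glue : ∀ i z, z ≠ 0 → b (!i) z⁻¹ = (z * starRingEnd ℂ z) ^ 2 * b i z

/-- The B-field transform by `t B`: the same smooth bundle and the same Higgs field, with the
holomorphic structure `∂̄ + t i_φ B`.  When `B = dz ∧ dz̄ / (1 + z z̄)²` this is the Nahm flow
at time `t`. -/
def CoHiggs.bField {n : ℕ} (V : CoHiggs n) (B : Form11) (t : ℂ) : CoHiggs n where
  g := V.g
  A i z := V.A i z + (t * B.b i z) • V.φ i z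
  φ := V.φ
  g_smooth := V.g_smooth
  g_inv := V.g_inv
  A_smooth i a c := by
    have h := (V.A_smooth i a c).add
      ((contDiffOn_const.mul (B.smooth i).contDiffOn).mul (V.φ_smooth i a c) :
        ContDiffOn ℝ ∞ (fun z => t * B.b i z * V.φ i z a c) Set.univ)
    simpa [Matrix.add_apply, Matrix.smul_apply] using h
  A_glue i z hz := by
    have hc : starRingEnd ℂ z ≠ 0 := by simpa using hz
    rw [add_mul, smul_add, V.A_glue i z hz, Matrix.smul_mul, V.φ_glue i z hz, B.glue i z hz,
      smul_smul, smul_smul, mul_add, Matrix.mul_smul]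
    have : -((starRingEnd ℂ z) ^ 2)⁻¹ * (t * ((z * starRingEnd ℂ z) ^ 2 * B.b i z))
        * -(z ^ 2)⁻¹ = t * B.b i z := by
      field_simp
    rw [this]
    abel
  φ_smooth := V.φ_smooth
  φ_glue := V.φ_glue
  φ_hol i z := by
    have h := V.φ_hol i z
    rw [add_mul, mul_add, Matrix.smul_mul, Matrix.mul_smul, add_sub_add_right_eq_sub]
    exact h

/-- The same bundle map, as a morphism between the B-field transforms. -/
def CoHiggs.Hom.bField {k l : ℕ} {V : CoHiggs k} {W : CoHiggs l} (f : V.Hom W) (B : Form11)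
    (t : ℂ) : (V.bField B t).Hom (W.bField B t) where
  mat := f.mat
  smooth := f.smooth
  glue := f.glue
  hol i z := by
    have h := f.hol i z
    change mdbar (f.mat i) z + ((W.A i z + (t * B.b i z) • W.φ i z) * f.mat i z
      - f.mat i z * (V.A i z + (t * B.b i z) • V.φ i z)) = 0
    rw [Matrix.add_mul, Matrix.mul_add, Matrix.smul_mul, Matrix.mul_smul, f.comm i z,
      add_sub_add_right_eq_sub]
    exact h
  comm := f.comm

/-- A morphism that is invertible in every fibre is an isomorphism. -/
def CoHiggs.Hom.IsIso {n : ℕ} {V W : CoHiggs n} (f : V.Hom W) : Prop :=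
  ∀ i z, IsUnit (f.mat i z)

/-! ### Spectral curves in the total space of `𝒪(2)` -/

/-- A polynomial `p = w ^ m + a₁ w ^ (m-1) + ⋯ + a_m` with `a_k` a section of `𝒪(2k)`, that is,
a polynomial of degree at most `2k` in `z`; the field `a k` is `a_(k+1)`. -/
structure SpectralPoly (m : ℕ) where
  a : Fin m → ℂ[X]
  deg : ∀ k, (a k).natDegree ≤ 2 * (k.val + 1)

/-- The coefficient `a_(k+1)` in the chart `i`. -/
def SpectralPoly.coeffAt {m : ℕ} (p : SpectralPoly m) : Bool → Fin m → ℂ → ℂ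
  | false, k, z => (p.a k).eval z
  | true, k, z => (-1) ^ (k.val + 1) * ((p.a k).reflect (2 * (k.val + 1))).eval z

/-- The polynomial `p(w, z)` in the variable `w`, at the point `z` of the chart `i`. -/
def SpectralPoly.poly {m : ℕ} (p : SpectralPoly m) (i : Bool) (z : ℂ) : ℂ[X] :=
  X ^ m + ∑ k : Fin m, C (p.coeffAt i k z) * X ^ (m - 1 - k.val)

/-- The point `(w, z)` of the chart `i` of the total space of `𝒪(2)` lies on `S = {p = 0}`. -/
def SpectralPoly.OnCurve {m : ℕ} (p : SpectralPoly m) (i : Bool) (w z : ℂ) : Prop :=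
  (p.poly i z).eval w = 0

/-- `p = 0` defines a smooth curve: `p`, `∂p/∂w` and `∂p/∂z` have no common zero. -/
def SpectralPoly.Smooth {m : ℕ} (p : SpectralPoly m) : Prop :=
  ∀ i w z, p.OnCurve i w z →
    ¬ ((p.poly i z).derivative.eval w = 0 ∧ deriv (fun x => (p.poly i x).eval w) z = 0)

/-- The co-Higgs bundle has spectral curve `p = 0`, that is, `det (w - φ) = p`. -/
def CoHiggs.HasSpectralPoly {m : ℕ} (W : CoHiggs m) (p : SpectralPoly m) : Prop :=
  ∀ i z, (W.φ i z).charpoly = p.poly i z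

/-- Effective divisors on the compact curve `S`. -/
structure SpectralPoly.Divisor {m : ℕ} (p : SpectralPoly m) where
  mult : Bool → ℂ → ℂ → ℕ
  supp : ∀ i w z, mult i w z ≠ 0 → p.OnCurve i w z
  glue : ∀ i w z, z ≠ 0 → mult (!i) (-(z ^ 2)⁻¹ * w) z⁻¹ = mult i w z
  finite : ∀ i, {x : ℂ × ℂ | mult i x.1 x.2 ≠ 0}.Finite

/-- A local holomorphic parametrization `τ ↦ (w τ, z τ)` of `S` in the chart `i`, centred at
the point `(w 0, z 0)`. -/
structure SpectralPoly.LocalParam {m : ℕ} (p : SpectralPoly m) (i : Bool) where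
  w : ℂ → ℂ
  z : ℂ → ℂ
  r : ℝ
  r_pos : 0 < r
  w_hol : DifferentiableOn ℂ w (Metric.ball 0 r)
  z_hol : DifferentiableOn ℂ z (Metric.ball 0 r)
  onCurve : ∀ τ ∈ Metric.ball (0 : ℂ) r, p.OnCurve i (w τ) (z τ)
  immersed : ∀ τ ∈ Metric.ball (0 : ℂ) r, ¬ (deriv w τ = 0 ∧ deriv z τ = 0)

/-! ### Extensions of co-Higgs bundles -/

/-- An extension `0 → W₁ → V → W₂ → 0` of co-Higgs bundles with `W₁`, `W₂` of rank `m`. -/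
structure Extension (m : ℕ) where
  W₁ : CoHiggs m
  V : CoHiggs (2 * m)
  W₂ : CoHiggs m
  ι : W₁.Hom V
  q : V.Hom W₂
  inj : ∀ i z, Function.Injective (ι.mat i z).mulVec
  exact : ∀ i z, Function.Exact (ι.mat i z).mulVec (q.mat i z).mulVec
  surj : ∀ i z, Function.Surjective (q.mat i z).mulVec

/-- A smooth splitting of an extension: a smooth bundle map `σ : W₂ → V` with `q ∘ σ = 1`. -/
structure Extension.Splitting {m : ℕ} (E : Extension m) where
  mat : Bool → ℂ → Matrix (Fin (2 * m)) (Fin m) ℂ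
  smooth : ∀ i, MSmoothOn (mat i) Set.univ
  glue : ∀ i z, z ≠ 0 → mat (!i) z⁻¹ * E.W₂.g i z = E.V.g i z * mat i z
  sect : ∀ i z, E.q.mat i z * mat i z = 1

/-- `ψ` is the off-diagonal term of the Higgs field: `φ = (φ₁ ψ; 0 φ₂)` in the splitting, which
says that `φ ∘ σ = ι ∘ ψ + σ ∘ φ₂`. -/
def Extension.Splitting.IsHiggsTerm {m : ℕ} {E : Extension m} (σ : E.Splitting)
    (ψ : Bool → ℂ → Matrix (Fin m) (Fin m) ℂ) : Prop :=
  ∀ i, MSmoothOn (ψ i) Set.univ ∧ ∀ z,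
    E.V.φ i z * σ.mat i z = E.ι.mat i z * ψ i z + σ.mat i z * E.W₂.φ i z

/-- `β i dz̄` is the off-diagonal term of the holomorphic structure: `∂̄_V = (∂̄₁ β; 0 ∂̄₂)` in
the splitting, which says that `∂̄_V ∘ σ = ι ∘ β + σ ∘ ∂̄₂`. -/
def Extension.Splitting.IsDbarTerm {m : ℕ} {E : Extension m} (σ : E.Splitting)
    (β : Bool → ℂ → Matrix (Fin m) (Fin m) ℂ) : Prop :=
  ∀ i, MSmoothOn (β i) Set.univ ∧ ∀ z,
    mdbar (σ.mat i) z + E.V.A i z * σ.mat i z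
      = E.ι.mat i z * β i z + σ.mat i z * E.W₂.A i z

/-- The map `φ₁₂ : Hom(W₂, W₁) → Hom(W₂, W₁)(2)`, `x ↦ x φ₂ - φ₁ x`. -/
def Extension.phi12 {m : ℕ} (E : Extension m) (i : Bool) (z : ℂ)
    (x : Matrix (Fin m) (Fin m) ℂ) : Matrix (Fin m) (Fin m) ℂ :=
  x * E.W₂.φ i z - E.W₁.φ i z * x

/-- The operator `∂̄` on sections of `Hom(W₂, W₁)(2)`, in the chart `i`. -/
def Extension.homDbar {m : ℕ} (E : Extension m) (i : Bool)
    (x : ℂ → Matrix (Fin m) (Fin m) ℂ) (z : ℂ) : Matrix (Fin m) (Fin m) ℂ :=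
  mdbar x z + (E.W₁.A i z * x z - x z * E.W₂.A i z)

/-! ### The line bundles `L₁`, `L₂` on the spectral curve and sections of `L₁ L₂^*(2m)` -/

/-- The cokernel of `φ - w`.  When `W` has the smooth spectral curve `S`, the cokernels of
`φ - w` at the points of `S` form the line bundle `L` on `S` with `π_* L = W`.  Off the curve the
cokernel is zero. -/
abbrev Coker {m : ℕ} (φ : Matrix (Fin m) (Fin m) ℂ) (w : ℂ) : Type :=
  (Fin m → ℂ) ⧸ LinearMap.range (φ - w • (1 : Matrix (Fin m) (Fin m) ℂ)).mulVecLin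

/-- The projection to the cokernel of `φ - w`. -/
abbrev toCoker {m : ℕ} (φ : Matrix (Fin m) (Fin m) ℂ) (w : ℂ) :
    (Fin m → ℂ) →ₗ[ℂ] Coker φ w :=
  Submodule.mkQ _

/-- The fibre of `L₁ L₂^*` at `(w, z)`.  In the chart `i` it is also the fibre of
`L₁ L₂^*(2m)`, by the frame `(d/dz) ^ m` of `𝒪(2m)`. -/
abbrev Extension.Fibre {m : ℕ} (E : Extension m) (i : Bool) (w z : ℂ) : Type :=
  Coker (E.W₂.φ i z) w →ₗ[ℂ] Coker (E.W₁.φ i z) w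

/-- A section `f` of `L₁ L₂^*(2m)` along a local parametrization of `S` is holomorphic near the
centre: it lifts to a smooth section `N` of the pull-back of `Hom(W₂, W₁)`, and the pulled-back
operator `∂̄` takes `N` to a form that is zero on the cokernels. -/
def Extension.HolAlong {m : ℕ} (E : Extension m) {p : SpectralPoly m} {i : Bool}
    (γ : p.LocalParam i) (f : ∀ τ : ℂ, E.Fibre i (γ.w τ) (γ.z τ)) : Prop :=
  ∃ ε : ℝ, 0 < ε ∧ ε ≤ γ.r ∧ ∃ N : ℂ → Matrix (Fin m) (Fin m) ℂ,
    MSmoothOn N (Metric.ball 0 ε) ∧ ∀ τ ∈ Metric.ball (0 : ℂ) ε, ∀ v : Fin m → ℂ,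
      f τ (toCoker (E.W₂.φ i (γ.z τ)) (γ.w τ) v)
        = toCoker (E.W₁.φ i (γ.z τ)) (γ.w τ) ((N τ).mulVec v) ∧
      toCoker (E.W₁.φ i (γ.z τ)) (γ.w τ)
        ((mdbar N τ + (starRingEnd ℂ (deriv γ.z τ)) •
          (E.W₁.A i (γ.z τ) * N τ - N τ * E.W₂.A i (γ.z τ))).mulVec v) = 0

/-- `s` is a holomorphic section of `L₁ L₂^*(2m)` on `S`. -/
structure Extension.IsHolSection {m : ℕ} (E : Extension m) (p : SpectralPoly m)
    (s : ∀ (i : Bool) (w z : ℂ), E.Fibre i w z) : Prop where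
  glue : ∀ i w z, z ≠ 0 → ∀ u v : Fin m → ℂ,
    s i w z (toCoker _ _ u) = toCoker _ _ v →
      s (!i) (-(z ^ 2)⁻¹ * w) z⁻¹ (toCoker _ _ ((E.W₂.g i z).mulVec u))
        = (-(z ^ 2)⁻¹) ^ m • toCoker _ _ ((E.W₁.g i z).mulVec v)
  hol : ∀ (i : Bool) (γ : p.LocalParam i), E.HolAlong γ fun τ => s i (γ.w τ) (γ.z τ)

/-- `s` corresponds to the class of `ψ` in `coker φ₁₂` under the isomorphism
`coker φ₁₂ ≅ (π_* (L₁^* L₂))^* (2) ≅ π_* (L₁ L₂^*) (2m)`.  The first map is the trace pairing of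
`Hom(W₂, W₁)(2)` with the maps `θ : W₁ → W₂` that intertwine `φ₁` and `φ₂`, which are the sections
of `π_* (L₁^* L₂)`.  The second is relative duality
for `π : S → ℙ¹`, whose relative canonical bundle is `𝒪(2m-2)`: it pairs `s` with `θ` by the trace
over the fibres of `π` of `s θ / (∂p/∂w)`.  It is determined by the unramified fibres, where the
trace is the sum over the points; there `c w` is the value of the function `s θ` at `(w, z)`. -/
def Extension.IsDualSection {m : ℕ} (E : Extension m) (p : SpectralPoly m)
    (ψ : Bool → ℂ → Matrix (Fin m) (Fin m) ℂ)
    (s : ∀ (i : Bool) (w z : ℂ), E.Fibre i w z) : Prop :=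
  ∀ i z, (p.poly i z).Separable → ∀ θ : Matrix (Fin m) (Fin m) ℂ,
    θ * E.W₁.φ i z = E.W₂.φ i z * θ →
      ∃ c : ℂ → ℂ,
        (∀ w, p.OnCurve i w z → ∀ u : Fin m → ℂ,
          s i w z (toCoker _ _ (θ.mulVec u)) = c w • toCoker _ _ u) ∧
        (ψ i z * θ).trace
          = ∑ w ∈ (p.poly i z).roots.toFinset, c w / (p.poly i z).derivative.eval w

/-- The section `s` vanishes to order exactly `k` at `(w, z)`: `s = τ ^ k e` with `τ` a local
coordinate of `S` at the point and `e` a local holomorphic section that is non-zero there. -/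
def Extension.HasOrder {m : ℕ} (E : Extension m) (p : SpectralPoly m)
    (s : ∀ (i : Bool) (w z : ℂ), E.Fibre i w z) (i : Bool) (w z : ℂ) (k : ℕ) : Prop :=
  ∃ γ : p.LocalParam i, γ.w 0 = w ∧ γ.z 0 = z ∧
    ∃ e : ∀ τ : ℂ, E.Fibre i (γ.w τ) (γ.z τ), E.HolAlong γ e ∧ e 0 ≠ 0 ∧
      ∃ ε : ℝ, 0 < ε ∧ ∀ τ ∈ Metric.ball (0 : ℂ) ε, s i (γ.w τ) (γ.z τ) = τ ^ k • e τ

/-- The off-diagonal Higgs term of the extension defines a non-zero holomorphic section of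
`L₁ L₂^*(2m)` on `S` with zero divisor `D`.  In detail: smooth splittings exist, and for each of
them, with off-diagonal terms `ψ` and `β`, one has `∂̄ψ + φ₁₂ β = 0` (the projection of
`ψ` to `coker φ₁₂` is holomorphic), exactly one holomorphic section `s` corresponds to `ψ`, and `s`
is not zero and has divisor `D`. -/
def Extension.HasZeroDivisor {m : ℕ} (E : Extension m) (p : SpectralPoly m)
    (D : p.Divisor) : Prop :=
  Nonempty E.Splitting ∧ ∀ σ : E.Splitting,
    ∃ ψ β : Bool → ℂ → Matrix (Fin m) (Fin m) ℂ,
      σ.IsHiggsTerm ψ ∧ σ.IsDbarTerm β ∧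
      (∀ i z, E.homDbar i (ψ i) z + E.phi12 i z (β i z) = 0) ∧
      ∃ s : ∀ (i : Bool) (w z : ℂ), E.Fibre i w z,
        (E.IsHolSection p s ∧ E.IsDualSection p ψ s) ∧
        (∀ s', E.IsHolSection p s' ∧ E.IsDualSection p ψ s' → s' = s) ∧
        s ≠ 0 ∧
        ∀ i w z, p.OnCurve i w z → E.HasOrder p s i w z (D.mult i w z)

/-- The B-field transform of an extension. -/
def Extension.bField {m : ℕ} (E : Extension m) (B : Form11) (t : ℂ) : Extension m where
  W₁ := E.W₁.bField B t
  V := E.V.bField B t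
  W₂ := E.W₂.bField B t
  ι := E.ι.bField B t
  q := E.q.bField B t
  inj := E.inj
  exact := E.exact
  surj := E.surj

end NahmRibbon

end

/-!
The map `p(φ)` vanishes on the image of `W₁` and takes values in it, because `p(φ₁) = 0` and
`p(φ₂) = 0` by the Cayley-Hamilton theorem.  So it is `ι ∘ R ∘ q` for a holomorphic map
`R : W₂ → W₁(2m)` with `R φ₂ = φ₁ R` (`Extension.polyMap`), and `R` induces on the cokernels of
`φ₂ - w` and `φ₁ - w` a holomorphic section `s` of `L₁ L₂^*(2m)` (`Extension.sec`).  It involves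
neither a splitting nor the holomorphic structures, which is why a B-field transform does not
change it.

The tool for the line bundles is the matrix `J(w)` of cofactors of `w - φᵢ` (`cof`).  Smoothness of
the curve makes it non-zero at every point of `S`: if `J` vanishes at a point, so do all first
derivatives of `det (w - φᵢ) = p`.  Thus `J` has rank one on `S`, its image is the eigenline, its
kernel is the image of `φᵢ - w`, and it embeds the cokernel line in the bundle.  The section `s` is
therefore encoded by the matrix `J₁ R = R J₂` (`Extension.secMap`).  Writing
`p = (x - w) h(x)`, so that `h(φᵢ) = Jᵢ`, gives `R J₂ = J₁ ψ J₂` for the off-diagonal term `ψ` of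
any splitting (`Extension.polyMap_mul_cof`).  With Lagrange interpolation
`∑ J₁(w) / (∂p/∂w) = 1` over an unramified fibre, this identity says that `s` is dual to `ψ`
(`Extension.isDualSection_sec`).  Conversely, testing with maps `θ` that factor through
eigenlines determines a dual section on unramified fibres, hence everywhere by continuity
(`Extension.IsHolSection.eq`).

For the zero divisor, solving an inhomogeneous Cauchy-Riemann equation (`exists_dbar_eq`) gives a
local holomorphic frame of `Hom(L₂, L₁)` along the curve (`Extension.exists_frame`), so near each
point `s` is either zero or `τ ^ n` times a frame.  If `p(φ)` is not zero then `s` is not zero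
somewhere, and since `S` is connected the first alternative never occurs.  Connectedness
(`SpectralPoly.curve_connected`) is where sections of `𝒪(2k)` on the projective line enter: if
`S = S' ∪ S''` is a disjoint union of open sets of degrees `d', d'' > 0` over the line, then the
resultant of the two factors of `p` is a nowhere vanishing section of `𝒪(2 d' d'')`, and there is
none.

An isomorphism of the middle terms intertwines the maps `p(φ)`.  Over a generic point `W₁` is the
kernel of `p(φ)`, so the isomorphism carries `W₁` to `W₁'`, and `R` changes by invertible factors;
the divisor does not change.  At a zero of `s`, finally, `J₁ ψ y₂ = 0` for an eigenvector `y₂` of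
`φ₂`, so that `ψ y₂ = (φ₁ - w) x` for some `x`, and `y₂` lifts to an eigenvector of `φ` in addition
to the eigenvector in `W₁`.
-/

noncomputable section

namespace NahmRibbon

open Filter Topology

/-! ### Calculus of the Cauchy-Riemann operator -/

lemma dbar_congr {f g : ℂ → ℂ} {z : ℂ} (h : f =ᶠ[𝓝 z] g) : dbar f z = dbar g z := by
  simp only [dbar, h.fderiv_eq]

lemma dbar_add {f g : ℂ → ℂ} {z : ℂ} (hf : DifferentiableAt ℝ f z) (hg : DifferentiableAt ℝ g z) :
    dbar (fun x => f x + g x) z = dbar f z + dbar g z := by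
  simp only [dbar, fderiv_fun_add hf hg, add_apply]
  ring

lemma dbar_mul {f g : ℂ → ℂ} {z : ℂ} (hf : DifferentiableAt ℝ f z) (hg : DifferentiableAt ℝ g z) :
    dbar (fun x => f x * g x) z = dbar f z * g z + f z * dbar g z := by
  simp only [dbar, fderiv_fun_mul hf hg, add_apply, smul_apply, smul_eq_mul]
  ring

lemma dbar_sum {ι : Type*} (s : Finset ι) {f : ι → ℂ → ℂ} {z : ℂ}
    (hf : ∀ i ∈ s, DifferentiableAt ℝ (f i) z) :
    dbar (fun x => ∑ i ∈ s, f i x) z = ∑ i ∈ s, dbar (f i) z := by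
  simp only [dbar, fderiv_fun_sum hf, sum_apply, Finset.mul_sum, ← Finset.sum_add_distrib]

lemma dbar_const (c z : ℂ) : dbar (fun _ => c) z = 0 := by
  simp [dbar]

lemma fderiv_real_of_hasDerivAt {f : ℂ → ℂ} {f' z : ℂ} (h : HasDerivAt f f' z) (v : ℂ) :
    fderiv ℝ f z v = v * f' := by
  have := h.hasFDerivAt.restrictScalars ℝ
  rw [this.fderiv]
  simp

lemma dbar_eq_zero_of_differentiableAt {f : ℂ → ℂ} {z : ℂ} (hf : DifferentiableAt ℂ f z) :
    dbar f z = 0 := by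
  simp only [dbar, fderiv_real_of_hasDerivAt hf.hasDerivAt]
  linear_combination (1 / 2 * deriv f z) * I_mul_I

lemma differentiableAt_of_dbar_eq_zero {f : ℂ → ℂ} {z : ℂ} (hf : DifferentiableAt ℝ f z)
    (h : dbar f z = 0) : DifferentiableAt ℂ f z := by
  rw [differentiableAt_complex_iff_differentiableAt_real]
  refine ⟨hf, ?_⟩
  simp only [dbar] at h
  rw [smul_eq_mul]
  linear_combination (-2 * I) * h + fderiv ℝ f z I * I_mul_I

/-- The chain rule for an outer holomorphic function. -/
lemma dbar_holomorphic_comp {f g : ℂ → ℂ} {z : ℂ} (hf : DifferentiableAt ℂ f (g z))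
    (hg : DifferentiableAt ℝ g z) :
    dbar (fun x => f (g x)) z = deriv f (g z) * dbar g z := by
  have h : HasFDerivAt (fun x => f (g x)) _ z :=
    (hf.hasDerivAt.hasFDerivAt.restrictScalars ℝ).comp z hg.hasFDerivAt
  simp only [dbar, h.fderiv]
  simp
  ring

/-- The chain rule for an inner holomorphic function. -/
lemma dbar_comp_holomorphic {f g : ℂ → ℂ} {z : ℂ} (hf : DifferentiableAt ℝ f (g z))
    (hg : DifferentiableAt ℂ g z) :
    dbar (fun x => f (g x)) z = starRingEnd ℂ (deriv g z) * dbar f (g z) := by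
  have h : HasFDerivAt (fun x => f (g x)) _ z :=
    hf.hasFDerivAt.comp z (hg.hasDerivAt.hasFDerivAt.restrictScalars ℝ)
  simp only [dbar, h.fderiv]
  simp
  set L := fderiv ℝ f (g z)
  have hL : ∀ c : ℂ, L c = c.re * L 1 + c.im * L I := by
    intro c
    conv_lhs => rw [← re_add_im c, show ((c.re : ℂ) + c.im * I) = c.re • (1 : ℂ) + c.im • I by
      simp, map_add, map_smul, map_smul]
    simp
  rw [hL (deriv g z), hL (I * deriv g z)]
  set c := deriv g z
  have h1 : (starRingEnd ℂ) c = c.re - c.im * I := by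
    apply Complex.ext <;> simp
  rw [h1]
  simp
  linear_combination ((c.im : ℂ) / 2 * L I) * I_mul_I

lemma dbar_exp {h : ℂ → ℂ} {z : ℂ} (hh : DifferentiableAt ℝ h z) :
    dbar (fun x => exp (h x)) z = exp (h z) * dbar h z := by
  rw [dbar_holomorphic_comp (Complex.differentiable_exp _) hh, Complex.deriv_exp]

/-! ### Matrix-valued functions -/

/-- Real differentiability of a matrix-valued function at a point, entry by entry. -/
def MDiffAt {k l : ℕ} (M : ℂ → Matrix (Fin k) (Fin l) ℂ) (z : ℂ) : Prop :=
  ∀ a b, DifferentiableAt ℝ (fun x => M x a b) z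

variable {k l n r : ℕ}

lemma MSmoothOn.mono {M : ℂ → Matrix (Fin k) (Fin l) ℂ} {U V : Set ℂ}
    (h : MSmoothOn M V) (hUV : U ⊆ V) : MSmoothOn M U :=
  fun a b => (h a b).mono hUV

lemma MSmoothOn.mdiffAt {M : ℂ → Matrix (Fin k) (Fin l) ℂ} {U : Set ℂ} {z : ℂ}
    (h : MSmoothOn M U) (hU : U ∈ 𝓝 z) : MDiffAt M z :=
  fun a b => ((h a b).contDiffAt hU).differentiableAt (by simp)

lemma MSmoothOn.mul {M : ℂ → Matrix (Fin k) (Fin l) ℂ} {N : ℂ → Matrix (Fin l) (Fin n) ℂ}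
    {U : Set ℂ} (hM : MSmoothOn M U) (hN : MSmoothOn N U) : MSmoothOn (fun z => M z * N z) U := by
  intro a b
  simp only [Matrix.mul_apply]
  exact ContDiffOn.sum fun j _ => (hM a j).mul (hN j b)

lemma MSmoothOn.add {M N : ℂ → Matrix (Fin k) (Fin l) ℂ} {U : Set ℂ}
    (hM : MSmoothOn M U) (hN : MSmoothOn N U) : MSmoothOn (fun z => M z + N z) U :=
  fun a b => (hM a b).add (hN a b)

lemma MSmoothOn.sub {M N : ℂ → Matrix (Fin k) (Fin l) ℂ} {U : Set ℂ}
    (hM : MSmoothOn M U) (hN : MSmoothOn N U) : MSmoothOn (fun z => M z - N z) U :=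
  fun a b => (hM a b).sub (hN a b)

lemma MSmoothOn.smul {c : ℂ → ℂ} {M : ℂ → Matrix (Fin k) (Fin l) ℂ} {U : Set ℂ}
    (hc : ContDiffOn ℝ ∞ c U) (hM : MSmoothOn M U) : MSmoothOn (fun z => c z • M z) U :=
  fun a b => hc.mul (hM a b)

lemma msmoothOn_const (M : Matrix (Fin k) (Fin l) ℂ) (U : Set ℂ) : MSmoothOn (fun _ => M) U :=
  fun _ _ => contDiffOn_const

lemma MSmoothOn.sum {ι : Type*} (s : Finset ι) {M : ι → ℂ → Matrix (Fin k) (Fin l) ℂ}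
    {U : Set ℂ} (hM : ∀ i ∈ s, MSmoothOn (M i) U) : MSmoothOn (fun z => ∑ i ∈ s, M i z) U := by
  intro a b
  simp only [Matrix.sum_apply]
  exact ContDiffOn.sum fun j hj => hM j hj a b

lemma MSmoothOn.pow {M : ℂ → Matrix (Fin k) (Fin k) ℂ} {U : Set ℂ} (hM : MSmoothOn M U) (j : ℕ) :
    MSmoothOn (fun z => M z ^ j) U := by
  induction j with
  | zero => simpa using msmoothOn_const 1 U
  | succ j ih => simpa only [pow_succ] using ih.mul hM

lemma MSmoothOn.comp {M : ℂ → Matrix (Fin k) (Fin l) ℂ} {f : ℂ → ℂ} {U V : Set ℂ}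
    (hM : MSmoothOn M V) (hf : ContDiffOn ℝ ∞ f U) (h : Set.MapsTo f U V) :
    MSmoothOn (fun z => M (f z)) U :=
  fun a b => (hM a b).comp hf h

lemma MSmoothOn.conjTranspose {M : ℂ → Matrix (Fin k) (Fin l) ℂ} {U : Set ℂ}
    (hM : MSmoothOn M U) : MSmoothOn (fun z => (M z).conjTranspose) U :=
  fun a b => Complex.conjCLE.contDiff.comp_contDiffOn (hM b a)

lemma MSmoothOn.det {M : ℂ → Matrix (Fin k) (Fin k) ℂ} {U : Set ℂ} (hM : MSmoothOn M U) :
    ContDiffOn ℝ ∞ (fun z => (M z).det) U := by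
  simp only [Matrix.det_apply]
  refine ContDiffOn.sum fun σ _ => ?_
  exact (contDiffOn_prod fun i _ => hM (σ i) i).const_smul _

lemma MSmoothOn.adjugate {M : ℂ → Matrix (Fin k) (Fin k) ℂ} {U : Set ℂ} (hM : MSmoothOn M U) :
    MSmoothOn (fun z => (M z).adjugate) U := by
  intro a b
  simp only [Matrix.adjugate_apply]
  refine MSmoothOn.det fun i j => ?_
  simp only [Matrix.updateRow_apply]
  split_ifs
  · exact contDiffOn_const
  · exact hM i j

lemma MSmoothOn.inv {M : ℂ → Matrix (Fin k) (Fin k) ℂ} {U : Set ℂ} (hM : MSmoothOn M U)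
    (h : ∀ z ∈ U, IsUnit (M z)) : MSmoothOn (fun z => (M z)⁻¹) U := by
  have h1 : ∀ z ∈ U, (M z).det ≠ 0 := fun z hz =>
    ((Matrix.isUnit_iff_isUnit_det _).1 (h z hz)).ne_zero
  simp only [Matrix.inv_def, Ring.inverse_eq_inv']
  exact MSmoothOn.smul (hM.det.inv h1) hM.adjugate

lemma MSmoothOn.continuous {M : ℂ → Matrix (Fin k) (Fin l) ℂ} (hM : MSmoothOn M Set.univ) :
    Continuous M :=
  continuous_matrix fun a b => (contDiffOn_univ.1 (hM a b)).continuous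

lemma MDiffAt.mul {M : ℂ → Matrix (Fin k) (Fin l) ℂ} {N : ℂ → Matrix (Fin l) (Fin n) ℂ}
    {z : ℂ} (hM : MDiffAt M z) (hN : MDiffAt N z) : MDiffAt (fun x => M x * N x) z := by
  intro a b
  simp only [Matrix.mul_apply]
  exact DifferentiableAt.fun_sum fun j _ => (hM a j).mul (hN j b)

lemma mdbar_congr {M N : ℂ → Matrix (Fin k) (Fin l) ℂ} {z : ℂ} (h : M =ᶠ[𝓝 z] N) :
    mdbar M z = mdbar N z := by
  ext a b
  exact dbar_congr (h.mono fun x hx => by simp only [hx])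

lemma mdbar_add {M N : ℂ → Matrix (Fin k) (Fin l) ℂ} {z : ℂ} (hM : MDiffAt M z)
    (hN : MDiffAt N z) : mdbar (fun x => M x + N x) z = mdbar M z + mdbar N z := by
  ext a b
  exact dbar_add (hM a b) (hN a b)

lemma mdbar_mul {M : ℂ → Matrix (Fin k) (Fin l) ℂ} {N : ℂ → Matrix (Fin l) (Fin n) ℂ}
    {z : ℂ} (hM : MDiffAt M z) (hN : MDiffAt N z) :
    mdbar (fun x => M x * N x) z = mdbar M z * N z + M z * mdbar N z := by
  ext a b
  simp only [mdbar, Matrix.of_apply, Matrix.mul_apply, Matrix.add_apply]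
  rw [dbar_sum _ fun j _ => (hM a j).fun_mul (hN j b), ← Finset.sum_add_distrib]
  exact Finset.sum_congr rfl fun j _ => dbar_mul (hM a j) (hN j b)

lemma mdbar_smul {c : ℂ → ℂ} {M : ℂ → Matrix (Fin k) (Fin l) ℂ} {z : ℂ}
    (hc : DifferentiableAt ℝ c z) (hM : MDiffAt M z) :
    mdbar (fun x => c x • M x) z = dbar c z • M z + c z • mdbar M z := by
  ext a b
  exact dbar_mul hc (hM a b)

lemma mdbar_const (M : Matrix (Fin k) (Fin l) ℂ) (z : ℂ) : mdbar (fun _ => M) z = 0 := by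
  ext a b
  exact dbar_const _ _

lemma mdbar_sum {ι : Type*} (s : Finset ι) {M : ι → ℂ → Matrix (Fin k) (Fin l) ℂ} {z : ℂ}
    (hM : ∀ i ∈ s, MDiffAt (M i) z) :
    mdbar (fun x => ∑ i ∈ s, M i x) z = ∑ i ∈ s, mdbar (M i) z := by
  ext a b
  simp only [mdbar, Matrix.of_apply, Matrix.sum_apply]
  exact dbar_sum s fun i hi => hM i hi a b

lemma mdbar_comp_holomorphic {M : ℂ → Matrix (Fin k) (Fin l) ℂ} {g : ℂ → ℂ} {z : ℂ}
    (hM : MDiffAt M (g z)) (hg : DifferentiableAt ℂ g z) :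
    mdbar (fun x => M (g x)) z = starRingEnd ℂ (deriv g z) • mdbar M (g z) := by
  ext a b
  exact dbar_comp_holomorphic (hM a b) hg

/-- The operator `∂̄` on homomorphisms from a bundle with operator `∂̄ + B` to one with operator
`∂̄ + A`. -/
def cov (A : ℂ → Matrix (Fin k) (Fin k) ℂ) (B : ℂ → Matrix (Fin l) (Fin l) ℂ)
    (M : ℂ → Matrix (Fin k) (Fin l) ℂ) (z : ℂ) : Matrix (Fin k) (Fin l) ℂ :=
  mdbar M z + (A z * M z - M z * B z)

section cov

variable {A : ℂ → Matrix (Fin k) (Fin k) ℂ} {B : ℂ → Matrix (Fin l) (Fin l) ℂ}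
  {C : ℂ → Matrix (Fin n) (Fin n) ℂ} {z : ℂ}

lemma cov_mul {M : ℂ → Matrix (Fin k) (Fin l) ℂ} {N : ℂ → Matrix (Fin l) (Fin n) ℂ}
    (hM : MDiffAt M z) (hN : MDiffAt N z) :
    cov A C (fun x => M x * N x) z = cov A B M z * N z + M z * cov B C N z := by
  simp only [cov, mdbar_mul hM hN, Matrix.add_mul,
    Matrix.sub_mul, Matrix.mul_add, Matrix.mul_sub, Matrix.mul_assoc]
  abel

lemma cov_congr {M N : ℂ → Matrix (Fin k) (Fin l) ℂ} (h : M =ᶠ[𝓝 z] N) :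
    cov A B M z = cov A B N z := by
  simp only [cov, mdbar_congr h, h.eq_of_nhds]

lemma cov_add {M N : ℂ → Matrix (Fin k) (Fin l) ℂ} (hM : MDiffAt M z) (hN : MDiffAt N z) :
    cov A B (fun x => M x + N x) z = cov A B M z + cov A B N z := by
  simp only [cov, mdbar_add hM hN, Matrix.add_mul, Matrix.mul_add]
  abel

lemma cov_smul {c : ℂ → ℂ} {M : ℂ → Matrix (Fin k) (Fin l) ℂ} (hc : DifferentiableAt ℝ c z)
    (hM : MDiffAt M z) :
    cov A B (fun x => c x • M x) z = dbar c z • M z + c z • cov A B M z := by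
  simp only [cov, mdbar_smul hc hM, Matrix.smul_mul, Matrix.mul_smul, smul_add, smul_sub]
  abel

lemma cov_sum {ι : Type*} (s : Finset ι) {M : ι → ℂ → Matrix (Fin k) (Fin l) ℂ}
    (hM : ∀ i ∈ s, MDiffAt (M i) z) :
    cov A B (fun x => ∑ i ∈ s, M i x) z = ∑ i ∈ s, cov A B (M i) z := by
  simp only [cov, mdbar_sum s hM, Matrix.sum_mul, Matrix.mul_sum, Finset.sum_add_distrib,
    Finset.sum_sub_distrib]

lemma MDiffAt.pow {M : ℂ → Matrix (Fin k) (Fin k) ℂ} (hM : MDiffAt M z) (j : ℕ) :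
    MDiffAt (fun x => M x ^ j) z := by
  induction j with
  | zero => simp only [pow_zero]; exact fun a b => differentiableAt_const _
  | succ j ih => simpa only [pow_succ] using ih.mul hM

lemma cov_pow {M : ℂ → Matrix (Fin k) (Fin k) ℂ} (hM : MDiffAt M z) (h : cov A A M z = 0)
    (j : ℕ) : cov A A (fun x => M x ^ j) z = 0 := by
  induction j with
  | zero => simp [cov, mdbar_const]
  | succ j ih => simp only [pow_succ]; rw [cov_mul (B := A) (hM.pow j) hM, h, ih]; simp

/-- A polynomial in a holomorphic endomorphism, with holomorphic coefficients, is holomorphic. -/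
lemma cov_sum_smul_pow {M : ℂ → Matrix (Fin k) (Fin k) ℂ} (hM : MDiffAt M z)
    (h : cov A A M z = 0) (N : ℕ) {c : ℕ → ℂ → ℂ} (hc : ∀ j, DifferentiableAt ℂ (c j) z) :
    cov A A (fun x => ∑ j ∈ Finset.range N, c j x • M x ^ j) z = 0 := by
  rw [cov_sum (M := fun j x => c j x • M x ^ j) _
    fun j _ a b => ((hc j).restrictScalars ℝ).fun_mul (hM.pow j a b)]
  refine Finset.sum_eq_zero fun j _ => ?_
  rw [cov_smul ((hc j).restrictScalars ℝ) (hM.pow j), cov_pow hM h,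
    dbar_eq_zero_of_differentiableAt (hc j)]
  simp

/-- Pull-back by a holomorphic map. -/
lemma cov_comp {M : ℂ → Matrix (Fin k) (Fin l) ℂ} {g : ℂ → ℂ}
    (hM : MDiffAt M (g z)) (hg : DifferentiableAt ℂ g z) :
    cov (fun x => starRingEnd ℂ (deriv g x) • A (g x))
      (fun x => starRingEnd ℂ (deriv g x) • B (g x)) (fun x => M (g x)) z
      = starRingEnd ℂ (deriv g z) • cov A B M (g z) := by
  simp only [cov, mdbar_comp_holomorphic hM hg, Matrix.smul_mul, Matrix.mul_smul, smul_add,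
    smul_sub]

end cov

/-! ### The inhomogeneous Cauchy-Riemann equation -/

section CauchyPompeiu

open MeasureTheory Set

/-- The point with polar coordinates `(r, θ)`. -/
def polarPt (p : ℝ × ℝ) : ℂ := p.1 * exp (p.2 * I)

lemma hasDerivAt_polarPt_radius (r θ : ℝ) :
    HasDerivAt (fun x : ℝ => polarPt (x, θ)) (exp (θ * I)) r := by
  simpa [polarPt] using (hasDerivAt_id (r : ℂ)).comp_ofReal.mul_const (exp (θ * I))

lemma hasDerivAt_polarPt_angle (r θ : ℝ) :
    HasDerivAt (fun x : ℝ => polarPt (r, x)) (r * (I * exp (θ * I))) θ := by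
  have h : HasDerivAt (fun x : ℂ => exp (x * I)) (exp (θ * I) * (1 * I)) (θ : ℂ) :=
    ((hasDerivAt_id (θ : ℂ)).mul_const I).cexp
  have := h.comp_ofReal.const_mul (r : ℂ)
  convert! this using 1
  ring

lemma continuous_polarPt : Continuous polarPt := by
  unfold polarPt
  fun_prop

variable {b : ℂ → ℂ}

lemma fderiv_apply_eq (L : ℂ →L[ℝ] ℂ) (c : ℂ) : L c = c.re * L 1 + c.im * L I := by
  conv_lhs => rw [← re_add_im c, show ((c.re : ℂ) + c.im * I) = c.re • (1 : ℂ) + c.im • I by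
    simp, map_add, map_smul, map_smul]
  simp

/-- The Cauchy-Pompeiu formula at the origin for functions with compact support. -/
lemma integral_inv_mul_dbar (hb : ContDiff ℝ ∞ b) (hc : HasCompactSupport b) :
    ∫ t : ℂ, t⁻¹ * dbar b t = -(Real.pi : ℂ) * b 0 := by
  have hbd : Differentiable ℝ b := hb.differentiable (by simp)
  have hD : Continuous (fderiv ℝ b) := hb.continuous_fderiv (by simp)
  obtain ⟨R, hR0, hR⟩ := hc.isBounded.exists_pos_norm_lt
  have hzero : ∀ t : ℂ, R ≤ ‖t‖ → b t = 0 := fun t ht => by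
    by_contra h
    exact absurd (hR t (subset_tsupport _ h)) (not_lt.2 ht)
  have hzero' : ∀ t : ℂ, R ≤ ‖t‖ → fderiv ℝ b t = 0 := fun t ht => by
    by_contra h
    exact absurd (hR t (support_fderiv_subset ℝ h)) (not_lt.2 ht)
  -- the radial derivative and the angular derivative divided by the radius
  set U : ℝ × ℝ → ℂ := fun p => fderiv ℝ b (polarPt p) (exp (p.2 * I)) with hU
  set V : ℝ × ℝ → ℂ := fun p => fderiv ℝ b (polarPt p) (I * exp (p.2 * I)) with hV
  have hUc : Continuous U :=
    (hD.comp continuous_polarPt).clm_apply (by fun_prop)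
  have hVc : Continuous V :=
    (hD.comp continuous_polarPt).clm_apply (by fun_prop)
  have hint : ∀ W : ℝ × ℝ → ℂ, Continuous W →
      IntegrableOn W (Ioo 0 R ×ˢ Ioo (-Real.pi) Real.pi) volume := by
    intro W hW
    refine (hW.continuousOn.integrableOn_compact
      (isCompact_Icc.prod isCompact_Icc :
        IsCompact (Icc 0 R ×ˢ Icc (-Real.pi) Real.pi))).mono_set ?_
    exact prod_mono Ioo_subset_Icc_self Ioo_subset_Icc_self
  have hUint : ∫ p in Ioo 0 R ×ˢ Ioo (-Real.pi) Real.pi, U p = -(2 * Real.pi : ℂ) * b 0 := by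
    rw [Measure.volume_eq_prod, ← setIntegral_prod_swap,
      setIntegral_prod (fun p => U p.swap) (hint U hUc).swap]
    have h1 : ∀ θ : ℝ, ∫ r in Ioo 0 R, U (r, θ) = -b 0 := by
      intro θ
      rw [← integral_Ioc_eq_integral_Ioo, ← intervalIntegral.integral_of_le hR0.le,
        intervalIntegral.integral_eq_sub_of_hasDerivAt (f := fun r => b (polarPt (r, θ)))]
      · have h2 : b (polarPt (R, θ)) = 0 := by
          apply hzero
          simp [polarPt, norm_exp_ofReal_mul_I, abs_of_pos hR0]
        rw [h2]
        simp [polarPt]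
      · intro r _
        exact (hbd _).hasFDerivAt.comp_hasDerivAt r (hasDerivAt_polarPt_radius r θ)
      · exact (hUc.comp (by fun_prop : Continuous fun r : ℝ => (r, θ))).intervalIntegrable _ _
    simp only [Prod.swap_prod_mk, h1]
    simp only [integral_const, MeasurableSet.univ, measureReal_restrict_apply, univ_inter,
      Real.volume_real_Ioo_of_le (by linarith [Real.pi_pos] : -Real.pi ≤ Real.pi)]
    rw [real_smul]
    push_cast
    ring
  have hVint : ∫ p in Ioo 0 R ×ˢ Ioo (-Real.pi) Real.pi, V p = 0 := by
    rw [Measure.volume_eq_prod, setIntegral_prod _ (hint V hVc)]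
    refine setIntegral_eq_zero_of_forall_eq_zero fun r hr => ?_
    have hr0 : (r : ℂ) ≠ 0 := by exact_mod_cast hr.1.ne'
    rw [← integral_Ioc_eq_integral_Ioo,
      ← intervalIntegral.integral_of_le (by linarith [Real.pi_pos] : -Real.pi ≤ Real.pi)]
    have h1 : ∫ θ in (-Real.pi)..Real.pi, (r : ℂ) * V (r, θ) = 0 := by
      rw [intervalIntegral.integral_eq_sub_of_hasDerivAt (f := fun θ => b (polarPt (r, θ)))]
      · simp [polarPt, exp_neg, exp_pi_mul_I]
      · intro θ _
        convert! (hbd _).hasFDerivAt.comp_hasDerivAt θ (hasDerivAt_polarPt_angle r θ) using 1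
        simp only [hV]
        rw [show (r : ℂ) * (I * exp (θ * I)) = r • (I * exp (θ * I)) from real_smul.symm, map_smul,
          real_smul]
      · exact (continuous_const.mul
          (hVc.comp (by fun_prop : Continuous fun θ : ℝ => (r, θ)))).intervalIntegrable _ _
    rw [intervalIntegral.integral_const_mul] at h1
    exact (mul_eq_zero.1 h1).resolve_left hr0
  rw [← Complex.integral_comp_polarCoord_symm]
  have hpol : ∀ p : ℝ × ℝ, Complex.polarCoord.symm p = polarPt p := by
    intro p
    rw [Complex.polarCoord_symm_apply, polarPt, exp_mul_I]
    simp
  have hfun : ∀ p ∈ polarCoord.target,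
      p.1 • ((Complex.polarCoord.symm p)⁻¹ * dbar b (Complex.polarCoord.symm p))
        = (1 / 2 : ℂ) * (U p + I * V p) := by
    rintro ⟨r, θ⟩ hp
    rw [polarCoord_target] at hp
    have hr0 : (r : ℂ) ≠ 0 := by exact_mod_cast (show 0 < r from hp.1).ne'
    rw [hpol, real_smul]
    simp only [hU, hV, dbar]
    set L := fderiv ℝ b (polarPt (r, θ))
    rw [fderiv_apply_eq L (exp _), fderiv_apply_eq L (I * exp _)]
    have e1 : exp ((θ : ℂ) * I) = (Real.cos θ : ℂ) + Real.sin θ * I := by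
      rw [exp_mul_I]; simp
    have e2 : exp ((θ : ℂ) * I) * ((Real.cos θ : ℂ) - Real.sin θ * I) = 1 := by
      rw [e1]
      have : (Real.cos θ : ℂ) ^ 2 + (Real.sin θ : ℂ) ^ 2 = 1 := by
        exact_mod_cast Real.cos_sq_add_sin_sq θ
      linear_combination this - (Real.sin θ : ℂ) ^ 2 * I_mul_I
    have e3 : (polarPt (r, θ))⁻¹ = (r : ℂ)⁻¹ * ((Real.cos θ : ℂ) - Real.sin θ * I) := by
      rw [polarPt, mul_inv]
      congr 1
      exact inv_eq_of_mul_eq_one_right e2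
    rw [e3, e1]
    simp only [add_re, mul_re, ofReal_re, ofReal_im, I_re, I_im, add_im, mul_im]
    push_cast
    field_simp
    ring_nf
    rw [I_sq]
    ring
  rw [setIntegral_congr_fun polarCoord.open_target.measurableSet hfun,
    setIntegral_eq_of_subset_of_forall_sdiff_eq_zero polarCoord.open_target.measurableSet
      (s := Ioo 0 R ×ˢ Ioo (-Real.pi) Real.pi)]
  · rw [integral_const_mul, integral_add (hint U hUc) ((hint V hVc).const_mul I),
      integral_const_mul, hUint, hVint]
    ring
  · rw [polarCoord_target]
    exact prod_mono Ioo_subset_Ioi_self subset_rfl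
  · rintro ⟨r, θ⟩ ⟨h1, h2⟩
    rw [polarCoord_target] at h1
    have hrR : R ≤ r := by
      by_contra h
      exact h2 ⟨⟨h1.1, not_le.1 h⟩, h1.2⟩
    have : fderiv ℝ b (polarPt (r, θ)) = 0 := by
      apply hzero'
      simpa [polarPt, norm_exp_ofReal_mul_I, abs_of_pos (hR0.trans_le hrR)] using hrR
    simp [hU, hV, this]

end CauchyPompeiu

open MeasureTheory in
lemma locallyIntegrable_inv : LocallyIntegrable (fun z : ℂ => z⁻¹) := by
  refine locallyIntegrable_of_norm_le_rpow (C := 1) (α := 1) (by simp) (by simp)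
    (Eventually.of_forall fun z => ?_) (by fun_prop)
  rw [Real.rpow_neg_one, norm_inv, one_mul]

open MeasureTheory in
/-- Convolution with the fundamental solution `1 / (π z)` inverts `∂̄` on smooth functions with
compact support. -/
lemma exists_dbar_eq_of_hasCompactSupport {a : ℂ → ℂ} (ha : ContDiff ℝ ∞ a)
    (hc : HasCompactSupport a) : ∃ h : ℂ → ℂ, ContDiff ℝ ∞ h ∧ ∀ z, dbar h z = a z := by
  set L : ℂ →L[ℝ] ℂ →L[ℝ] ℂ := ContinuousLinearMap.mul ℝ ℂ
  set g : ℂ → ℂ := fun z => (Real.pi : ℂ)⁻¹ * z⁻¹ with hg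
  have hgi : LocallyIntegrable g := locallyIntegrable_inv.smul (Real.pi : ℂ)⁻¹
  refine ⟨convolution g a L volume, hc.contDiff_convolution_right L hgi ha, fun z => ?_⟩
  have hd := hc.hasFDerivAt_convolution_right L hgi (ha.of_le (by simp)) z
  have hfc : HasCompactSupport (fderiv ℝ a) := hc.fderiv ℝ
  have hcont : Continuous (fderiv ℝ a) := ha.continuous_fderiv (by simp)
  have happ : ∀ v : ℂ, HasCompactSupport fun x => fderiv ℝ a x v := fun v => hc.fderiv_apply ℝ v
  have hex : ∀ v : ℂ, Integrable fun t => g t * fderiv ℝ a (z - t) v := fun v =>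
    ((happ v).convolutionExists_right L hgi (hcont.clm_apply continuous_const) z).integrable
  simp only [dbar, hd.fderiv]
  rw [convolution_precompR_apply L hgi hfc hcont, convolution_precompR_apply L hgi hfc hcont]
  have h1 : ∀ v : ℂ, convolution g (fun x => fderiv ℝ a x v) L volume z
      = ∫ t, g t * fderiv ℝ a (z - t) v := fun v => rfl
  rw [h1, h1, ← integral_const_mul, ← integral_add (hex 1) ((hex I).const_mul I),
    ← integral_const_mul]
  -- the Cauchy-Pompeiu formula for the reflected function
  set b : ℂ → ℂ := fun t => a (z - t)
  have hb : ContDiff ℝ ∞ b := ha.comp (contDiff_const.sub contDiff_id)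
  have hbc : HasCompactSupport b := hc.comp_homeomorph (Homeomorph.subLeft z)
  have hbd : ∀ t, dbar b t =
      -((1 / 2 : ℂ) * (fderiv ℝ a (z - t) 1 + I * fderiv ℝ a (z - t) I)) := by
    intro t
    have h2 : HasFDerivAt b _ t := (ha.differentiable (by simp) (z - t)).hasFDerivAt.comp t
      ((hasFDerivAt_id (𝕜 := ℝ) t).const_sub z)
    simp only [dbar, h2.fderiv]
    simp
    ring
  have key := integral_inv_mul_dbar hb hbc
  have h3 : ∀ t, (1 / 2 : ℂ) * (g t * fderiv ℝ a (z - t) 1 + I * (g t * fderiv ℝ a (z - t) I))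
      = (-(Real.pi : ℂ)⁻¹) * (t⁻¹ * dbar b t) := by
    intro t
    rw [hbd]
    simp only [hg]
    ring
  simp only [h3]
  rw [integral_const_mul, key]
  have hpi : (Real.pi : ℂ) ≠ 0 := by exact_mod_cast Real.pi_ne_zero
  simp only [b, sub_zero]
  field_simp

/-- The `∂̄`-Poincaré lemma in one variable. -/
lemma exists_dbar_eq {μ : ℂ → ℂ} {ε : ℝ} (hε : 0 < ε)
    (hμ : ContDiffOn ℝ ∞ μ (Metric.ball 0 ε)) :
    ∃ h : ℂ → ℂ, ContDiff ℝ ∞ h ∧ ∀ z ∈ Metric.ball (0 : ℂ) (ε / 3), dbar h z = μ z := by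
  let χ : ContDiffBump (0 : ℂ) := ⟨ε / 3, ε / 2, by positivity, by linarith⟩
  set a : ℂ → ℂ := fun z => χ z • μ z with haf
  have ha : ContDiff ℝ ∞ a := by
    rw [contDiff_iff_contDiffAt]
    intro z
    by_cases hz : z ∈ Metric.ball (0 : ℂ) ε
    · exact χ.contDiffAt.smul (hμ.contDiffAt (Metric.isOpen_ball.mem_nhds hz))
    · have h1 : z ∈ (Metric.closedBall (0 : ℂ) (ε / 2))ᶜ := by
        simp only [Metric.mem_ball, not_lt, dist_zero_right] at hz
        simp only [Set.mem_compl_iff, Metric.mem_closedBall, dist_zero_right, not_le]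
        linarith
      have h2 : a =ᶠ[𝓝 z] fun _ => 0 := by
        filter_upwards [Metric.isClosed_closedBall.isOpen_compl.mem_nhds h1] with x hx
        have : χ x = 0 := by
          apply χ.zero_of_le_dist
          simp only [Set.mem_compl_iff, Metric.mem_closedBall, not_le] at hx
          exact hx.le
        simp [haf, this]
      exact contDiffAt_const.congr_of_eventuallyEq h2
  have hc : HasCompactSupport a := χ.hasCompactSupport.smul_right
  obtain ⟨h, hh, hd⟩ := exists_dbar_eq_of_hasCompactSupport ha hc
  refine ⟨h, hh, fun z hz => ?_⟩
  rw [hd, haf]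
  simp only
  rw [χ.one_of_mem_closedBall (Metric.ball_subset_closedBall hz), one_smul]

/-! ### Linear algebra of regular matrices -/

section LinearAlgebra

variable {m k l : ℕ}

/-- The adjugate of `w - M`.  If it is not zero at an eigenvalue `w`, then it has rank one, its
image is the eigenspace and its kernel is the image of `w - M`. -/
def cof (M : Matrix (Fin m) (Fin m) ℂ) (w : ℂ) : Matrix (Fin m) (Fin m) ℂ :=
  (w • (1 : Matrix (Fin m) (Fin m) ℂ) - M).adjugate

lemma eval_charpoly_eq_det (M : Matrix (Fin m) (Fin m) ℂ) (w : ℂ) :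
    M.charpoly.eval w = (w • (1 : Matrix (Fin m) (Fin m) ℂ) - M).det := by
  rw [Matrix.eval_charpoly]
  congr 2
  ext i j
  simp [Matrix.scalar_apply, Matrix.diagonal_apply, Matrix.one_apply]

lemma sub_mul_cof {M : Matrix (Fin m) (Fin m) ℂ} {w : ℂ} (h : M.charpoly.eval w = 0) :
    (M - w • (1 : Matrix (Fin m) (Fin m) ℂ)) * cof M w = 0 := by
  have := Matrix.mul_adjugate (w • (1 : Matrix (Fin m) (Fin m) ℂ) - M)
  rw [← eval_charpoly_eq_det, h, zero_smul] at this
  rw [← neg_sub, Matrix.neg_mul, cof, this, neg_zero]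

lemma cof_mul_sub {M : Matrix (Fin m) (Fin m) ℂ} {w : ℂ} (h : M.charpoly.eval w = 0) :
    cof M w * (M - w • (1 : Matrix (Fin m) (Fin m) ℂ)) = 0 := by
  have := Matrix.adjugate_mul (w • (1 : Matrix (Fin m) (Fin m) ℂ) - M)
  rw [← eval_charpoly_eq_det, h, zero_smul] at this
  rw [← neg_sub, Matrix.mul_neg, cof, this, neg_zero]

lemma sub_mul_aeval_divByMonic (M : Matrix (Fin m) (Fin m) ℂ) (P : ℂ[X]) (w : ℂ) :
    (M - w • (1 : Matrix (Fin m) (Fin m) ℂ)) * aeval M (P /ₘ (X - C w))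
      = aeval M P - P.eval w • (1 : Matrix (Fin m) (Fin m) ℂ) := by
  have h := congrArg (aeval M) (X_sub_C_mul_divByMonic_eq_sub_modByMonic P w)
  rw [modByMonic_X_sub_C_eq_C_eval] at h
  simpa [Algebra.algebraMap_eq_smul_one] using h

lemma continuous_aeval_divByMonic (M : Matrix (Fin m) (Fin m) ℂ) (P : ℂ[X]) :
    Continuous fun w => aeval M (P /ₘ (X - C w)) := by
  have h : ∀ w : ℂ, (P /ₘ (X - C w)).natDegree < P.natDegree + 1 := fun w => by
    rw [natDegree_divByMonic _ (monic_X_sub_C w)]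
    omega
  simp only [fun w => aeval_eq_sum_range' (h w) M, coeff_divByMonic_X_sub_C]
  fun_prop

lemma dense_compl_roots {P : ℂ[X]} (hP : P ≠ 0) : Dense {x : ℂ | P.eval x ≠ 0} := by
  have : {x : ℂ | P.eval x ≠ 0} = (P.rootSet ℂ)ᶜ := by
    ext x
    simp [mem_rootSet, hP]
  rw [this]
  exact (P.rootSet_finite ℂ).countable.dense_compl ℂ

/-- The adjugate of `w - M` is a polynomial in `M`. -/
lemma cof_eq_aeval (M : Matrix (Fin m) (Fin m) ℂ) (w : ℂ) :
    cof M w = aeval M (M.charpoly /ₘ (X - C w)) := by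
  have hc : Continuous (cof M) := by
    unfold cof
    exact Continuous.matrix_adjugate (by fun_prop)
  refine congrFun (hc.ext_on (dense_compl_roots M.charpoly_monic.ne_zero)
    (continuous_aeval_divByMonic M M.charpoly) fun x hx => ?_) w
  have h1 := sub_mul_aeval_divByMonic M M.charpoly x
  rw [Matrix.aeval_self_charpoly, zero_sub, ← neg_sub, Matrix.neg_mul, neg_inj] at h1
  have h2 := Matrix.mul_adjugate (x • (1 : Matrix (Fin m) (Fin m) ℂ) - M)
  rw [← eval_charpoly_eq_det] at h2
  have hu : IsUnit (x • (1 : Matrix (Fin m) (Fin m) ℂ) - M) := by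
    rw [Matrix.isUnit_iff_isUnit_det, ← eval_charpoly_eq_det]
    exact isUnit_iff_ne_zero.2 hx
  exact hu.mul_left_cancel (h2.trans h1.symm)

/-- Intertwining relations pass to polynomials. -/
lemma mul_aeval_eq_aeval_mul {M : Matrix (Fin k) (Fin k) ℂ} {N : Matrix (Fin l) (Fin l) ℂ}
    {T : Matrix (Fin l) (Fin k) ℂ} (h : T * M = N * T) (P : ℂ[X]) :
    T * aeval M P = aeval N P * T := by
  have hpow : ∀ j : ℕ, T * M ^ j = N ^ j * T := by
    intro j
    induction j with
    | zero => simp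
    | succ j ih => rw [pow_succ, ← Matrix.mul_assoc, ih, Matrix.mul_assoc, h, ← Matrix.mul_assoc,
        pow_succ]
  simp only [aeval_eq_sum_range, Matrix.mul_sum, Matrix.sum_mul, Matrix.mul_smul, Matrix.smul_mul,
    hpow]

lemma mul_cof_eq_cof_mul {M N T : Matrix (Fin m) (Fin m) ℂ} (h : T * M = N * T)
    (hc : M.charpoly = N.charpoly) (w : ℂ) : T * cof M w = cof N w * T := by
  rw [cof_eq_aeval, cof_eq_aeval, hc, mul_aeval_eq_aeval_mul h]

/-- A singular matrix with non-zero adjugate has a one-dimensional kernel, and its adjugate is the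
product of a kernel vector and a cokernel vector. -/
lemma exists_adjugate_eq_vecMulVec {A : Matrix (Fin m) (Fin m) ℂ} (hd : A.det = 0)
    (ha : A.adjugate ≠ 0) :
    ∃ y f : Fin m → ℂ, y ≠ 0 ∧ f ≠ 0 ∧ A.adjugate = Matrix.vecMulVec y f ∧ A.mulVec y = 0 ∧
      ∀ v, A.mulVec v = 0 → ∃ c : ℂ, v = c • y := by
  obtain ⟨i, j, hij⟩ : ∃ i j, A.adjugate i j ≠ 0 := by
    by_contra! h
    exact ha (Matrix.ext h)
  -- replacing a row by a unit vector gives an invertible matrix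
  set B := A.updateRow j (Pi.single i 1) with hB
  have hBu : IsUnit B := by
    rw [Matrix.isUnit_iff_isUnit_det, isUnit_iff_ne_zero]
    rwa [Matrix.adjugate_apply] at hij
  have hker : ∀ v, A.mulVec v = 0 → v = v i • (B⁻¹).mulVec (Pi.single j 1) := by
    intro v hv
    have h1 : B.mulVec v = v i • Pi.single j 1 := by
      ext r
      by_cases hr : r = j
      · subst hr
        simp [hB, Matrix.mulVec, Matrix.updateRow_self]
      · have := congrFun hv r
        simp only [Matrix.mulVec, Pi.zero_apply] at this
        simp [hB, Matrix.mulVec, this, hr]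
    rw [← Matrix.mulVec_smul, ← h1, Matrix.mulVec_mulVec,
      Matrix.nonsing_inv_mul _ ((Matrix.isUnit_iff_isUnit_det _).1 hBu), Matrix.one_mulVec]
  obtain ⟨y, hy0, hy⟩ := Matrix.exists_mulVec_eq_zero_iff.2 hd
  have hyi : y i ≠ 0 := fun h => hy0 (by rw [hker y hy, h, zero_smul])
  have hker' : ∀ v, A.mulVec v = 0 → ∃ c : ℂ, v = c • y := by
    intro v hv
    refine ⟨v i / y i, ?_⟩
    have hz : y = y i • (B⁻¹).mulVec (Pi.single j 1) := hker y hy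
    set z := (B⁻¹).mulVec (Pi.single j 1)
    calc v = v i • z := hker v hv
      _ = (v i / y i) • (y i • z) := by rw [smul_smul, div_mul_cancel₀ _ hyi]
      _ = (v i / y i) • y := by rw [← hz]
  have hcol : ∀ b, ∃ c : ℂ, (fun a => A.adjugate a b) = c • y := by
    intro b
    apply hker'
    have h1 : A * A.adjugate = 0 := by rw [Matrix.mul_adjugate, hd, zero_smul]
    ext a
    exact congrFun (congrFun h1 a) b
  choose f hf using hcol
  have hJ : A.adjugate = Matrix.vecMulVec y f := by
    ext a b
    rw [Matrix.vecMulVec_apply, mul_comm]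
    exact congrFun (hf b) a
  refine ⟨y, f, hy0, fun h => ha ?_, hJ, hy, hker'⟩
  rw [hJ, h]
  ext a b
  simp [Matrix.vecMulVec_apply]

variable {M : Matrix (Fin m) (Fin m) ℂ} {w : ℂ}

lemma exists_cof_eq_vecMulVec (hw : M.charpoly.eval w = 0) (hJ : cof M w ≠ 0) :
    ∃ y f : Fin m → ℂ, y ≠ 0 ∧ f ≠ 0 ∧ cof M w = Matrix.vecMulVec y f ∧ M.mulVec y = w • y ∧
      ∀ v, M.mulVec v = w • v → ∃ c : ℂ, v = c • y := by
  have key : ∀ v, (w • (1 : Matrix (Fin m) (Fin m) ℂ) - M).mulVec v = 0 ↔ M.mulVec v = w • v := by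
    intro v
    rw [Matrix.sub_mulVec, Matrix.smul_mulVec, Matrix.one_mulVec, sub_eq_zero, eq_comm]
  obtain ⟨y, f, h1, h2, h3, h4, h5⟩ := exists_adjugate_eq_vecMulVec
    (by rw [← eval_charpoly_eq_det, hw]) hJ
  exact ⟨y, f, h1, h2, h3, (key y).1 h4, fun v hv => h5 v ((key v).2 hv)⟩

/-- Proportionality of the rows and columns of the rank-one matrix `cof M w`. -/
lemma cof_apply_mul_apply (hw : M.charpoly.eval w = 0) (a b x y : Fin m) :
    cof M w x y * cof M w a b = cof M w x b * cof M w a y := by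
  by_cases hJ : cof M w = 0
  · simp [hJ]
  obtain ⟨u, f, -, -, h, -, -⟩ := exists_cof_eq_vecMulVec hw hJ
  simp only [h, Matrix.vecMulVec_apply]
  ring

lemma cof_mul_mul_cof (hw : M.charpoly.eval w = 0) (X : Matrix (Fin m) (Fin m) ℂ) :
    cof M w * X * cof M w = (X * cof M w).trace • cof M w := by
  by_cases hJ : cof M w = 0
  · simp [hJ]
  obtain ⟨u, f, -, -, h, -, -⟩ := exists_cof_eq_vecMulVec hw hJ
  rw [h]
  ext a b
  simp only [Matrix.mul_apply, Matrix.vecMulVec_apply, Matrix.smul_apply, Matrix.trace,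
    Matrix.diag_apply, smul_eq_mul, Finset.sum_mul]
  rw [Finset.sum_comm]
  refine Finset.sum_congr rfl fun i _ => Finset.sum_congr rfl fun j _ => ?_
  ring

lemma cof_mulVec_eq_zero_of_mem_range (hw : M.charpoly.eval w = 0) {v : Fin m → ℂ}
    (hv : v ∈ LinearMap.range (M - w • (1 : Matrix (Fin m) (Fin m) ℂ)).mulVecLin) :
    (cof M w).mulVec v = 0 := by
  obtain ⟨u, rfl⟩ := hv
  rw [Matrix.mulVecLin_apply, Matrix.mulVec_mulVec, cof_mul_sub hw, Matrix.zero_mulVec]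

lemma mem_range_iff_cof_mulVec_eq_zero (hw : M.charpoly.eval w = 0) (hJ : cof M w ≠ 0)
    (v : Fin m → ℂ) :
    v ∈ LinearMap.range (M - w • (1 : Matrix (Fin m) (Fin m) ℂ)).mulVecLin
      ↔ (cof M w).mulVec v = 0 := by
  refine ⟨cof_mulVec_eq_zero_of_mem_range hw, fun hv => ?_⟩
  obtain ⟨y, f, hy, hf, h, hMy, hker⟩ := exists_cof_eq_vecMulVec hw hJ
  set A := (M - w • (1 : Matrix (Fin m) (Fin m) ℂ)).mulVecLin
  have hle : LinearMap.range A ≤ LinearMap.ker (cof M w).mulVecLin := fun u hu =>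
    cof_mulVec_eq_zero_of_mem_range hw hu
  have h1 : Module.finrank ℂ (LinearMap.ker A) = 1 := by
    refine finrank_eq_one (⟨y, ?_⟩ : LinearMap.ker A) ?_ ?_
    · simp [A, hMy]
    · simpa using hy
    · rintro ⟨u, hu⟩
      have : M.mulVec u = w • u := by
        simpa [A, Matrix.sub_mulVec, Matrix.smul_mulVec, sub_eq_zero] using hu
      obtain ⟨c, hc⟩ := hker u this
      exact ⟨c, by ext1; exact hc.symm⟩
  have h2 : Module.finrank ℂ (LinearMap.range (cof M w).mulVecLin) ≠ 0 := by
    intro h0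
    have h3 : (cof M w).mulVecLin = 0 :=
      LinearMap.range_eq_bot.1 (Submodule.finrank_eq_zero.1 h0)
    apply hJ
    ext a b
    have := congrFun (LinearMap.congr_fun h3 (Pi.single b 1)) a
    simpa using this
  have h3 := LinearMap.finrank_range_add_finrank_ker A
  have h4 := LinearMap.finrank_range_add_finrank_ker (cof M w).mulVecLin
  have heq := Submodule.eq_of_le_of_finrank_le hle (by omega)
  rw [heq]
  exact hv

/-- The residue identity: the cofactor matrices, divided by the derivative of the characteristic
polynomial, sum to the identity when the eigenvalues are distinct. -/
lemma sum_inv_derivative_smul_cof (hs : M.charpoly.Separable) :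
    ∑ v ∈ M.charpoly.roots.toFinset, (M.charpoly.derivative.eval v)⁻¹ • cof M v = 1 := by
  rcases Nat.eq_zero_or_pos m with rfl | hm
  · exact Subsingleton.elim _ _
  set P := M.charpoly
  have hPm : P.Monic := M.charpoly_monic
  have hdeg : P.natDegree = m := M.charpoly_natDegree_eq_dim.trans (Fintype.card_fin m)
  have hcard : P.roots.toFinset.card = m := by
    rw [Multiset.toFinset_card_of_nodup (nodup_roots hs),
      ← (IsAlgClosed.splits P).natDegree_eq_card_roots, hdeg]
  have hroot : ∀ v ∈ P.roots.toFinset, P.eval v = 0 := fun v hv => by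
    simpa [hPm.ne_zero] using hv
  have hder : ∀ v, P.eval v = 0 → P.derivative.eval v ≠ 0 := fun v hv h =>
    hs.eval₂_derivative_ne_zero (RingHom.id ℂ) (x := v)
      (by simpa [eval₂_id] using hv) (by simpa [eval₂_id] using h)
  have hfac : ∀ v, P.eval v = 0 → (X - C v) * (P /ₘ (X - C v)) = P := fun v hv =>
    mul_divByMonic_eq_iff_isRoot.2 hv
  have hQ : ∑ v ∈ P.roots.toFinset, C (P.derivative.eval v)⁻¹ * (P /ₘ (X - C v)) = 1 := by
    refine eq_of_degree_sub_lt_of_eval_finset_eq P.roots.toFinset ?_ fun u hu => ?_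
    · rw [hcard]
      refine (degree_sub_le _ _).trans_lt (max_lt ?_ ?_)
      · refine (degree_sum_le _ _).trans_lt ?_
        rw [Finset.sup_lt_iff (WithBot.bot_lt_coe _)]
        intro v hv
        rw [degree_C_mul (inv_ne_zero (hder v (hroot v hv)))]
        rw [← hdeg, ← degree_eq_natDegree hPm.ne_zero]
        exact degree_divByMonic_lt _ _ hPm.ne_zero (by rw [degree_X_sub_C]; exact zero_lt_one)
      · rw [degree_one]
        exact_mod_cast hm
    · rw [eval_finsetSum, Finset.sum_eq_single u]
      · have h1 := congrArg (fun q => (derivative q).eval u) (hfac u (hroot u hu))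
        simp only [derivative_mul, derivative_sub, derivative_X, derivative_C, eval_add, eval_mul,
          eval_sub, eval_X, eval_C, sub_self, zero_mul, add_zero, sub_zero, one_mul] at h1
        rw [eval_mul, eval_C, h1, eval_one, inv_mul_cancel₀ (hder u (hroot u hu))]
      · intro v hv hvu
        have h1 := congrArg (eval u) (hfac v (hroot v hv))
        rw [hroot u hu, eval_mul, eval_sub, eval_X, eval_C] at h1
        rw [eval_mul, (mul_eq_zero.1 h1).resolve_left (sub_ne_zero.2 hvu.symm), mul_zero]
      · intro h
        exact absurd hu h
  have := congrArg (aeval M) hQ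
  simp only [map_sum, map_mul, aeval_C, map_one] at this
  rw [← this]
  refine Finset.sum_congr rfl fun v _ => ?_
  rw [cof_eq_aeval, Algebra.algebraMap_eq_smul_one, Matrix.smul_mul, Matrix.one_mul]

/-- The derivative of the determinant vanishes where the adjugate does. -/
lemma hasDerivAt_det_zero {N : ℝ → Matrix (Fin m) (Fin m) ℂ} {N' : Matrix (Fin m) (Fin m) ℂ}
    {t : ℝ} (h : ∀ a b, HasDerivAt (fun x => N x a b) (N' a b) t) (ha : (N t).adjugate = 0) :
    HasDerivAt (fun x => (N x).det) 0 t := by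
  simp only [Matrix.det_apply]
  have h1 : HasDerivAt (fun x => ∑ σ : Equiv.Perm (Fin m),
      Equiv.Perm.sign σ • ∏ i, N x (σ i) i) _ t :=
    HasDerivAt.fun_sum fun σ _ =>
      (HasDerivAt.fun_finsetProd fun i _ => h (σ i) i).const_smul (Equiv.Perm.sign σ)
  convert! h1 using 1
  have h2 : ∀ i, ((N t).updateCol i fun a => N' a i).det = 0 := by
    intro i
    rw [← Matrix.cramer_apply, Matrix.cramer_eq_adjugate_mulVec, ha]
    simp
  rw [← Finset.sum_const_zero (s := (Finset.univ : Finset (Fin m)))]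
  simp only [Finset.smul_sum]
  rw [Finset.sum_comm]
  refine Finset.sum_congr rfl fun i _ => ?_
  rw [← h2 i, Matrix.det_apply]
  refine Finset.sum_congr rfl fun σ _ => ?_
  rw [← Finset.prod_erase_mul _ _ (Finset.mem_univ i)]
  congr 2
  · refine Finset.prod_congr rfl fun j hj => ?_
    rw [Matrix.updateCol_ne (Finset.ne_of_mem_erase hj)]
  · rw [Matrix.updateCol_self]

/-- The kernel of an intertwiner `R` is invariant under `M`.  If it is not zero, it contains an
eigenvector of `M`, and this spans the image of a cofactor matrix. -/
lemma exists_mul_cof_eq_zero {M N R : Matrix (Fin m) (Fin m) ℂ} (h : R * M = N * R)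
    (hreg : ∀ w, M.charpoly.eval w = 0 → cof M w ≠ 0) (hR : ¬ IsUnit R) :
    ∃ w, M.charpoly.eval w = 0 ∧ R * cof M w = 0 := by
  have hdet : R.det = 0 := by
    by_contra h0
    exact hR ((Matrix.isUnit_iff_isUnit_det _).2 (isUnit_iff_ne_zero.2 h0))
  obtain ⟨v, hv0, hv⟩ := Matrix.exists_mulVec_eq_zero_iff.2 hdet
  set K := LinearMap.ker R.mulVecLin
  have hK : ∀ u ∈ K, M.mulVecLin u ∈ K := by
    intro u hu
    simp only [K, LinearMap.mem_ker, Matrix.mulVecLin_apply] at hu ⊢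
    rw [Matrix.mulVec_mulVec, h, ← Matrix.mulVec_mulVec, hu, Matrix.mulVec_zero]
  have : Nontrivial K := ⟨⟨⟨v, hv⟩, 0, fun h0 => hv0 (congrArg Subtype.val h0)⟩⟩
  obtain ⟨w, hw⟩ := Module.End.exists_eigenvalue (M.mulVecLin.restrict hK)
  obtain ⟨⟨u, huK⟩, hu⟩ := hw.exists_hasEigenvector
  have hu0 : u ≠ 0 := fun h0 => hu.2 (Subtype.ext h0)
  have hMu : M.mulVec u = w • u := congrArg Subtype.val hu.apply_eq_smul
  have hroot : M.charpoly.eval w = 0 := by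
    rw [eval_charpoly_eq_det]
    refine Matrix.exists_mulVec_eq_zero_iff.1 ⟨u, hu0, ?_⟩
    rw [Matrix.sub_mulVec, Matrix.smul_mulVec, Matrix.one_mulVec, hMu, sub_self]
  refine ⟨w, hroot, ?_⟩
  obtain ⟨y, f, hy, hf, hJ, hMy, hker⟩ := exists_cof_eq_vecMulVec hroot (hreg w hroot)
  obtain ⟨c, hc⟩ := hker u hMu
  have hc0 : c ≠ 0 := fun h0 => hu0 (by rw [hc, h0, zero_smul])
  have hRy : R.mulVec y = 0 := by
    have : R.mulVec u = 0 := huK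
    rw [hc, Matrix.mulVec_smul] at this
    exact (smul_eq_zero.1 this).resolve_left hc0
  rw [hJ, Matrix.mul_vecMulVec, hRy]
  ext a b
  simp [Matrix.vecMulVec_apply]

end LinearAlgebra

/-! ### Spectral curves -/

section Curve

variable {m : ℕ} (p : SpectralPoly m)

/-- The function `p(w, z)` in the chart `i`. -/
def SpectralPoly.fn (i : Bool) (x : ℂ × ℂ) : ℂ := (p.poly i x.2).eval x.1

/-- The part of the spectral curve in the chart `i`. -/
def SpectralPoly.curve (i : Bool) : Set (ℂ × ℂ) := {x | p.fn i x = 0}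

/-- The coordinate change from the chart `i` of `𝒪(2)` to the chart `!i`, away from `z = 0`. -/
def chartChange (x : ℂ × ℂ) : ℂ × ℂ := (-(x.2 ^ 2)⁻¹ * x.1, x.2⁻¹)

variable {p}

lemma SpectralPoly.fn_eq (i : Bool) (x : ℂ × ℂ) :
    p.fn i x = x.1 ^ m + ∑ k : Fin m, p.coeffAt i k x.2 * x.1 ^ (m - 1 - k.val) := by
  simp [SpectralPoly.fn, SpectralPoly.poly, eval_finsetSum]

lemma SpectralPoly.contDiff_coeffAt (i : Bool) (k : Fin m) : ContDiff ℂ 1 (p.coeffAt i k) := by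
  have h : ∀ q : ℂ[X], ContDiff ℂ 1 fun z => q.eval z := fun q => by
    simpa [coe_aeval_eq_eval] using q.contDiff_aeval (𝕜 := ℂ) 1
  cases i
  · exact h (p.a k)
  · exact contDiff_const.mul (h ((p.a k).reflect (2 * (k.val + 1))))

lemma SpectralPoly.contDiff_fn (i : Bool) : ContDiff ℂ 1 (p.fn i) := by
  have h : p.fn i = fun x => x.1 ^ m + ∑ k : Fin m, p.coeffAt i k x.2 * x.1 ^ (m - 1 - k.val) :=
    funext (p.fn_eq i)
  rw [h]
  have := fun k => (p.contDiff_coeffAt i k)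
  fun_prop

lemma SpectralPoly.continuous_fn (i : Bool) : Continuous (p.fn i) := (p.contDiff_fn i).continuous

lemma SpectralPoly.monic_poly (i : Bool) (z : ℂ) : (p.poly i z).Monic := by
  refine monic_X_pow_add ((degree_sum_le _ _).trans_lt ?_)
  rw [Finset.sup_lt_iff (WithBot.bot_lt_coe _)]
  intro k _
  refine (degree_C_mul_X_pow_le _ _).trans_lt ?_
  have := k.isLt
  exact_mod_cast (by omega : m - 1 - k.val < m)

lemma SpectralPoly.natDegree_poly (i : Bool) (z : ℂ) : (p.poly i z).natDegree = m := by
  refine natDegree_eq_of_degree_eq_some ?_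
  rw [SpectralPoly.poly, degree_add_eq_left_of_degree_lt, degree_X_pow]
  rw [degree_X_pow]
  refine (degree_sum_le _ _).trans_lt ?_
  rw [Finset.sup_lt_iff (WithBot.bot_lt_coe _)]
  intro k _
  refine (degree_C_mul_X_pow_le _ _).trans_lt ?_
  have := k.isLt
  exact_mod_cast (by omega : m - 1 - k.val < m)

lemma SpectralPoly.differentiable_coeff_poly (i : Bool) (j : ℕ) :
    Differentiable ℂ fun z => (p.poly i z).coeff j := by
  have h : (fun z => (p.poly i z).coeff j) = fun z =>
      (X ^ m : ℂ[X]).coeff j + ∑ k : Fin m,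
        p.coeffAt i k z * (X ^ (m - 1 - k.val) : ℂ[X]).coeff j := by
    funext z
    simp only [SpectralPoly.poly, coeff_add, finsetSum_coeff, coeff_C_mul]
  rw [h]
  have := fun k => (p.contDiff_coeffAt i k).differentiable one_ne_zero
  fun_prop

lemma SpectralPoly.coeffAt_inv (i : Bool) (k : Fin m) {z : ℂ} (hz : z ≠ 0) :
    p.coeffAt (!i) k z⁻¹ = (-(z ^ 2)⁻¹) ^ (k.val + 1) * p.coeffAt i k z := by
  have key : ∀ x : ℂ, x ≠ 0 → p.coeffAt true k x⁻¹
      = (-(x ^ 2)⁻¹) ^ (k.val + 1) * p.coeffAt false k x := by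
    intro x hx
    let _ := invertibleOfNonzero hx
    have h := eval₂_reflect_mul_pow (RingHom.id ℂ) x (2 * (k.val + 1)) (p.a k) (p.deg k)
    rw [invOf_eq_inv] at h
    simp only [SpectralPoly.coeffAt, eval, ← h]
    rw [neg_pow ((x ^ 2)⁻¹), inv_pow, ← pow_mul]
    field_simp
  cases i
  · exact key z hz
  · have := key z⁻¹ (inv_ne_zero hz)
    rw [inv_inv] at this
    rw [this, ← mul_assoc, ← mul_pow, Bool.not_true]
    have h1 : -(z ^ 2)⁻¹ * -((z⁻¹) ^ 2)⁻¹ = 1 := by field_simp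
    rw [h1, one_pow, one_mul]

lemma SpectralPoly.eval_poly_inv (i : Bool) (w : ℂ) {z : ℂ} (hz : z ≠ 0) :
    (p.poly (!i) z⁻¹).eval (-(z ^ 2)⁻¹ * w) = (-(z ^ 2)⁻¹) ^ m * (p.poly i z).eval w := by
  have h1 := p.fn_eq (!i) (-(z ^ 2)⁻¹ * w, z⁻¹)
  have h2 := p.fn_eq i (w, z)
  simp only [SpectralPoly.fn] at h1 h2
  rw [h1, h2, mul_add, mul_pow, Finset.mul_sum]
  congr 1
  refine Finset.sum_congr rfl fun k _ => ?_
  rw [p.coeffAt_inv i k hz, mul_pow]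
  have hk : m = (k.val + 1) + (m - 1 - k.val) := by have := k.isLt; omega
  conv_rhs => rw [show (-(z ^ 2)⁻¹) ^ m = (-(z ^ 2)⁻¹) ^ ((k.val + 1) + (m - 1 - k.val)) by
    rw [← hk]]
  rw [pow_add]
  ring

lemma SpectralPoly.comp_poly_inv (i : Bool) {z : ℂ} (hz : z ≠ 0) :
    (p.poly (!i) z⁻¹).comp (C (-(z ^ 2)⁻¹) * X) = C ((-(z ^ 2)⁻¹) ^ m) * p.poly i z := by
  refine Polynomial.funext fun w => ?_
  simpa using p.eval_poly_inv i w hz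

lemma chartChange_chartChange {x : ℂ × ℂ} (hx : x.2 ≠ 0) : chartChange (chartChange x) = x := by
  obtain ⟨w, z⟩ := x
  simp only [chartChange] at hx ⊢
  ext
  · simp only
    field_simp
  · simp

lemma chartChange_mem_curve {i : Bool} {x : ℂ × ℂ} (hz : x.2 ≠ 0) :
    chartChange x ∈ p.curve (!i) ↔ x ∈ p.curve i := by
  simp only [SpectralPoly.curve, Set.mem_ofPred_eq, SpectralPoly.fn, chartChange]
  rw [p.eval_poly_inv i x.1 hz]
  simp [hz]

lemma continuousAt_chartChange {x : ℂ × ℂ} (hx : x.2 ≠ 0) : ContinuousAt chartChange x := by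
  unfold chartChange
  have : x.2 ^ 2 ≠ 0 := pow_ne_zero 2 hx
  fun_prop (disch := assumption)

lemma tendsto_chartChange {i : Bool} {x : ℂ × ℂ} (hx : x.2 ≠ 0) :
    Tendsto chartChange (𝓝[p.curve i] x) (𝓝[p.curve (!i)] (chartChange x)) := by
  refine tendsto_nhdsWithin_iff.2 ⟨(continuousAt_chartChange hx).mono_left nhdsWithin_le_nhds, ?_⟩
  have : ∀ᶠ y : ℂ × ℂ in 𝓝 x, y.2 ≠ 0 := continuous_snd.continuousAt.eventually_ne hx
  filter_upwards [self_mem_nhdsWithin, nhdsWithin_le_nhds this] with y hy hy0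
  exact (chartChange_mem_curve hy0).2 hy

/-- The points of the spectral curve over a disc form a compact set. -/
lemma SpectralPoly.isCompact_curve_inter (i : Bool) (z₀ : ℂ) (r : ℝ) :
    IsCompact (p.curve i ∩ {x | x.2 ∈ Metric.closedBall z₀ r}) := by
  set c : ℂ → ℝ := fun z => ∑ k : Fin m, ‖p.coeffAt i k z‖ with hc
  have hcc : Continuous c :=
    continuous_finsetSum _ fun k _ => (p.contDiff_coeffAt i k).continuous.norm
  obtain ⟨B, hB⟩ := (isCompact_closedBall z₀ r).bddAbove_image hcc.continuousOn
  have hsub : p.curve i ∩ {x | x.2 ∈ Metric.closedBall z₀ r}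
      ⊆ Metric.closedBall (0 : ℂ) (max 1 B) ×ˢ Metric.closedBall z₀ r := by
    rintro ⟨w, z⟩ ⟨h1, h2⟩
    refine ⟨?_, h2⟩
    rw [mem_closedBall_zero_iff]
    by_contra hw
    rw [not_le, max_lt_iff] at hw
    have hcB : c z ≤ B := hB ⟨z, h2, rfl⟩
    simp only [SpectralPoly.curve, Set.mem_ofPred_eq, p.fn_eq] at h1
    have hm : m ≠ 0 := by
      rintro rfl
      simp at h1
    have h3 : ‖w‖ ^ m ≤ c z * ‖w‖ ^ (m - 1) := by
      rw [← norm_pow, eq_neg_of_add_eq_zero_left h1, norm_neg, hc, Finset.sum_mul]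
      refine (norm_sum_le _ _).trans (Finset.sum_le_sum fun k _ => ?_)
      rw [norm_mul, norm_pow]
      refine mul_le_mul_of_nonneg_left ?_ (norm_nonneg _)
      exact pow_le_pow_right₀ hw.1.le (by omega)
    have h4 : ‖w‖ ^ m = ‖w‖ * ‖w‖ ^ (m - 1) := by
      rw [← pow_succ', Nat.sub_add_cancel (Nat.pos_of_ne_zero hm)]
    rw [h4] at h3
    have := le_of_mul_le_mul_right h3 (pow_pos (zero_lt_one.trans hw.1) _)
    linarith [hw.2]
  refine IsCompact.of_isClosed_subset ((isCompact_closedBall _ _).prod (isCompact_closedBall _ _))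
    ?_ hsub
  exact (isClosed_singleton.preimage (p.continuous_fn i)).inter
    (Metric.isClosed_closedBall.preimage continuous_snd)

/-- A subset of a compact set that accumulates nowhere is finite. -/
lemma finite_inter_of_isolated {Y : Type*} [TopologicalSpace Y] {K T : Set Y} (hK : IsCompact K)
    (h : ∀ x ∈ K, ∀ᶠ y in 𝓝[≠] x, y ∈ K → y ∉ T) : (K ∩ T).Finite := by
  rw [Set.inter_comm]
  refine hK.induction_on (p := fun s => (T ∩ (s ∩ K)).Finite) (by simp) ?_ ?_ ?_ |>.subset ?_
  · intro s t hst ht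
    exact ht.subset fun x hx => ⟨hx.1, hst hx.2.1, hx.2.2⟩
  · intro s t hs ht
    rw [Set.union_inter_distrib_right, Set.inter_union_distrib_left]
    exact hs.union ht
  · intro x hx
    have h1 : {y | y ≠ x → y ∈ K → y ∉ T} ∈ 𝓝 x := eventually_nhdsWithin_iff.1 (h x hx)
    refine ⟨_, mem_nhdsWithin_of_mem_nhds h1, (Set.finite_singleton x).subset ?_⟩
    rintro y ⟨hyT, hy, hyK⟩
    by_contra hne
    exact hy hne hyK hyT
  · rintro x ⟨hxT, hxK⟩
    exact ⟨hxT, hxK, hxK⟩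

/-- The implicit function theorem for a function on `ℂ × ℂ`. -/
lemma exists_implicit {G : ℂ × ℂ → ℂ} (hG : ContDiff ℂ 1 G) {x y : ℂ} (h0 : G (x, y) = 0)
    (hy : deriv (fun t => G (x, t)) y ≠ 0) :
    ∃ f : ℂ → ℂ, ∃ r : ℝ, 0 < r ∧ DifferentiableOn ℂ f (Metric.ball x r) ∧ f x = y ∧
      (∀ t ∈ Metric.ball x r, G (t, f t) = 0) ∧
      ∀ᶠ v in 𝓝 (x, y), G v = 0 → v.2 = f v.1 := by
  have hc : ContDiffAt ℂ 1 G (x, y) := hG.contDiffAt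
  have hd : deriv (fun t => G (x, t)) y = fderiv ℂ G (x, y) (0, 1) := by
    have h1 : HasDerivAt (fun t : ℂ => ((x, t) : ℂ × ℂ)) (0, 1) y :=
      (hasDerivAt_const y x).prodMk (hasDerivAt_id y)
    exact ((hG.differentiable one_ne_zero (x, y)).hasFDerivAt.comp_hasDerivAt y h1).deriv
  have hinv : (fderiv ℂ G (x, y) ∘L .inr ℂ ℂ ℂ).IsInvertible := by
    rw [hd] at hy
    refine ⟨ContinuousLinearEquiv.unitsEquivAut ℂ (Units.mk0 _ hy), ?_⟩
    ext
    simp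
  set f := hc.implicitFunction one_ne_zero hinv
  have e1 := hc.eventually_apply_implicitFunction one_ne_zero hinv
  have e2 : ∀ᶠ t in 𝓝 x, DifferentiableAt ℂ f t :=
    ((hc.contDiffAt_implicitFunction one_ne_zero hinv).eventually (by simp)).mono
      fun t ht => ht.differentiableAt one_ne_zero
  obtain ⟨r, hr, hball⟩ := Metric.eventually_nhds_iff_ball.1 (e1.and e2)
  refine ⟨f, r, hr, fun t ht => (hball t ht).2.differentiableWithinAt,
    hc.implicitFunction_apply_self one_ne_zero hinv, fun t ht => (hball t ht).1.trans h0, ?_⟩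
  filter_upwards [hc.eventually_apply_eq_iff_implicitFunction one_ne_zero hinv] with v hv h
  exact (hv.1 (h.trans h0.symm)).symm

lemma SpectralPoly.deriv_fn_fst (i : Bool) (w z : ℂ) :
    deriv (fun t => p.fn i (t, z)) w = (p.poly i z).derivative.eval w :=
  (p.poly i z).deriv (x := w)

/-- The point of the curve with parameter `τ`. -/
def SpectralPoly.LocalParam.pt {i : Bool} (γ : p.LocalParam i) (τ : ℂ) : ℂ × ℂ := (γ.w τ, γ.z τ)

/-- The parametrization covers a neighbourhood of its centre in the curve, and its parameter is
bounded by the distance to the centre.  The bound ensures that points near the centre have small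
parameters, so `cover` need not ask for `τ` in the disc of the parametrization. -/
structure SpectralPoly.LocalParam.IsCoordinate {i : Bool} (γ : p.LocalParam i) : Prop where
  norm_le : ∀ τ, ‖τ‖ ≤ ‖γ.pt τ - γ.pt 0‖
  cover : ∀ᶠ x in 𝓝 (γ.pt 0), x ∈ p.curve i → ∃ τ, γ.pt τ = x

variable {i : Bool}

/-- One of the two coordinates of `ℂ × ℂ` is a local coordinate of a smooth curve. -/
lemma SpectralPoly.exists_localParam (hp : p.Smooth) {w z : ℂ} (h : p.OnCurve i w z) :
    ∃ γ : p.LocalParam i, γ.w 0 = w ∧ γ.z 0 = z ∧ γ.IsCoordinate := by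
  have hshift : ∀ (c : ℂ) (r : ℝ) (τ : ℂ), τ ∈ Metric.ball (0 : ℂ) r → c + τ ∈ Metric.ball c r := by
    intro c r τ hτ
    simpa using hτ
  by_cases hw : (p.poly i z).derivative.eval w = 0
  · have hz : deriv (fun x => (p.poly i x).eval w) z ≠ 0 := fun h0 => hp i w z h ⟨hw, h0⟩
    obtain ⟨f, r, hr, hfd, hf0, hfc, hcov⟩ := exists_implicit (p.contDiff_fn i) h hz
    refine ⟨⟨fun τ => w + τ, fun τ => f (w + τ), r, hr, by fun_prop,
      hfd.comp (by fun_prop) (fun τ hτ => hshift w r τ hτ),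
      fun τ hτ => hfc _ (hshift w r τ hτ), ?_⟩,
      by simp, by simp [hf0], ?_, ?_⟩
    · rintro τ - ⟨h1, -⟩
      simp at h1
    · intro τ
      refine le_trans (le_of_eq ?_) (norm_fst_le _)
      simp [SpectralPoly.LocalParam.pt]
    · simp only [SpectralPoly.LocalParam.pt, add_zero, hf0]
      filter_upwards [hcov] with x hx hxc
      refine ⟨x.1 - w, ?_⟩
      simp only [add_sub_cancel]
      rw [← hx hxc]
  · have hw' : deriv (fun t => p.fn i (t, z)) w ≠ 0 := by
      rwa [p.deriv_fn_fst]
    obtain ⟨f, r, hr, hfd, hf0, hfc, hcov⟩ := exists_implicit (G := fun x => p.fn i (x.2, x.1))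
      ((p.contDiff_fn i).comp (contDiff_snd.prodMk contDiff_fst)) h hw'
    refine ⟨⟨fun τ => f (z + τ), fun τ => z + τ, r, hr,
      hfd.comp (by fun_prop) (fun τ hτ => hshift z r τ hτ), by fun_prop,
      fun τ hτ => hfc _ (hshift z r τ hτ), ?_⟩, by simp [hf0], by simp, ?_, ?_⟩
    · rintro τ - ⟨-, h1⟩
      simp at h1
    · intro τ
      refine le_trans (le_of_eq ?_) (norm_snd_le _)
      simp [SpectralPoly.LocalParam.pt]
    · simp only [SpectralPoly.LocalParam.pt, add_zero, hf0]
      have hsw : Tendsto (Prod.swap : ℂ × ℂ → ℂ × ℂ) (𝓝 (w, z)) (𝓝 (z, w)) :=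
        continuous_swap.tendsto (w, z)
      filter_upwards [hsw.eventually hcov] with x hx hxc
      refine ⟨x.2 - z, ?_⟩
      simp only [add_sub_cancel]
      rw [← Prod.fst_swap, ← hx hxc]
      simp

namespace SpectralPoly.LocalParam

variable (γ : p.LocalParam i)

lemma ball_mem : Metric.ball (0 : ℂ) γ.r ∈ 𝓝 (0 : ℂ) := Metric.ball_mem_nhds 0 γ.r_pos

lemma differentiableAt_w {τ : ℂ} (hτ : τ ∈ Metric.ball (0 : ℂ) γ.r) : DifferentiableAt ℂ γ.w τ :=
  γ.w_hol.differentiableAt (Metric.isOpen_ball.mem_nhds hτ)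

lemma differentiableAt_z {τ : ℂ} (hτ : τ ∈ Metric.ball (0 : ℂ) γ.r) : DifferentiableAt ℂ γ.z τ :=
  γ.z_hol.differentiableAt (Metric.isOpen_ball.mem_nhds hτ)

lemma zero_mem : (0 : ℂ) ∈ Metric.ball (0 : ℂ) γ.r := Metric.mem_ball_self γ.r_pos

lemma differentiableAt_pt : DifferentiableAt ℂ γ.pt 0 :=
  (γ.differentiableAt_w γ.zero_mem).prodMk (γ.differentiableAt_z γ.zero_mem)

lemma tendsto_pt : Tendsto γ.pt (𝓝 0) (𝓝[p.curve i] (γ.pt 0)) := by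
  refine tendsto_nhdsWithin_iff.2 ⟨γ.differentiableAt_pt.continuousAt, ?_⟩
  filter_upwards [γ.ball_mem] with τ hτ using γ.onCurve τ hτ

variable {γ}

lemma IsCoordinate.map_nhds (hγ : γ.IsCoordinate) :
    map γ.pt (𝓝 0) = 𝓝[p.curve i] (γ.pt 0) := by
  refine le_antisymm γ.tendsto_pt fun s hs => ?_
  obtain ⟨ε, hε, hball⟩ := Metric.mem_nhds_iff.1 (mem_map.1 hs)
  refine mem_nhdsWithin_iff_eventually.2 ?_
  filter_upwards [hγ.cover, Metric.ball_mem_nhds _ hε] with x hx hxε hxc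
  obtain ⟨τ, rfl⟩ := hx hxc
  refine hball ?_
  rw [mem_ball_zero_iff]
  refine (hγ.norm_le τ).trans_lt ?_
  rwa [Metric.mem_ball, dist_eq_norm] at hxε

lemma IsCoordinate.pt_eq_iff (hγ : γ.IsCoordinate) {τ : ℂ} : γ.pt τ = γ.pt 0 ↔ τ = 0 := by
  refine ⟨fun h => ?_, fun h => by rw [h]⟩
  have := hγ.norm_le τ
  rwa [h, sub_self, norm_zero, norm_le_zero_iff] at this

lemma IsCoordinate.map_nhdsNE (hγ : γ.IsCoordinate) :
    map γ.pt (𝓝[≠] 0) = 𝓝[p.curve i \ {γ.pt 0}] (γ.pt 0) := by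
  have h1 : ({0}ᶜ : Set ℂ) = γ.pt ⁻¹' {γ.pt 0}ᶜ := by
    ext τ
    simp [hγ.pt_eq_iff]
  rw [Set.sdiff_eq, nhdsWithin_inter', ← hγ.map_nhds, nhdsWithin, h1, ← comap_principal,
    Filter.push_pull]

lemma IsCoordinate.isTheta (hγ : γ.IsCoordinate) :
    (fun τ => γ.pt τ - γ.pt 0) =Θ[𝓝 0] (fun τ : ℂ => τ) := by
  constructor
  · simpa using γ.differentiableAt_pt.isBigO_sub
  · exact Asymptotics.isBigO_of_le _ hγ.norm_le

variable (γ)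

lemma eventually_z_ne : ∀ᶠ τ in 𝓝[≠] (0 : ℂ), γ.z τ ≠ γ.z 0 := by
  have hzan : AnalyticAt ℂ γ.z 0 := γ.z_hol.analyticAt γ.ball_mem
  rcases hzan.eventually_eq_or_eventually_ne analyticAt_const with h | h
  · exfalso
    have hz0 : deriv γ.z 0 = 0 := by
      rw [Filter.EventuallyEq.deriv_eq h, deriv_const]
    have hw0 : deriv γ.w 0 ≠ 0 := fun h0 => γ.immersed 0 γ.zero_mem ⟨h0, hz0⟩
    have hwd := (γ.differentiableAt_w γ.zero_mem)
    have h1 : ∀ᶠ τ in 𝓝[≠] (0 : ℂ), γ.w τ ≠ γ.w 0 := hwd.hasDerivAt.eventually_ne hw0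
    set P := p.poly i (γ.z 0)
    have hfin : (((P.rootSet ℂ) \ {γ.w 0})ᶜ : Set ℂ) ∈ 𝓝 (γ.w 0) :=
      ((P.rootSet_finite ℂ).subset Set.sdiff_subset).isClosed.isOpen_compl.mem_nhds (by simp)
    have h2 : ∀ᶠ τ in 𝓝[≠] (0 : ℂ), False := by
      filter_upwards [h1, nhdsWithin_le_nhds (hwd.continuousAt.eventually hfin),
        nhdsWithin_le_nhds h, nhdsWithin_le_nhds γ.ball_mem] with τ a1 a2 a3 a4
      have := γ.onCurve τ a4
      rw [SpectralPoly.OnCurve, a3] at this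
      refine a2 ⟨?_, a1⟩
      rw [mem_rootSet]
      exact ⟨(p.monic_poly i _).ne_zero, by simpa [P] using this⟩
    exact h2.exists.choose_spec
  · exact h

/-- Ramification points of the projection to the line are isolated. -/
lemma eventually_derivative_ne (hp : p.Smooth) :
    ∀ᶠ τ in 𝓝[≠] (0 : ℂ), (p.poly i (γ.z τ)).derivative.eval (γ.w τ) ≠ 0 := by
  have hfd : Differentiable ℂ (p.fn i) := (p.contDiff_fn i).differentiable one_ne_zero
  have hpart : ∀ x : ℂ × ℂ, ∀ a b : ℂ, fderiv ℂ (p.fn i) x (a, b)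
      = a * (p.poly i x.2).derivative.eval x.1
        + b * deriv (fun t => (p.poly i t).eval x.1) x.2 := by
    rintro ⟨w, z⟩ a b
    have h1 : HasDerivAt (fun t : ℂ => ((t, z) : ℂ × ℂ)) (1, 0) w :=
      (hasDerivAt_id w).prodMk (hasDerivAt_const w z)
    have h2 : HasDerivAt (fun t : ℂ => ((w, t) : ℂ × ℂ)) (0, 1) z :=
      (hasDerivAt_const z w).prodMk (hasDerivAt_id z)
    have e1 := ((hfd (w, z)).hasFDerivAt.comp_hasDerivAt w h1).deriv
    have e2 := ((hfd (w, z)).hasFDerivAt.comp_hasDerivAt z h2).deriv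
    have e3 : ((a, b) : ℂ × ℂ) = a • (1, 0) + b • (0, 1) := by simp
    rw [e3, map_add, map_smul, map_smul, ← e1, ← e2, smul_eq_mul, smul_eq_mul]
    congr 2
    exact p.deriv_fn_fst i w z
  have han : AnalyticAt ℂ (fun τ => (p.poly i (γ.z τ)).derivative.eval (γ.w τ)) 0 := by
    have h1 : (fun τ => (p.poly i (γ.z τ)).derivative.eval (γ.w τ)) = fun τ =>
        ∑ j ∈ Finset.range (m + 1), (p.poly i (γ.z τ)).coeff j * (j * γ.w τ ^ (j - 1)) := by
      funext τ
      rw [derivative_eval, sum_over_range' _ (by simp) (m + 1)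
        (by rw [p.natDegree_poly]; omega)]
      exact Finset.sum_congr rfl fun j _ => by ring
    rw [h1]
    have : DifferentiableOn ℂ (fun τ => ∑ j ∈ Finset.range (m + 1),
        (p.poly i (γ.z τ)).coeff j * (j * γ.w τ ^ (j - 1))) (Metric.ball 0 γ.r) := by
      refine DifferentiableOn.fun_sum fun j _ => DifferentiableOn.mul ?_ ?_
      · exact (p.differentiable_coeff_poly i j).comp_differentiableOn γ.z_hol
      · exact (γ.w_hol.pow _).const_mul _
    exact this.analyticAt γ.ball_mem
  rcases han.eventually_eq_zero_or_eventually_ne_zero with h | h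
  · exfalso
    -- if `∂p/∂w` vanishes along the parametrization, then `z` is constant along it
    obtain ⟨r, hr, hball⟩ := Metric.eventually_nhds_iff_ball.1 (h.and γ.ball_mem)
    have hderiv : ∀ τ ∈ Metric.ball (0 : ℂ) r, deriv γ.z τ = 0 := by
      intro τ hτ
      obtain ⟨h0, hτr⟩ := hball τ hτ
      have hcomp := (hfd (γ.pt τ)).hasFDerivAt.comp_hasDerivAt τ
        ((γ.differentiableAt_w hτr).hasDerivAt.prodMk (γ.differentiableAt_z hτr).hasDerivAt)
      have hzero : (fun t => p.fn i (γ.pt t)) =ᶠ[𝓝 τ] fun _ => 0 := by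
        filter_upwards [Metric.isOpen_ball.mem_nhds hτr] with t ht using γ.onCurve t ht
      have h1 := hcomp.unique ((hasDerivAt_const τ (0 : ℂ)).congr_of_eventuallyEq hzero)
      rw [hpart] at h1
      simp only [SpectralPoly.LocalParam.pt] at h1
      rw [h0, mul_zero, zero_add] at h1
      refine (mul_eq_zero.1 h1).resolve_right fun h2 => ?_
      exact hp i _ _ (γ.onCurve τ hτr) ⟨h0, h2⟩
    have hconst : ∀ τ ∈ Metric.ball (0 : ℂ) r, γ.z τ = γ.z 0 := by
      intro τ hτ
      refine Metric.isOpen_ball.is_const_of_deriv_eq_zero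
        (convex_ball (0 : ℂ) r).isPreconnected (fun t ht =>
          (γ.differentiableAt_z (hball t ht).2).differentiableWithinAt) hderiv hτ
          (Metric.mem_ball_self hr)
    have h2 : ∀ᶠ τ in 𝓝[≠] (0 : ℂ), False := by
      filter_upwards [γ.eventually_z_ne, nhdsWithin_le_nhds (Metric.ball_mem_nhds 0 hr)]
        with τ a1 a2 using a1 (hconst τ a2)
    exact h2.exists.choose_spec
  · exact h

end SpectralPoly.LocalParam

/-- All but a discrete set of fibres are unramified. -/
lemma SpectralPoly.eventually_separable (hp : p.Smooth) (i : Bool) (z₀ : ℂ) :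
    ∀ᶠ z in 𝓝[≠] z₀, (p.poly i z).Separable := by
  set T : Set (ℂ × ℂ) := {x | (p.poly i x.2).derivative.eval x.1 = 0}
  have hfin := finite_inter_of_isolated (T := T) (p.isCompact_curve_inter i z₀ 1) ?_
  · have h1 : ((Prod.snd '' ((p.curve i ∩ {x | x.2 ∈ Metric.closedBall z₀ 1}) ∩ T)) \ {z₀})ᶜ
        ∈ 𝓝 z₀ :=
      ((hfin.image _).subset Set.sdiff_subset).isClosed.isOpen_compl.mem_nhds (by simp)
    filter_upwards [nhdsWithin_le_nhds h1, self_mem_nhdsWithin,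
      nhdsWithin_le_nhds (Metric.closedBall_mem_nhds z₀ zero_lt_one)] with z a1 a2 a3
    rw [Polynomial.Separable, isCoprime_iff_aeval_ne_zero_of_isAlgClosed ℂ ℂ]
    intro w
    by_contra! hcon
    simp only [coe_aeval_eq_eval] at hcon
    exact a1 ⟨⟨(w, z), ⟨⟨hcon.1, a3⟩, hcon.2⟩, rfl⟩, a2⟩
  · rintro ⟨w, z⟩ ⟨hx, -⟩
    obtain ⟨γ, rfl, rfl, hγ⟩ := SpectralPoly.exists_localParam hp hx
    have h1 : ∀ᶠ y in 𝓝[p.curve i \ {γ.pt 0}] (γ.pt 0), y ∉ T := by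
      rw [← hγ.map_nhdsNE]
      exact γ.eventually_derivative_ne hp
    rw [eventually_nhdsWithin_iff] at h1 ⊢
    filter_upwards [h1] with y hy hne hyK
    exact hy ⟨hyK.1, hne⟩

lemma SpectralPoly.LocalParam.eventually_separable (hp : p.Smooth) (γ : p.LocalParam i) :
    ∀ᶠ τ in 𝓝[≠] (0 : ℂ), (p.poly i (γ.z τ)).Separable ∧ γ.z τ ≠ 0 := by
  have h0 : ∀ᶠ z in 𝓝[≠] (γ.z 0), z ≠ 0 := by
    by_cases h : γ.z 0 = 0
    · rw [h]
      exact self_mem_nhdsWithin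
    · exact nhdsWithin_le_nhds (continuousAt_id.eventually_ne h)
  have ht : Tendsto γ.z (𝓝[≠] 0) (𝓝[≠] (γ.z 0)) :=
    tendsto_nhdsWithin_iff.2 ⟨(γ.differentiableAt_z γ.zero_mem).continuousAt.mono_left
      nhdsWithin_le_nhds, γ.eventually_z_ne⟩
  exact ht.eventually ((p.eventually_separable hp i (γ.z 0)).and h0)

end Curve

/-! ### Connectedness of the spectral curve -/

/-- Liouville's theorem for bounded functions with isolated singularities. -/
lemma exists_eq_const_of_bounded {G : ℂ → ℂ} (hd : ∀ z₀, ∀ᶠ z in 𝓝[≠] z₀, DifferentiableAt ℂ G z)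
    {C : ℝ} (hC : ∀ z, ‖G z‖ ≤ C) : ∃ c, ∀ z, DifferentiableAt ℂ G z → G z = c := by
  set g : ℂ → ℂ := fun z => limUnder (𝓝[≠] z) G with hg
  have hG : ∀ z, DifferentiableAt ℂ G z → g z = G z := fun z hz =>
    (hz.continuousAt.tendsto.mono_left nhdsWithin_le_nhds).limUnder_eq
  have hgd : Differentiable ℂ g := by
    intro z₀
    obtain ⟨r, hr, hball⟩ := Metric.eventually_nhds_iff_ball.1 (eventually_nhdsWithin_iff.1 (hd z₀))
    have h1 : DifferentiableOn ℂ (Function.update G z₀ (limUnder (𝓝[≠] z₀) G))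
        (Metric.ball z₀ r) := by
      refine differentiableOn_update_limUnder_of_bddAbove (Metric.ball_mem_nhds z₀ hr)
        (fun z hz => (hball z hz.1 hz.2).differentiableWithinAt) ⟨C, ?_⟩
      rintro _ ⟨z, -, rfl⟩
      exact hC z
    refine (h1.differentiableAt (Metric.ball_mem_nhds z₀ hr)).congr_of_eventuallyEq ?_
    filter_upwards [Metric.ball_mem_nhds z₀ hr] with z hz
    by_cases h : z = z₀
    · subst h
      simp [hg]
    · rw [Function.update_of_ne h, hG z (hball z hz h)]
  have hgb : Bornology.IsBounded (Set.range g) := by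
    refine isBounded_iff_forall_norm_le.2 ⟨C, ?_⟩
    rintro _ ⟨z, rfl⟩
    have h1 : Tendsto (fun x => ‖g x‖) (𝓝[≠] z) (𝓝 ‖g z‖) :=
      (hgd z).continuousAt.norm.tendsto.mono_left nhdsWithin_le_nhds
    refine le_of_tendsto h1 ?_
    filter_upwards [hd z] with x hx
    rw [hG x hx]
    exact hC x
  exact ⟨g 0, fun z hz => by rw [← hG z hz, hgd.apply_eq_apply_of_bounded hgb z 0]⟩

section

variable {m : ℕ} {p : SpectralPoly m}

lemma SpectralPoly.mem_roots_iff {i : Bool} {w z : ℂ} :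
    w ∈ (p.poly i z).roots.toFinset ↔ (w, z) ∈ p.curve i := by
  simp [(p.monic_poly i z).ne_zero, SpectralPoly.curve, SpectralPoly.fn]

/-- A locally constant property of points of the curve separates the points of a fibre uniformly
over the unit disc. -/
lemma exists_gap {i : Bool} {Q : ℂ × ℂ → Prop}
    (hQ : ∀ x ∈ p.curve i, ∀ᶠ y in 𝓝[p.curve i] x, (Q y ↔ Q x)) :
    ∃ δ : ℝ, 0 < δ ∧ ∀ z : ℂ, ‖z‖ ≤ 1 → ∀ a b, (a, z) ∈ p.curve i → (b, z) ∈ p.curve i →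
      Q (a, z) → ¬ Q (b, z) → δ ≤ ‖a - b‖ := by
  set K := p.curve i ∩ {x | x.2 ∈ Metric.closedBall 0 1} with hKdef
  have hK : IsCompact K := p.isCompact_curve_inter i 0 1
  have hU : ∀ x : K, ∃ U : Set (ℂ × ℂ), IsOpen U ∧ x.1 ∈ U ∧ ∀ y ∈ U, y ∈ p.curve i →
      (Q y ↔ Q x.1) := by
    intro x
    obtain ⟨U, h1, h2, h3⟩ := eventually_nhds_iff.1 (eventually_nhdsWithin_iff.1 (hQ x.1 x.2.1))
    exact ⟨U, h2, h3, h1⟩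
  choose U hUo hUx hUQ using hU
  obtain ⟨δ, hδ, hδK⟩ := lebesgue_number_lemma_of_metric hK hUo
    (fun x hx => Set.mem_iUnion.2 ⟨⟨x, hx⟩, hUx ⟨x, hx⟩⟩)
  refine ⟨δ, hδ, fun z hz a b ha hb hQa hQb => ?_⟩
  by_contra hlt
  have haK : (a, z) ∈ K := ⟨ha, by simpa using hz⟩
  obtain ⟨x, hx⟩ := hδK (a, z) haK
  have h1 := (hUQ x _ (hx (Metric.mem_ball_self hδ)) ha).1 hQa
  refine hQb ((hUQ x _ (hx ?_) hb).2 h1)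
  rw [Metric.mem_ball, Prod.dist_eq, dist_self, dist_comm, dist_eq_norm]
  exact max_lt (not_le.1 hlt) hδ

open Classical in
/-- The points `w` of the fibre over `z` with the property `Q`. -/
def fibrePts (p : SpectralPoly m) (i : Bool) (Q : ℂ × ℂ → Prop) (z : ℂ) : Finset ℂ :=
  (p.poly i z).roots.toFinset.filter fun w => Q (w, z)

lemma fibrePts_subset {i : Bool} {Q : ℂ × ℂ → Prop} {z : ℂ} :
    fibrePts p i Q z ⊆ (p.poly i z).roots.toFinset := by
  classical exact Finset.filter_subset _ _

lemma mem_fibrePts {i : Bool} {Q : ℂ × ℂ → Prop} {z w : ℂ} :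
    w ∈ fibrePts p i Q z ↔ (w, z) ∈ p.curve i ∧ Q (w, z) := by
  simp only [fibrePts, Finset.mem_filter, p.mem_roots_iff]

open Classical in
/-- Near an unramified fibre, the fibre consists of the values of holomorphic functions, and these
respect every locally constant property. -/
lemma exists_sheets {i : Bool} {z₀ : ℂ} (hs : (p.poly i z₀).Separable) :
    ∃ f : ℂ → ℂ → ℂ, (∀ a ∈ (p.poly i z₀).roots.toFinset, DifferentiableAt ℂ (f a) z₀) ∧
      (∀ᶠ z in 𝓝 z₀, Set.InjOn (fun a => f a z) (p.poly i z₀).roots.toFinset) ∧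
      ∀ Q : ℂ × ℂ → Prop, (∀ x ∈ p.curve i, ∀ᶠ y in 𝓝[p.curve i] x, (Q y ↔ Q x)) →
        ∀ᶠ z in 𝓝 z₀, fibrePts p i Q z = (fibrePts p i Q z₀).image fun a => f a z := by
  set S := (p.poly i z₀).roots.toFinset
  have hcard : S.card = m := by
    rw [Multiset.toFinset_card_of_nodup (nodup_roots hs),
      ← (IsAlgClosed.splits _).natDegree_eq_card_roots, p.natDegree_poly]
  have hex : ∀ a, a ∈ S → ∃ f : ℂ → ℂ, DifferentiableAt ℂ f z₀ ∧ f z₀ = a ∧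
      ∀ᶠ z in 𝓝 z₀, (f z, z) ∈ p.curve i := by
    intro a ha
    have hac : (a, z₀) ∈ p.curve i := p.mem_roots_iff.1 ha
    have hd : (p.poly i z₀).derivative.eval a ≠ 0 := by
      have h := (isCoprime_iff_aeval_ne_zero_of_isAlgClosed ℂ ℂ _ _).1 hs a
      simp only [coe_aeval_eq_eval] at h
      exact h.resolve_left fun h0 => h0 hac
    rw [← p.deriv_fn_fst] at hd
    obtain ⟨g, r, hr, hgd, hg0, hgc, -⟩ := exists_implicit (G := fun x => p.fn i (x.2, x.1))
      ((p.contDiff_fn i).comp (contDiff_snd.prodMk contDiff_fst)) hac hd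
    refine ⟨g, hgd.differentiableAt (Metric.ball_mem_nhds _ hr), hg0, ?_⟩
    filter_upwards [Metric.ball_mem_nhds z₀ hr] with z hz using hgc z hz
  choose! f hfd hf0 hfc using hex
  have hinj : ∀ᶠ z in 𝓝 z₀, Set.InjOn (fun a => f a z) S := by
    have h1 : ∀ᶠ z in 𝓝 z₀, ∀ a ∈ S, ∀ b ∈ S, a ≠ b → f a z ≠ f b z := by
      refine (Filter.eventually_all_finset S).2 fun a ha =>
        (Filter.eventually_all_finset S).2 fun b hb => ?_
      by_cases hab : a = b
      · exact Eventually.of_forall fun z h => absurd hab h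
      · have h2 : f a z₀ ≠ f b z₀ := by rwa [hf0 a ha, hf0 b hb]
        have h3 := (hfd a ha).continuousAt.sub (hfd b hb).continuousAt
        filter_upwards [h3.eventually_ne (sub_ne_zero.2 h2)] with z hz _
        exact sub_ne_zero.1 hz
    filter_upwards [h1] with z hz a ha b hb hab
    by_contra hne
    exact hz a ha b hb hne hab
  refine ⟨f, hfd, hinj, fun Q hQ => ?_⟩
  have hcurve : ∀ᶠ z in 𝓝 z₀, ∀ a ∈ S, (f a z, z) ∈ p.curve i :=
    (Filter.eventually_all_finset S).2 fun a ha => hfc a ha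
  have hQf : ∀ᶠ z in 𝓝 z₀, ∀ a ∈ S, (Q (f a z, z) ↔ Q (a, z₀)) := by
    refine (Filter.eventually_all_finset S).2 fun a ha => ?_
    have ht : Tendsto (fun z => (f a z, z)) (𝓝 z₀) (𝓝[p.curve i] (a, z₀)) := by
      refine tendsto_nhdsWithin_iff.2 ⟨?_, hfc a ha⟩
      have h1 := (hfd a ha).continuousAt.tendsto
      rw [hf0 a ha] at h1
      exact h1.prodMk_nhds tendsto_id
    exact ht.eventually (hQ _ (p.mem_roots_iff.1 ha))
  filter_upwards [hinj, hcurve, hQf] with z h1 h2 h3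
  have himg : (p.poly i z).roots.toFinset = S.image fun a => f a z := by
    symm
    refine Finset.eq_of_subset_of_card_le ?_ ?_
    · intro w hw
      obtain ⟨a, ha, rfl⟩ := Finset.mem_image.1 hw
      exact p.mem_roots_iff.2 (h2 a ha)
    · rw [Finset.card_image_of_injOn h1, hcard]
      refine (Multiset.toFinset_card_le _).trans ((card_roots' _).trans ?_)
      rw [p.natDegree_poly]
  ext w
  simp only [fibrePts, himg, Finset.mem_filter, Finset.mem_image]
  constructor
  · rintro ⟨⟨a, ha, rfl⟩, hq⟩
    exact ⟨a, ⟨ha, (h3 a ha).1 hq⟩, rfl⟩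
  · rintro ⟨a, ⟨ha, hq⟩, rfl⟩
    exact ⟨⟨a, ha, rfl⟩, (h3 a ha).2 hq⟩

/-- A smooth spectral curve is connected.  If it were the disjoint union of two open and closed
parts, the product of `(a - b)⁻¹` over the pairs of points `a`, `b` of the two parts in the same
fibre would be a bounded holomorphic function on the plane; as `a - b` is a coordinate in `𝒪(2)`,
the product tends to zero at infinity, but it is never zero. -/
theorem SpectralPoly.curve_connected (hp : p.Smooth) {Q : Bool → ℂ × ℂ → Prop}
    (hQ : ∀ i, ∀ x ∈ p.curve i, ∀ᶠ y in 𝓝[p.curve i] x, (Q i y ↔ Q i x))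
    (hT : ∀ i, ∀ x ∈ p.curve i, x.2 ≠ 0 → (Q (!i) (chartChange x) ↔ Q i x))
    {i : Bool} {x : ℂ × ℂ} (hx : x ∈ p.curve i) (hQx : Q i x) :
    ∀ j, ∀ y ∈ p.curve j, Q j y := by
  intro j y hy
  by_contra hQy
  set A := fibrePts p false (Q false)
  set B := fibrePts p false fun v => ¬ Q false v
  have hQn : ∀ i, ∀ x ∈ p.curve i, ∀ᶠ y in 𝓝[p.curve i] x, (¬ Q i y ↔ ¬ Q i x) := fun i x hx =>
    (hQ i x hx).mono fun _ h => not_congr h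
  have hsep := p.eventually_separable hp false
  have hcard : ∀ z, A z ⊆ (p.poly false z).roots.toFinset ∧
      B z ⊆ (p.poly false z).roots.toFinset := fun z =>
    ⟨fibrePts_subset, fibrePts_subset⟩
  have hrootcard : ∀ z, (p.poly false z).roots.toFinset.card ≤ m := fun z => by
    refine (Multiset.toFinset_card_le _).trans ((card_roots' _).trans ?_)
    rw [p.natDegree_poly]
  -- both parts meet every unramified fibre in a constant number of points
  have hpos : ∀ Q' : Bool → ℂ × ℂ → Prop,
      (∀ i, ∀ x ∈ p.curve i, ∀ᶠ y in 𝓝[p.curve i] x, (Q' i y ↔ Q' i x)) →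
      (∀ i, ∀ x ∈ p.curve i, x.2 ≠ 0 → (Q' (!i) (chartChange x) ↔ Q' i x)) →
      ∀ i, ∀ x ∈ p.curve i, Q' i x → ∀ z, (p.poly false z).Separable →
        (fibrePts p false (Q' false) z).Nonempty := by
    intro Q' hQ' hT' i x hx hQx z hz
    set c : ℂ → ℂ := fun z => ((fibrePts p false (Q' false) z).card : ℂ)
    have hcd : ∀ z, (p.poly false z).Separable → DifferentiableAt ℂ c z := by
      intro z₀ hz₀
      obtain ⟨f, -, hinj, hf⟩ := exists_sheets hz₀
      have : c =ᶠ[𝓝 z₀] fun _ => c z₀ := by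
        filter_upwards [hinj, hf _ (hQ' false)] with z h1 h2
        simp only [c]
        rw [h2, Finset.card_image_of_injOn]
        exact h1.mono (Finset.coe_subset.2 fibrePts_subset)
      exact (differentiableAt_const _).congr_of_eventuallyEq this
    obtain ⟨c₀, hc₀⟩ := exists_eq_const_of_bounded (G := c) (C := m)
      (fun z₀ => (hsep z₀).mono hcd) fun z => by
        simp only [c, norm_natCast, Nat.cast_le]
        exact (Finset.card_le_card fibrePts_subset).trans (hrootcard z)
    -- there is a point with the property over some unramified point of the first chart
    have hpt : ∃ v ∈ p.curve false, Q' false v ∧ (p.poly false v.2).Separable := by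
      obtain ⟨γ, hw0, hz0, -⟩ := SpectralPoly.exists_localParam hp hx
      have hpt0 : γ.pt 0 = x := Prod.ext hw0 hz0
      have h1 := γ.tendsto_pt
      rw [hpt0] at h1
      have h2 : ∀ᶠ τ in 𝓝[≠] (0 : ℂ), γ.pt τ ∈ p.curve i ∧ Q' i (γ.pt τ) := by
        refine nhdsWithin_le_nhds (h1.eventually ((eventually_mem_nhdsWithin).and ?_))
        exact (hQ' i x hx).mono fun _ h => h.2 hQx
      obtain ⟨τ, ⟨h3, h4⟩, h5, h6⟩ := (h2.and (γ.eventually_separable hp)).exists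
      cases i
      · exact ⟨_, h3, h4, h5⟩
      · -- move to the first chart, near a point with `z ≠ 0`
        have h7 : chartChange (γ.pt τ) ∈ p.curve (!true) := (chartChange_mem_curve h6).2 h3
        obtain ⟨γ', hw1, hz1, -⟩ := SpectralPoly.exists_localParam hp h7
        have hpt1 : γ'.pt 0 = chartChange (γ.pt τ) := Prod.ext hw1 hz1
        have h8 := γ'.tendsto_pt
        rw [hpt1] at h8
        have h9 : ∀ᶠ t in 𝓝[≠] (0 : ℂ), γ'.pt t ∈ p.curve false ∧ Q' false (γ'.pt t) := by
          refine nhdsWithin_le_nhds (h8.eventually ((eventually_mem_nhdsWithin).and ?_))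
          exact (hQ' false _ h7).mono fun _ h => h.2 ((hT' true _ h3 h6).2 h4)
        obtain ⟨t, ⟨g3, g4⟩, g5, -⟩ := (h9.and (γ'.eventually_separable hp)).exists
        exact ⟨_, g3, g4, g5⟩
    obtain ⟨v, hv, hQv, hvs⟩ := hpt
    have e1 : c z = c v.2 := by rw [hc₀ z (hcd z hz), hc₀ v.2 (hcd v.2 hvs)]
    have e2 : (fibrePts p false (Q' false) z).card = (fibrePts p false (Q' false) v.2).card :=
      Nat.cast_injective (R := ℂ) e1
    rw [← Finset.card_pos, e2, Finset.card_pos]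
    exact ⟨v.1, mem_fibrePts.2 ⟨hv, hQv⟩⟩
  have hTn : ∀ i, ∀ x ∈ p.curve i, x.2 ≠ 0 → (¬ Q (!i) (chartChange x) ↔ ¬ Q i x) :=
    fun i x hx h => not_congr (hT i x hx h)
  have hA := hpos Q hQ hT i x hx hQx
  have hB := hpos (fun i v => ¬ Q i v) hQn hTn j y hy hQy
  set G : ℂ → ℂ := fun z => ∏ v ∈ A z ×ˢ B z, (v.1 - v.2)⁻¹ with hG
  have hne : ∀ z, ∀ v ∈ A z ×ˢ B z, v.1 - v.2 ≠ 0 := by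
    rintro z ⟨a, b⟩ hv h0
    obtain ⟨ha, hb⟩ := Finset.mem_product.1 hv
    have : a = b := sub_eq_zero.1 h0
    subst this
    exact (mem_fibrePts.1 hb).2 (mem_fibrePts.1 ha).2
  have hGd : ∀ z, (p.poly false z).Separable → DifferentiableAt ℂ G z := by
    classical
    intro z₀ hz₀
    obtain ⟨f, hfd, hinj, hf⟩ := exists_sheets hz₀
    have hself := hinj.self_of_nhds
    have : G =ᶠ[𝓝 z₀] fun z => ∏ v ∈ A z₀ ×ˢ B z₀, (f v.1 z - f v.2 z)⁻¹ := by
      filter_upwards [hinj, hf _ (hQ false), hf _ (hQn false)] with z h1 h2 h3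
      simp only [hG]
      rw [Finset.prod_product, Finset.prod_product]
      simp only [A, B]
      rw [h2, Finset.prod_image (h1.mono (Finset.coe_subset.2 (hcard z₀).1))]
      refine Finset.prod_congr rfl fun a _ => ?_
      rw [h3, Finset.prod_image (h1.mono (Finset.coe_subset.2 (hcard z₀).2))]
    refine DifferentiableAt.congr_of_eventuallyEq ?_ this
    refine DifferentiableAt.fun_finsetProd fun v hv => ?_
    obtain ⟨ha, hb⟩ := Finset.mem_product.1 hv
    refine ((hfd _ ((hcard z₀).1 ha)).sub (hfd _ ((hcard z₀).2 hb))).inv fun h0 => ?_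
    have := hself ((hcard z₀).1 ha) ((hcard z₀).2 hb) (sub_eq_zero.1 h0)
    exact hne z₀ v hv (sub_eq_zero.2 this)
  obtain ⟨δ₀, hδ₀, hgap₀⟩ := exists_gap (hQ false)
  obtain ⟨δ₁, hδ₁, hgap₁⟩ := exists_gap (hQ true)
  set C₀ := max 1 (max δ₀⁻¹ δ₁⁻¹)
  have hC1 : 1 ≤ C₀ := le_max_left _ _
  have hlarge : ∀ z : ℂ, 1 ≤ ‖z‖ → ∀ v ∈ A z ×ˢ B z, ‖(v.1 - v.2)⁻¹‖ ≤ C₀ * (‖z‖ ^ 2)⁻¹ := by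
    rintro z hz ⟨a, b⟩ hv
    obtain ⟨ha, hb⟩ := Finset.mem_product.1 hv
    obtain ⟨ha, hQa⟩ := mem_fibrePts.1 ha
    obtain ⟨hb, hQb⟩ := mem_fibrePts.1 hb
    have hz0 : z ≠ 0 := norm_pos_iff.1 (zero_lt_one.trans_le hz)
    have h1 := hgap₁ z⁻¹ (by rw [norm_inv]; exact inv_le_one_of_one_le₀ hz)
      (-(z ^ 2)⁻¹ * a) (-(z ^ 2)⁻¹ * b)
      ((chartChange_mem_curve (i := false) (x := (a, z)) hz0).2 ha)
      ((chartChange_mem_curve (i := false) (x := (b, z)) hz0).2 hb)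
      ((hT false (a, z) ha hz0).2 hQa) ((hTn false (b, z) hb hz0).2 hQb)
    rw [← mul_sub, norm_mul, norm_neg, norm_inv, norm_pow] at h1
    have h3 : 0 < ‖a - b‖ := norm_pos_iff.2 (hne z (a, b) hv)
    have h4 : 0 < ‖z‖ ^ 2 := by positivity
    have h5 : δ₁ * ‖z‖ ^ 2 ≤ ‖a - b‖ := by
      rwa [inv_mul_eq_div, le_div_iff₀ h4] at h1
    rw [norm_inv]
    calc ‖a - b‖⁻¹ ≤ (δ₁ * ‖z‖ ^ 2)⁻¹ := inv_anti₀ (by positivity) h5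
      _ = δ₁⁻¹ * (‖z‖ ^ 2)⁻¹ := mul_inv _ _
      _ ≤ C₀ * (‖z‖ ^ 2)⁻¹ := by
        gcongr
        exact (le_max_right _ _).trans (le_max_right _ _)
  have hall : ∀ z : ℂ, ∀ v ∈ A z ×ˢ B z, ‖(v.1 - v.2)⁻¹‖ ≤ C₀ := by
    rintro z ⟨a, b⟩ hv
    rcases le_total ‖z‖ 1 with hz | hz
    · obtain ⟨ha, hb⟩ := Finset.mem_product.1 hv
      obtain ⟨ha, hQa⟩ := mem_fibrePts.1 ha
      obtain ⟨hb, hQb⟩ := mem_fibrePts.1 hb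
      rw [norm_inv]
      exact (inv_anti₀ hδ₀ (hgap₀ z hz a b ha hb hQa hQb)).trans
        ((le_max_left _ _).trans (le_max_right _ _))
    · refine (hlarge z hz _ hv).trans (mul_le_of_le_one_right (by positivity) ?_)
      exact inv_le_one_of_one_le₀ (one_le_pow₀ hz)
  have hGb : ∀ z, ‖G z‖ ≤ C₀ ^ (m * m) := by
    intro z
    rw [hG]
    simp only [norm_prod]
    refine (Finset.prod_le_prod (fun _ _ => norm_nonneg _) (hall z)).trans ?_
    rw [Finset.prod_const, Finset.card_product]
    exact pow_le_pow_right₀ hC1 (Nat.mul_le_mul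
      ((Finset.card_le_card (hcard z).1).trans (hrootcard z))
      ((Finset.card_le_card (hcard z).2).trans (hrootcard z)))
  obtain ⟨c, hc⟩ := exists_eq_const_of_bounded (fun z₀ => (hsep z₀).mono hGd) hGb
  have hsmall : ∀ z : ℂ, (p.poly false z).Separable → 1 ≤ ‖z‖ → C₀ ≤ ‖z‖ ^ 2 →
      ‖c‖ ≤ C₀ * (‖z‖ ^ 2)⁻¹ := by
    intro z hz h1 h2
    rw [← hc z (hGd z hz), hG]
    simp only [norm_prod]
    have h4 : 0 < ‖z‖ ^ 2 := by positivity
    refine (Finset.prod_le_prod (fun _ _ => norm_nonneg _) (hlarge z h1)).trans ?_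
    rw [Finset.prod_const]
    refine pow_le_of_le_one (by positivity) ?_ ?_
    · rwa [← div_eq_mul_inv, div_le_one h4]
    · exact (Finset.card_pos.2 ((hA z hz).product (hB z hz))).ne'
  have hcne : c ≠ 0 := by
    obtain ⟨z, hz⟩ := (hsep 0).exists
    rw [← hc z (hGd z hz), hG]
    exact Finset.prod_ne_zero_iff.2 fun v hv => inv_ne_zero (hne z v hv)
  -- unramified points exist arbitrarily far out
  obtain ⟨R, hR1, hR2⟩ : ∃ R : ℝ, 1 ≤ R ∧ C₀ * (R ^ 2)⁻¹ < ‖c‖ ∧ C₀ ≤ R ^ 2 := by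
    have hcp : 0 < ‖c‖ := norm_pos_iff.2 hcne
    have ht : Tendsto (fun R : ℝ => C₀ * (R ^ 2)⁻¹) atTop (𝓝 (C₀ * 0)) :=
      (tendsto_inv_atTop_zero.comp (tendsto_pow_atTop two_ne_zero)).const_mul _
    rw [mul_zero] at ht
    obtain ⟨R, h1, h2, h3⟩ := ((eventually_ge_atTop (1 : ℝ)).and ((ht.eventually_lt_const hcp).and
      ((tendsto_pow_atTop two_ne_zero).eventually_ge_atTop C₀))).exists
    exact ⟨R, h1, h2, h3⟩
  obtain ⟨z, hz, hzR⟩ : ∃ z, (p.poly false z).Separable ∧ R < ‖z‖ := by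
    have h1 : ∀ᶠ z in 𝓝[≠] ((R + 1 : ℝ) : ℂ), R < ‖z‖ := by
      refine nhdsWithin_le_nhds (continuous_norm.continuousAt.eventually_const_lt ?_)
      change R < ‖((R + 1 : ℝ) : ℂ)‖
      rw [norm_real, Real.norm_of_nonneg (by linarith)]
      linarith
    exact ((hsep _).and h1).exists
  have h1 : R ^ 2 ≤ ‖z‖ ^ 2 := by gcongr
  have h2 := hsmall z hz (hR1.trans hzR.le) (hR2.2.trans h1)
  have h3 : C₀ * (‖z‖ ^ 2)⁻¹ ≤ C₀ * (R ^ 2)⁻¹ := by gcongr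
  linarith [hR2.1]

end

/-! ### One-sided inverses and smooth splittings -/

section OneSided

variable {k l : ℕ}

open scoped ComplexOrder in
lemma isUnit_conjTranspose_mul_self {M : Matrix (Fin k) (Fin l) ℂ}
    (h : Function.Injective M.mulVec) : IsUnit (M.conjTranspose * M) :=
  (Matrix.PosDef.conjTranspose_mul_self M h).isUnit

open scoped ComplexOrder in
lemma isUnit_mul_conjTranspose_self {M : Matrix (Fin k) (Fin l) ℂ}
    (h : Function.Surjective M.mulVec) : IsUnit (M * M.conjTranspose) := by
  refine (Matrix.PosDef.mul_conjTranspose_self M fun u v huv => ?_).isUnit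
  refine dotProduct_eq _ _ fun x => ?_
  obtain ⟨y, rfl⟩ := h x
  have huv' : Matrix.vecMul u M = Matrix.vecMul v M := huv
  rw [Matrix.dotProduct_mulVec, Matrix.dotProduct_mulVec, huv']

/-- A left inverse of an injective matrix, given by the standard hermitian metric. -/
def leftInv (M : Matrix (Fin k) (Fin l) ℂ) : Matrix (Fin l) (Fin k) ℂ :=
  (M.conjTranspose * M)⁻¹ * M.conjTranspose

/-- A right inverse of a surjective matrix, given by the standard hermitian metric. -/
def rightInv (M : Matrix (Fin k) (Fin l) ℂ) : Matrix (Fin l) (Fin k) ℂ :=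
  M.conjTranspose * (M * M.conjTranspose)⁻¹

lemma leftInv_mul {M : Matrix (Fin k) (Fin l) ℂ} (h : Function.Injective M.mulVec) :
    leftInv M * M = 1 := by
  rw [leftInv, Matrix.mul_assoc, Matrix.nonsing_inv_mul _
    ((Matrix.isUnit_iff_isUnit_det _).1 (isUnit_conjTranspose_mul_self h))]

lemma mul_rightInv {M : Matrix (Fin k) (Fin l) ℂ} (h : Function.Surjective M.mulVec) :
    M * rightInv M = 1 := by
  rw [rightInv, ← Matrix.mul_assoc, Matrix.mul_nonsing_inv _
    ((Matrix.isUnit_iff_isUnit_det _).1 (isUnit_mul_conjTranspose_self h))]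

lemma MSmoothOn.leftInv {M : ℂ → Matrix (Fin k) (Fin l) ℂ} {U : Set ℂ} (hM : MSmoothOn M U)
    (h : ∀ z ∈ U, Function.Injective (M z).mulVec) : MSmoothOn (fun z => leftInv (M z)) U :=
  ((hM.conjTranspose.mul hM).inv fun z hz => isUnit_conjTranspose_mul_self (h z hz)).mul
    hM.conjTranspose

lemma MSmoothOn.rightInv {M : ℂ → Matrix (Fin k) (Fin l) ℂ} {U : Set ℂ} (hM : MSmoothOn M U)
    (h : ∀ z ∈ U, Function.Surjective (M z).mulVec) : MSmoothOn (fun z => rightInv (M z)) U :=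
  hM.conjTranspose.mul
    ((hM.mul hM.conjTranspose).inv fun z hz => isUnit_mul_conjTranspose_self (h z hz))

lemma MSmoothOn.mdbar {M : ℂ → Matrix (Fin k) (Fin l) ℂ} (hM : MSmoothOn M Set.univ) :
    MSmoothOn (mdbar M) Set.univ := by
  intro a b
  have h : ContDiff ℝ ∞ (fun z => M z a b) := contDiffOn_univ.1 (hM a b)
  have h1 : ContDiff ℝ ∞ (fderiv ℝ fun z => M z a b) := h.fderiv_right (by simp)
  exact (contDiff_const.mul ((h1.clm_apply contDiff_const).add
    (contDiff_const.mul (h1.clm_apply contDiff_const)))).contDiffOn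

end OneSided

/-- A smooth cut-off function on the projective line: it equals one near `0` and zero near `∞`. -/
def cutoff (z : ℂ) : ℝ := Real.smoothTransition (2 / (1 + ‖z‖ ^ 2) - 1 / 2)

lemma contDiff_cutoff : ContDiff ℝ ∞ cutoff := by
  refine Real.smoothTransition.contDiff.comp
    (ContDiff.sub (contDiff_const.div ?_ ?_) contDiff_const)
  · exact contDiff_const.add (contDiff_norm_sq ℝ)
  · intro z
    positivity

lemma cutoff_inv {z : ℂ} (hz : z ≠ 0) : cutoff z⁻¹ = 1 - cutoff z := by
  have h : ∀ x, Real.smoothTransition (1 - x) = 1 - Real.smoothTransition x := fun x => by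
    have := (Real.smoothTransition.pos_denom x).ne'
    rw [Real.smoothTransition, Real.smoothTransition, sub_sub_cancel, add_comm, eq_sub_iff_add_eq,
      ← add_div, add_comm, div_self this]
  have hz' : ‖z‖ ≠ 0 := norm_ne_zero_iff.2 hz
  rw [cutoff, cutoff, ← h]
  congr 1
  rw [norm_inv]
  have h1 : 1 + ‖z‖ ^ 2 ≠ 0 := by positivity
  have h2 : 1 + (‖z‖⁻¹) ^ 2 ≠ 0 := by positivity
  field_simp
  ring

lemma cutoff_eventuallyEq_one : ∀ᶠ z in 𝓝 (0 : ℂ), cutoff z = 1 := by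
  filter_upwards [Metric.ball_mem_nhds (0 : ℂ) (by norm_num : (0 : ℝ) < 1 / 2)] with z hz
  refine Real.smoothTransition.one_of_one_le ?_
  have h1 : ‖z‖ < 1 / 2 := by simpa using hz
  have h2 : ‖z‖ ^ 2 ≤ 1 / 4 := by nlinarith [norm_nonneg z]
  rw [le_sub_iff_add_le, le_div_iff₀ (by positivity)]
  linarith

section Ext

variable {m : ℕ}

lemma CoHiggs.g_mul_g_inv {n : ℕ} (V : CoHiggs n) (i : Bool) {z : ℂ} (hz : z ≠ 0) :
    V.g i z * V.g (!i) z⁻¹ = 1 := by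
  have := V.g_inv (!i) z⁻¹ (inv_ne_zero hz)
  rwa [Bool.not_not, inv_inv] at this

/-- Smooth splittings exist: local splittings are glued by a partition of unity. -/
lemma Extension.nonempty_splitting (E : Extension m) : Nonempty E.Splitting := by
  set T : Bool → ℂ → Matrix (Fin (2 * m)) (Fin m) ℂ := fun i z => rightInv (E.q.mat i z) with hT
  have hTs : ∀ i, MSmoothOn (T i) Set.univ := fun i =>
    (E.q.smooth i).rightInv fun z _ => E.surj i z
  have hqT : ∀ i z, E.q.mat i z * T i z = 1 := fun i z => mul_rightInv (E.surj i z)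
  set T' : Bool → ℂ → Matrix (Fin (2 * m)) (Fin m) ℂ := fun i z =>
    E.V.g (!i) z⁻¹ * T (!i) z⁻¹ * E.W₂.g i z with hT'
  have hinv : ContDiffOn ℝ ∞ (fun z : ℂ => z⁻¹) {0}ᶜ := fun z hz =>
    (contDiffAt_inv ℝ hz).contDiffWithinAt
  have hmaps : Set.MapsTo (fun z : ℂ => z⁻¹) {0}ᶜ {0}ᶜ := fun z hz => inv_ne_zero hz
  have hT's : ∀ i, MSmoothOn (T' i) {0}ᶜ := fun i =>
    (((E.V.g_smooth (!i)).comp hinv hmaps).mul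
      ((hTs (!i)).comp hinv (Set.mapsTo_univ _ _))).mul (E.W₂.g_smooth i)
  have hqT' : ∀ i z, z ≠ 0 → E.q.mat i z * T' i z = 1 := by
    intro i z hz
    have h1 := E.q.glue (!i) z⁻¹ (inv_ne_zero hz)
    rw [Bool.not_not, inv_inv] at h1
    simp only [hT']
    rw [← Matrix.mul_assoc, ← Matrix.mul_assoc, h1, Matrix.mul_assoc (E.W₂.g (!i) z⁻¹), hqT,
      Matrix.mul_one, E.W₂.g_inv i z hz]
  refine ⟨⟨fun i z => (cutoff z : ℂ) • T i z + (1 - cutoff z : ℂ) • T' i z, ?_, ?_, ?_⟩⟩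
  · intro i a b
    have hc : ContDiff ℝ ∞ fun z => (cutoff z : ℂ) := ofRealCLM.contDiff.comp contDiff_cutoff
    rw [contDiffOn_univ, contDiff_iff_contDiffAt]
    intro z
    by_cases hz : z = 0
    · subst hz
      have h1 : ContDiffAt ℝ ∞ (fun z => T i z a b) 0 := (contDiffOn_univ.1 (hTs i a b)).contDiffAt
      refine h1.congr_of_eventuallyEq ?_
      filter_upwards [cutoff_eventuallyEq_one] with z hz
      simp [hz]
    · have hU : ({0}ᶜ : Set ℂ) ∈ 𝓝 z := isOpen_compl_singleton.mem_nhds hz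
      exact ((((hTs i).mono (Set.subset_univ _)).smul hc.contDiffOn).add
        ((hT's i).smul (contDiff_const.sub hc).contDiffOn) a b).contDiffAt hU
  · intro i z hz
    have e1 : T' (!i) z⁻¹ * E.W₂.g i z = E.V.g i z * T i z := by
      simp only [hT', Bool.not_not, inv_inv]
      rw [Matrix.mul_assoc, E.W₂.g_inv i z hz, Matrix.mul_one]
    have e2 : E.V.g i z * T' i z = T (!i) z⁻¹ * E.W₂.g i z := by
      simp only [hT']
      rw [← Matrix.mul_assoc, ← Matrix.mul_assoc, E.V.g_mul_g_inv i hz, Matrix.one_mul]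
    rw [cutoff_inv hz, Matrix.add_mul, Matrix.mul_add, Matrix.smul_mul, Matrix.smul_mul,
      Matrix.mul_smul, Matrix.mul_smul, e1, e2, add_comm]
    push_cast
    rw [sub_sub_cancel]
  · intro i z
    rw [Matrix.mul_add, Matrix.mul_smul, Matrix.mul_smul, hqT]
    by_cases hz : z = 0
    · subst hz
      rw [cutoff_eventuallyEq_one.self_of_nhds]
      simp
    · rw [hqT' i z hz, ← add_smul]
      simp

variable (E : Extension m)

lemma Extension.q_mul_ι (i : Bool) (z : ℂ) : E.q.mat i z * E.ι.mat i z = 0 := by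
  refine Matrix.ext_of_mulVec_single fun j => ?_
  rw [← Matrix.mulVec_mulVec, Matrix.zero_mulVec]
  exact (E.exact i z).apply_apply_eq_zero _

variable {E}

lemma Extension.leftInv_mul_ι (i : Bool) (z : ℂ) : leftInv (E.ι.mat i z) * E.ι.mat i z = 1 :=
  leftInv_mul (E.inj i z)

lemma Extension.ι_cancel {i : Bool} {z : ℂ} {k : ℕ} {X Y : Matrix (Fin m) (Fin k) ℂ}
    (h : E.ι.mat i z * X = E.ι.mat i z * Y) : X = Y := by
  have := congrArg (fun M => leftInv (E.ι.mat i z) * M) h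
  simpa only [← Matrix.mul_assoc, E.leftInv_mul_ι, Matrix.one_mul] using this

lemma Extension.q_cancel {i : Bool} {z : ℂ} {k : ℕ} {X Y : Matrix (Fin k) (Fin m) ℂ}
    (h : X * E.q.mat i z = Y * E.q.mat i z) : X = Y := by
  have := congrArg (fun M => M * rightInv (E.q.mat i z)) h
  simpa only [Matrix.mul_assoc, mul_rightInv (E.surj i z), Matrix.mul_one] using this

lemma Extension.ι_mul_leftInv_mul {i : Bool} {z : ℂ} {k : ℕ} {X : Matrix (Fin (2 * m)) (Fin k) ℂ}
    (h : E.q.mat i z * X = 0) : E.ι.mat i z * (leftInv (E.ι.mat i z) * X) = X := by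
  refine Matrix.ext_of_mulVec_single fun j => ?_
  have h1 : (E.q.mat i z).mulVec (X.mulVec (Pi.single j 1)) = 0 := by
    rw [Matrix.mulVec_mulVec, h, Matrix.zero_mulVec]
  obtain ⟨u, hu⟩ := (E.exact i z _).1 h1
  rw [← Matrix.mulVec_mulVec, ← Matrix.mulVec_mulVec, ← hu, Matrix.mulVec_mulVec u,
    E.leftInv_mul_ι, Matrix.one_mulVec]

/-! ### Off-diagonal terms of a splitting -/

lemma CoHiggs.Hom.cov_eq_zero {k l : ℕ} {V : CoHiggs k} {W : CoHiggs l} (f : V.Hom W) (i : Bool)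
    (z : ℂ) : cov (W.A i) (V.A i) (f.mat i) z = 0 := f.hol i z

lemma CoHiggs.cov_φ_eq_zero {n : ℕ} (V : CoHiggs n) (i : Bool) (z : ℂ) :
    cov (V.A i) (V.A i) (V.φ i) z = 0 := V.φ_hol i z

lemma MSmoothOn.mdiffAt_univ {k l : ℕ} {M : ℂ → Matrix (Fin k) (Fin l) ℂ}
    (h : MSmoothOn M Set.univ) (z : ℂ) : MDiffAt M z := h.mdiffAt univ_mem

variable (σ : E.Splitting)

/-- The off-diagonal term of the Higgs field in a splitting. -/
def Extension.Splitting.higgsTerm (i : Bool) (z : ℂ) : Matrix (Fin m) (Fin m) ℂ :=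
  leftInv (E.ι.mat i z) * (E.V.φ i z * σ.mat i z - σ.mat i z * E.W₂.φ i z)

/-- The off-diagonal term of the holomorphic structure in a splitting. -/
def Extension.Splitting.dbarTerm (i : Bool) (z : ℂ) : Matrix (Fin m) (Fin m) ℂ :=
  leftInv (E.ι.mat i z) * cov (E.V.A i) (E.W₂.A i) (σ.mat i) z

lemma Extension.Splitting.ι_mul_higgsTerm (i : Bool) (z : ℂ) :
    E.ι.mat i z * σ.higgsTerm i z = E.V.φ i z * σ.mat i z - σ.mat i z * E.W₂.φ i z := by
  refine E.ι_mul_leftInv_mul ?_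
  rw [Matrix.mul_sub, ← Matrix.mul_assoc, ← Matrix.mul_assoc, ← E.q.comm, Matrix.mul_assoc,
    σ.sect, Matrix.mul_one, Matrix.one_mul, sub_self]

lemma Extension.Splitting.ι_mul_dbarTerm (i : Bool) (z : ℂ) :
    E.ι.mat i z * σ.dbarTerm i z = cov (E.V.A i) (E.W₂.A i) (σ.mat i) z := by
  refine E.ι_mul_leftInv_mul ?_
  have h1 := cov_mul (A := E.W₂.A i) (B := E.V.A i) (C := E.W₂.A i)
    ((E.q.smooth i).mdiffAt_univ z) ((σ.smooth i).mdiffAt_univ z)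
  rw [E.q.cov_eq_zero, Matrix.zero_mul, zero_add] at h1
  rw [← h1]
  simp only [σ.sect]
  simp [cov, mdbar_const]

lemma Extension.leftInv_ι_smooth (i : Bool) :
    MSmoothOn (fun z => leftInv (E.ι.mat i z)) Set.univ :=
  (E.ι.smooth i).leftInv fun z _ => E.inj i z

lemma Extension.Splitting.higgsTerm_smooth (i : Bool) : MSmoothOn (σ.higgsTerm i) Set.univ :=
  (E.leftInv_ι_smooth i).mul (((E.V.φ_smooth i).mul (σ.smooth i)).sub
    ((σ.smooth i).mul (E.W₂.φ_smooth i)))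

lemma Extension.Splitting.dbarTerm_smooth (i : Bool) : MSmoothOn (σ.dbarTerm i) Set.univ :=
  (E.leftInv_ι_smooth i).mul ((σ.smooth i).mdbar.add
    (((E.V.A_smooth i).mul (σ.smooth i)).sub ((σ.smooth i).mul (E.W₂.A_smooth i))))

lemma Extension.Splitting.isHiggsTerm_higgsTerm : σ.IsHiggsTerm σ.higgsTerm := fun i =>
  ⟨σ.higgsTerm_smooth i, fun z => by rw [σ.ι_mul_higgsTerm, sub_add_cancel]⟩

lemma Extension.Splitting.isDbarTerm_dbarTerm : σ.IsDbarTerm σ.dbarTerm := fun i =>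
  ⟨σ.dbarTerm_smooth i, fun z => by rw [σ.ι_mul_dbarTerm, cov]; abel⟩

/-- The off-diagonal part of `∂̄ φ = 0`. -/
lemma Extension.Splitting.homDbar_higgsTerm_add (i : Bool) (z : ℂ) :
    E.homDbar i (σ.higgsTerm i) z + E.phi12 i z (σ.dbarTerm i z) = 0 := by
  have hι := (E.ι.smooth i).mdiffAt_univ z
  have hσ := (σ.smooth i).mdiffAt_univ z
  have hψ := (σ.higgsTerm_smooth i).mdiffAt_univ z
  have hφ := (E.V.φ_smooth i).mdiffAt_univ z
  have hφ₂ := (E.W₂.φ_smooth i).mdiffAt_univ z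
  have h1 : cov (E.V.A i) (E.W₂.A i) (fun x => E.V.φ i x * σ.mat i x) z
      = cov (E.V.A i) (E.W₂.A i)
        (fun x => E.ι.mat i x * σ.higgsTerm i x + σ.mat i x * E.W₂.φ i x) z := by
    refine cov_congr (Eventually.of_forall fun x => ?_)
    simp only [σ.ι_mul_higgsTerm, sub_add_cancel]
  rw [cov_add (hι.mul hψ) (hσ.mul hφ₂), cov_mul (B := E.V.A i) hφ hσ,
    cov_mul (B := E.W₁.A i) hι hψ, cov_mul (B := E.W₂.A i) hσ hφ₂, E.V.cov_φ_eq_zero,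
    E.W₂.cov_φ_eq_zero, E.ι.cov_eq_zero, ← σ.ι_mul_dbarTerm, ← Matrix.mul_assoc, E.ι.comm] at h1
  simp only [Matrix.zero_mul, Matrix.mul_zero, zero_add, add_zero, Matrix.mul_assoc,
    ← Matrix.mul_add] at h1
  have h2 := E.ι_cancel h1
  rw [Extension.phi12, h2]
  change cov (E.W₁.A i) (E.W₂.A i) (σ.higgsTerm i) z + _ = 0
  abel

/-! ### The map `p(φ)` and the section it induces -/

variable (E) in
/-- The map `W₂ → W₁` whose composition with the projection `V → W₂` and the inclusion `W₁ → V`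
is `p(φ)`. -/
def Extension.polyMap (p : SpectralPoly m) (i : Bool) (z : ℂ) : Matrix (Fin m) (Fin m) ℂ :=
  leftInv (E.ι.mat i z) * aeval (E.V.φ i z) (p.poly i z) * rightInv (E.q.mat i z)

variable {p : SpectralPoly m} (h₁ : E.W₁.HasSpectralPoly p) (h₂ : E.W₂.HasSpectralPoly p)

lemma CoHiggs.HasSpectralPoly.aeval_eq_zero {W : CoHiggs m} (h : W.HasSpectralPoly p) (i : Bool)
    (z : ℂ) : aeval (W.φ i z) (p.poly i z) = 0 := by
  rw [← h i z]
  exact Matrix.aeval_self_charpoly _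

include h₁ h₂ in
lemma Extension.ι_mul_polyMap_mul_q (i : Bool) (z : ℂ) :
    E.ι.mat i z * E.polyMap p i z * E.q.mat i z = aeval (E.V.φ i z) (p.poly i z) := by
  set P := aeval (E.V.φ i z) (p.poly i z)
  have h3 : P * E.ι.mat i z = 0 := by
    rw [← mul_aeval_eq_aeval_mul (E.ι.comm i z).symm, h₁.aeval_eq_zero, Matrix.mul_zero]
  have h4 : E.q.mat i z * P = 0 := by
    rw [mul_aeval_eq_aeval_mul (E.q.comm i z).symm, h₂.aeval_eq_zero, Matrix.zero_mul]
  have h5 : E.ι.mat i z * (leftInv (E.ι.mat i z) * (1 - rightInv (E.q.mat i z) * E.q.mat i z))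
      = 1 - rightInv (E.q.mat i z) * E.q.mat i z := by
    refine E.ι_mul_leftInv_mul ?_
    rw [Matrix.mul_sub, ← Matrix.mul_assoc, mul_rightInv (E.surj i z), Matrix.mul_one,
      Matrix.one_mul, sub_self]
  have h6 : P * (1 - rightInv (E.q.mat i z) * E.q.mat i z) = 0 := by
    rw [← h5, ← Matrix.mul_assoc, h3, Matrix.zero_mul]
  rw [Matrix.mul_sub, Matrix.mul_one, sub_eq_zero] at h6
  rw [Extension.polyMap, ← Matrix.mul_assoc, ← Matrix.mul_assoc, Matrix.mul_assoc (E.ι.mat i z),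
    E.ι_mul_leftInv_mul h4, Matrix.mul_assoc, ← h6]

lemma aeval_poly_eq_sum {n : ℕ} (M : Matrix (Fin n) (Fin n) ℂ) (i : Bool) (z : ℂ) :
    aeval M (p.poly i z) = ∑ j ∈ Finset.range (m + 1), (p.poly i z).coeff j • M ^ j :=
  aeval_eq_sum_range' (by rw [p.natDegree_poly]; omega) M

lemma CoHiggs.smooth_aeval {n : ℕ} (V : CoHiggs n) (i : Bool) :
    MSmoothOn (fun z => aeval (V.φ i z) (p.poly i z)) Set.univ := by
  simp only [aeval_poly_eq_sum]
  refine MSmoothOn.sum _ fun j _ => MSmoothOn.smul ?_ ((V.φ_smooth i).pow j)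
  exact ((p.differentiable_coeff_poly i j).contDiff.restrict_scalars ℝ).contDiffOn

lemma Extension.polyMap_smooth (i : Bool) : MSmoothOn (E.polyMap p i) Set.univ :=
  ((E.leftInv_ι_smooth i).mul (E.V.smooth_aeval i)).mul
    ((E.q.smooth i).rightInv fun z _ => E.surj i z)

include h₁ h₂ in
lemma Extension.polyMap_comm (i : Bool) (z : ℂ) :
    E.polyMap p i z * E.W₂.φ i z = E.W₁.φ i z * E.polyMap p i z := by
  refine E.ι_cancel (i := i) (z := z) (E.q_cancel (i := i) (z := z) ?_)
  have h := E.ι_mul_polyMap_mul_q h₁ h₂ i z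
  have hc : E.V.φ i z * aeval (E.V.φ i z) (p.poly i z)
      = aeval (E.V.φ i z) (p.poly i z) * E.V.φ i z :=
    mul_aeval_eq_aeval_mul (M := E.V.φ i z) (N := E.V.φ i z) (T := E.V.φ i z) rfl _
  rw [← h] at hc
  calc E.ι.mat i z * (E.polyMap p i z * E.W₂.φ i z) * E.q.mat i z
      = E.ι.mat i z * E.polyMap p i z * (E.W₂.φ i z * E.q.mat i z) := by
        simp only [Matrix.mul_assoc]
    _ = E.V.φ i z * (E.ι.mat i z * E.polyMap p i z * E.q.mat i z) := by
        rw [E.q.comm, ← Matrix.mul_assoc, hc]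
    _ = E.ι.mat i z * (E.W₁.φ i z * E.polyMap p i z) * E.q.mat i z := by
        rw [← Matrix.mul_assoc, ← Matrix.mul_assoc, E.ι.comm]
        simp only [Matrix.mul_assoc]

include h₁ h₂ in
/-- The map induced by `p(φ)` is holomorphic. -/
lemma Extension.cov_polyMap (i : Bool) (z : ℂ) :
    cov (E.W₁.A i) (E.W₂.A i) (E.polyMap p i) z = 0 := by
  have hι := (E.ι.smooth i).mdiffAt_univ z
  have hq := (E.q.smooth i).mdiffAt_univ z
  have hR := (E.polyMap_smooth (p := p) i).mdiffAt_univ z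
  have h1 : cov (E.V.A i) (E.V.A i) (fun x => aeval (E.V.φ i x) (p.poly i x)) z = 0 := by
    simp only [aeval_poly_eq_sum]
    exact cov_sum_smul_pow ((E.V.φ_smooth i).mdiffAt_univ z) (E.V.cov_φ_eq_zero i z) (m + 1)
      fun j => (p.differentiable_coeff_poly i j) z
  simp only [← E.ι_mul_polyMap_mul_q h₁ h₂] at h1
  rw [cov_mul (B := E.W₂.A i) (hι.mul hR) hq, cov_mul (B := E.W₁.A i) hι hR, E.ι.cov_eq_zero,
    E.q.cov_eq_zero, Matrix.zero_mul, zero_add, Matrix.mul_zero, add_zero] at h1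
  refine E.ι_cancel (i := i) (z := z) (E.q_cancel (i := i) (z := z) ?_)
  rw [h1, Matrix.mul_zero, Matrix.zero_mul]

lemma CoHiggs.aeval_glue {n : ℕ} (V : CoHiggs n) (i : Bool) {z : ℂ} (hz : z ≠ 0) :
    aeval (V.φ (!i) z⁻¹) (p.poly (!i) z⁻¹) * V.g i z
      = (-(z ^ 2)⁻¹) ^ m • (V.g i z * aeval (V.φ i z) (p.poly i z)) := by
  have h1 : V.g i z * ((-(z ^ 2)⁻¹) • V.φ i z) = V.φ (!i) z⁻¹ * V.g i z := by
    rw [V.φ_glue i z hz, Matrix.mul_smul]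
  rw [← mul_aeval_eq_aeval_mul h1]
  have h2 := congrArg (aeval (V.φ i z)) (p.comp_poly_inv i hz)
  rw [aeval_comp] at h2
  simp only [map_mul, aeval_C, aeval_X, Algebra.algebraMap_eq_smul_one, Matrix.smul_mul,
    Matrix.one_mul] at h2
  rw [h2, Matrix.mul_smul]

include h₁ h₂ in
lemma Extension.polyMap_glue (i : Bool) {z : ℂ} (hz : z ≠ 0) :
    E.polyMap p (!i) z⁻¹ * E.W₂.g i z
      = (-(z ^ 2)⁻¹) ^ m • (E.W₁.g i z * E.polyMap p i z) := by
  refine E.ι_cancel (i := !i) (z := z⁻¹) (E.q_cancel (i := i) (z := z) ?_)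
  have h := E.V.aeval_glue (p := p) i hz
  rw [← E.ι_mul_polyMap_mul_q h₁ h₂, ← E.ι_mul_polyMap_mul_q h₁ h₂] at h
  calc E.ι.mat (!i) z⁻¹ * (E.polyMap p (!i) z⁻¹ * E.W₂.g i z) * E.q.mat i z
      = E.ι.mat (!i) z⁻¹ * E.polyMap p (!i) z⁻¹ * E.q.mat (!i) z⁻¹ * E.V.g i z := by
        rw [Matrix.mul_assoc _ (E.q.mat (!i) z⁻¹), E.q.glue i z hz]
        simp only [Matrix.mul_assoc]
    _ = (-(z ^ 2)⁻¹) ^ m • (E.V.g i z * (E.ι.mat i z * E.polyMap p i z * E.q.mat i z)) := h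
    _ = _ := by
        rw [← Matrix.mul_assoc, ← Matrix.mul_assoc, ← E.ι.glue i z hz]
        simp only [Matrix.mul_assoc, Matrix.mul_smul, Matrix.smul_mul]

include h₁ h₂ in
/-- At a point of the spectral curve, `p(φ)` and the off-diagonal Higgs term agree up to cofactor
matrices: `p(φ) = q(φ) (φ - w)` with `q(φ₁)`, `q(φ₂)` the cofactor matrices. -/
lemma Extension.polyMap_mul_cof (i : Bool) {w z : ℂ} (hw : p.OnCurve i w z) :
    E.polyMap p i z * cof (E.W₂.φ i z) w
      = cof (E.W₁.φ i z) w * σ.higgsTerm i z * cof (E.W₂.φ i z) w := by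
  set Q := p.poly i z /ₘ (X - C w)
  have hroot : (p.poly i z).eval w = 0 := hw
  have e1 : cof (E.W₁.φ i z) w = aeval (E.W₁.φ i z) Q := by rw [cof_eq_aeval, h₁ i z]
  have hfac : aeval (E.V.φ i z) (p.poly i z)
      = aeval (E.V.φ i z) Q * (E.V.φ i z - w • (1 : Matrix (Fin (2 * m)) (Fin (2 * m)) ℂ)) := by
    conv_lhs => rw [← mul_divByMonic_eq_iff_isRoot.2 hroot, mul_comm (X - C w)]
    simp [Q, Algebra.algebraMap_eq_smul_one]
  have hσ : (E.V.φ i z - w • (1 : Matrix (Fin (2 * m)) (Fin (2 * m)) ℂ)) * σ.mat i z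
      = E.ι.mat i z * σ.higgsTerm i z
        + σ.mat i z * (E.W₂.φ i z - w • (1 : Matrix (Fin m) (Fin m) ℂ)) := by
    rw [σ.ι_mul_higgsTerm, Matrix.sub_mul, Matrix.mul_sub, Matrix.smul_mul, Matrix.mul_smul,
      Matrix.one_mul, Matrix.mul_one]
    abel
  refine E.ι_cancel (i := i) (z := z) ?_
  have h3 := E.ι_mul_polyMap_mul_q h₁ h₂ i z
  calc E.ι.mat i z * (E.polyMap p i z * cof (E.W₂.φ i z) w)
      = E.ι.mat i z * E.polyMap p i z * (E.q.mat i z * σ.mat i z) * cof (E.W₂.φ i z) w := by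
        rw [σ.sect, Matrix.mul_one, Matrix.mul_assoc]
    _ = aeval (E.V.φ i z) (p.poly i z) * σ.mat i z * cof (E.W₂.φ i z) w := by
        rw [← h3]
        simp only [Matrix.mul_assoc]
    _ = aeval (E.V.φ i z) Q * E.ι.mat i z * σ.higgsTerm i z * cof (E.W₂.φ i z) w := by
        rw [hfac, Matrix.mul_assoc _ _ (σ.mat i z), hσ, Matrix.mul_add, Matrix.add_mul,
          Matrix.mul_assoc _ (σ.mat i z * _), Matrix.mul_assoc (σ.mat i z),
          sub_mul_cof (by rw [h₂ i z]; exact hroot)]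
        simp only [Matrix.mul_zero, add_zero, Matrix.mul_assoc]
    _ = _ := by
        rw [← mul_aeval_eq_aeval_mul (E.ι.comm i z).symm, ← e1]
        simp only [Matrix.mul_assoc]

end Ext

/-! ### Regularity of Higgs fields with a smooth spectral curve -/

section Regular

variable {m : ℕ} {p : SpectralPoly m} {W : CoHiggs m} {i : Bool}

/-- A Higgs field with a smooth spectral curve is regular at every point of the curve: if the
cofactor matrix vanished, then so would both partial derivatives of `det (w - φ) = p`. -/
lemma CoHiggs.HasSpectralPoly.cof_ne_zero (hp : p.Smooth) (h : W.HasSpectralPoly p) {w z : ℂ}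
    (hw : p.OnCurve i w z) : cof (W.φ i z) w ≠ 0 := by
  intro hJ
  have hdet : ∀ x y : ℂ, (x • (1 : Matrix (Fin m) (Fin m) ℂ) - W.φ i y).det = p.fn i (x, y) := by
    intro x y
    rw [← eval_charpoly_eq_det, h i y, SpectralPoly.fn]
  refine hp i w z hw ⟨?_, ?_⟩
  · have h1 : HasDerivAt (fun t : ℝ => ((w + t) • (1 : Matrix (Fin m) (Fin m) ℂ) - W.φ i z).det)
        0 0 := by
      refine hasDerivAt_det_zero (N' := 1) (fun a b => ?_) (by simpa [cof] using hJ)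
      have h2 : HasDerivAt (fun t : ℂ => (w + t) * (1 : Matrix (Fin m) (Fin m) ℂ) a b - W.φ i z a b)
          (1 * (1 : Matrix (Fin m) (Fin m) ℂ) a b) ((0 : ℝ) : ℂ) :=
        (((hasDerivAt_id _).const_add w).mul_const _).sub_const _
      simpa using h2.comp_ofReal
    have h3 : HasDerivAt (fun t : ℂ => (p.poly i z).eval (w + t))
        ((p.poly i z).derivative.eval w) ((0 : ℝ) : ℂ) := by
      have h4 : HasDerivAt (fun t => (p.poly i z).eval t) _ (w + ((0 : ℝ) : ℂ)) :=
        (p.poly i z).hasDerivAt _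
      simpa using h4.comp_const_add w _
    refine h3.comp_ofReal.unique ?_
    simpa only [hdet, SpectralPoly.fn] using h1
  · have hφ := (W.φ_smooth i).mdiffAt_univ z
    have hline : HasDerivAt (fun t : ℝ => z + t) 1 0 := by
      simpa using ((hasDerivAt_id ((0 : ℝ) : ℂ)).const_add z).comp_ofReal
    have h1 : HasDerivAt (fun t : ℝ => (w • (1 : Matrix (Fin m) (Fin m) ℂ) - W.φ i (z + t)).det)
        0 0 := by
      refine hasDerivAt_det_zero
        (N' := Matrix.of fun a b => -(fderiv ℝ (fun x => W.φ i x a b) z 1)) (fun a b => ?_)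
        (by simpa [cof] using hJ)
      have h2 : HasFDerivAt (fun x => W.φ i x a b) (fderiv ℝ (fun x => W.φ i x a b) z)
          (z + ((0 : ℝ) : ℂ)) := by simpa using (hφ a b).hasFDerivAt
      exact (h2.comp_hasDerivAt (0 : ℝ) hline).const_sub _
    have h3 : HasDerivAt (fun t : ℂ => p.fn i (w, z + t))
        (deriv (fun x => (p.poly i x).eval w) z) ((0 : ℝ) : ℂ) := by
      have hd : Differentiable ℂ fun x => p.fn i (w, x) :=
        ((p.contDiff_fn i).differentiable one_ne_zero).comp
          ((differentiable_const w).prodMk differentiable_id)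
      have h4 : HasDerivAt (fun x => p.fn i (w, x)) (deriv (fun x => (p.poly i x).eval w) z)
          (z + ((0 : ℝ) : ℂ)) := by
        rw [ofReal_zero, add_zero]
        exact (hd z).hasDerivAt
      exact h4.comp_const_add z _
    refine h3.comp_ofReal.unique ?_
    simpa only [hdet] using h1

lemma CoHiggs.HasSpectralPoly.eval_charpoly (h : W.HasSpectralPoly p) {w z : ℂ}
    (hw : p.OnCurve i w z) : (W.φ i z).charpoly.eval w = 0 := by
  rw [h i z]
  exact hw

/-- On the curve, the cofactor matrix embeds the cokernel line into the fibre of the bundle. -/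
lemma CoHiggs.HasSpectralPoly.toCoker_eq_iff (hp : p.Smooth) (h : W.HasSpectralPoly p) {w z : ℂ}
    (hw : p.OnCurve i w z) {u v : Fin m → ℂ} :
    toCoker (W.φ i z) w u = toCoker (W.φ i z) w v
      ↔ (cof (W.φ i z) w).mulVec u = (cof (W.φ i z) w).mulVec v := by
  rw [Submodule.mkQ_apply, Submodule.mkQ_apply, Submodule.Quotient.eq,
    mem_range_iff_cof_mulVec_eq_zero (h.eval_charpoly hw) (h.cof_ne_zero hp hw),
    Matrix.mulVec_sub, sub_eq_zero]

lemma CoHiggs.HasSpectralPoly.subsingleton_coker (h : W.HasSpectralPoly p) {w z : ℂ}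
    (hw : ¬ p.OnCurve i w z) : Subsingleton (Coker (W.φ i z) w) := by
  refine Submodule.Quotient.subsingleton_iff.2 ?_
  rw [LinearMap.range_eq_top]
  have hu : IsUnit (W.φ i z - w • (1 : Matrix (Fin m) (Fin m) ℂ)) := by
    rw [← neg_sub, IsUnit.neg_iff, Matrix.isUnit_iff_isUnit_det, ← eval_charpoly_eq_det, h i z]
    exact isUnit_iff_ne_zero.2 hw
  exact Matrix.mulVec_surjective_iff_isUnit.2 hu

end Regular

/-! ### Sections of `L₁ L₂^*` along local parametrizations -/

section Frame

variable {m : ℕ} {p : SpectralPoly m} {E : Extension m} {i : Bool}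

open Classical in
variable (E) in
/-- The map of cokernels induced by a matrix if there is one, and zero otherwise. -/
def Extension.fibreOf (i : Bool) (w z : ℂ) (N : Matrix (Fin m) (Fin m) ℂ) : E.Fibre i w z :=
  if h : LinearMap.range (E.W₂.φ i z - w • (1 : Matrix (Fin m) (Fin m) ℂ)).mulVecLin
      ≤ (LinearMap.range (E.W₁.φ i z - w • (1 : Matrix (Fin m) (Fin m) ℂ)).mulVecLin).comap
        N.mulVecLin
  then Submodule.mapQ _ _ N.mulVecLin h else 0

lemma Extension.fibreOf_apply {w z : ℂ} {N X : Matrix (Fin m) (Fin m) ℂ}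
    (h : N * (E.W₂.φ i z - w • (1 : Matrix (Fin m) (Fin m) ℂ))
      = (E.W₁.φ i z - w • (1 : Matrix (Fin m) (Fin m) ℂ)) * X) (v : Fin m → ℂ) :
    E.fibreOf i w z N (toCoker _ _ v) = toCoker _ _ (N.mulVec v) := by
  rw [Extension.fibreOf, dif_pos]
  · rfl
  · rintro _ ⟨u, rfl⟩
    refine ⟨X.mulVec u, ?_⟩
    simp only [Matrix.mulVecLin_apply, Matrix.mulVec_mulVec, h]

variable (p) in
variable (E) in
/-- The section of `L₁ L₂^*(2m)` induced by `p(φ)`.  Off the curve its values lie in zero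
spaces. -/
def Extension.sec (i : Bool) (w z : ℂ) : E.Fibre i w z := E.fibreOf i w z (E.polyMap p i z)

lemma Extension.fibre_ext {w z : ℂ} {f g : E.Fibre i w z}
    (h : ∀ v, f (toCoker _ _ v) = g (toCoker _ _ v)) : f = g :=
  Submodule.linearMap_qext _ (LinearMap.ext h)

/-- The pull-back of the connection form along a local parametrization. -/
def CoHiggs.pullA {n : ℕ} (W : CoHiggs n) (γ : p.LocalParam i) (τ : ℂ) : Matrix (Fin n) (Fin n) ℂ :=
  starRingEnd ℂ (deriv γ.z τ) • W.A i (γ.z τ)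

/-- The cofactor matrix along a local parametrization. -/
def CoHiggs.pullCof (W : CoHiggs m) (γ : p.LocalParam i) (τ : ℂ) : Matrix (Fin m) (Fin m) ℂ :=
  cof (W.φ i (γ.z τ)) (γ.w τ)

lemma SpectralPoly.LocalParam.contDiffOn_z (γ : p.LocalParam i) :
    ContDiffOn ℝ ∞ γ.z (Metric.ball 0 γ.r) :=
  (γ.z_hol.contDiffOn Metric.isOpen_ball).restrict_scalars ℝ

lemma SpectralPoly.LocalParam.contDiffOn_w (γ : p.LocalParam i) :
    ContDiffOn ℝ ∞ γ.w (Metric.ball 0 γ.r) :=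
  (γ.w_hol.contDiffOn Metric.isOpen_ball).restrict_scalars ℝ

lemma MSmoothOn.pull {k l : ℕ} {M : ℂ → Matrix (Fin k) (Fin l) ℂ} (hM : MSmoothOn M Set.univ)
    (γ : p.LocalParam i) : MSmoothOn (fun τ => M (γ.z τ)) (Metric.ball 0 γ.r) :=
  hM.comp γ.contDiffOn_z (Set.mapsTo_univ _ _)

lemma CoHiggs.pullA_smooth {n : ℕ} (W : CoHiggs n) (γ : p.LocalParam i) :
    MSmoothOn (W.pullA γ) (Metric.ball 0 γ.r) := by
  refine MSmoothOn.smul ?_ ((W.A_smooth i).pull γ)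
  exact Complex.conjCLE.contDiff.comp_contDiffOn
    (((γ.z_hol.deriv Metric.isOpen_ball).contDiffOn Metric.isOpen_ball).restrict_scalars ℝ)

lemma CoHiggs.pullCof_smooth (W : CoHiggs m) (γ : p.LocalParam i) :
    MSmoothOn (W.pullCof γ) (Metric.ball 0 γ.r) :=
  ((MSmoothOn.smul γ.contDiffOn_w (msmoothOn_const 1 _)).sub
    ((W.φ_smooth i).pull γ)).adjugate

lemma MSmoothOn.mdiffAt_ball {k l : ℕ} {M : ℂ → Matrix (Fin k) (Fin l) ℂ} {ε : ℝ} {τ : ℂ}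
    (h : MSmoothOn M (Metric.ball 0 ε)) (hτ : τ ∈ Metric.ball (0 : ℂ) ε) : MDiffAt M τ :=
  h.mdiffAt (Metric.isOpen_ball.mem_nhds hτ)

lemma cov_pull {k l : ℕ} {V : CoHiggs k} {W : CoHiggs l} (γ : p.LocalParam i)
    {M : ℂ → Matrix (Fin k) (Fin l) ℂ} (hM : MSmoothOn M Set.univ) {τ : ℂ}
    (hτ : τ ∈ Metric.ball (0 : ℂ) γ.r) (h : cov (V.A i) (W.A i) M (γ.z τ) = 0) :
    cov (V.pullA γ) (W.pullA γ) (fun τ => M (γ.z τ)) τ = 0 := by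
  have := cov_comp (A := V.A i) (B := W.A i) (hM.mdiffAt_univ (γ.z τ)) (γ.differentiableAt_z hτ)
  rw [h, smul_zero] at this
  exact this

/-- The cofactor matrix is a holomorphic endomorphism along the curve. -/
lemma CoHiggs.HasSpectralPoly.cov_pullCof {W : CoHiggs m} (h : W.HasSpectralPoly p)
    (γ : p.LocalParam i) {τ : ℂ} (hτ : τ ∈ Metric.ball (0 : ℂ) γ.r) :
    cov (W.pullA γ) (W.pullA γ) (W.pullCof γ) τ = 0 := by
  have h1 : W.pullCof γ = fun τ => ∑ j ∈ Finset.range (m + 1),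
      (∑ k ∈ Finset.Icc (j + 1) m, γ.w τ ^ (k - (j + 1)) * (p.poly i (γ.z τ)).coeff k)
        • W.φ i (γ.z τ) ^ j := by
    funext t
    rw [CoHiggs.pullCof, cof_eq_aeval, h i (γ.z t), aeval_eq_sum_range' (n := m + 1)]
    · simp only [coeff_divByMonic_X_sub_C, p.natDegree_poly]
    · rw [natDegree_divByMonic _ (monic_X_sub_C _), p.natDegree_poly]
      omega
  rw [h1]
  refine cov_sum_smul_pow (((W.φ_smooth i).pull γ).mdiffAt_ball hτ)
    (cov_pull γ (W.φ_smooth i) hτ (W.cov_φ_eq_zero i _)) (m + 1) fun j => ?_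
  refine DifferentiableAt.fun_sum fun k _ => ?_
  exact ((γ.differentiableAt_w hτ).pow _).mul
    (((p.differentiable_coeff_poly i k) _).comp τ (γ.differentiableAt_z hτ))

/-- A section of `L₁ L₂^*` is holomorphic if and only if it is represented by a smooth map `N` for
which the composition of `N` with the embedding of `L₁` given by the cofactor matrix is
holomorphic. -/
lemma Extension.holAlong_iff (hp : p.Smooth) (h₁ : E.W₁.HasSpectralPoly p) (γ : p.LocalParam i)
    (f : ∀ τ : ℂ, E.Fibre i (γ.w τ) (γ.z τ)) :
    E.HolAlong γ f ↔ ∃ ε : ℝ, 0 < ε ∧ ε ≤ γ.r ∧ ∃ N : ℂ → Matrix (Fin m) (Fin m) ℂ,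
      MSmoothOn N (Metric.ball 0 ε) ∧ ∀ τ ∈ Metric.ball (0 : ℂ) ε,
        (∀ v, f τ (toCoker _ _ v) = toCoker _ _ ((N τ).mulVec v)) ∧
        cov (E.W₁.pullA γ) (E.W₂.pullA γ) (fun τ => E.W₁.pullCof γ τ * N τ) τ = 0 := by
  refine exists_congr fun ε => and_congr_right fun hε => and_congr_right fun hεr =>
    exists_congr fun N => and_congr_right fun hN => forall₂_congr fun τ hτ => ?_
  have hτr : τ ∈ Metric.ball (0 : ℂ) γ.r := Metric.ball_subset_ball hεr hτ
  have h3 : mdbar N τ + (starRingEnd ℂ (deriv γ.z τ)) •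
      (E.W₁.A i (γ.z τ) * N τ - N τ * E.W₂.A i (γ.z τ))
      = cov (E.W₁.pullA γ) (E.W₂.pullA γ) N τ := by
    simp only [cov, CoHiggs.pullA, smul_sub, Matrix.smul_mul, Matrix.mul_smul]
  rw [h3, cov_mul (B := E.W₁.pullA γ) ((E.W₁.pullCof_smooth γ).mdiffAt_ball hτr)
    (hN.mdiffAt_ball hτ), h₁.cov_pullCof γ hτr, Matrix.zero_mul, zero_add, forall_and]
  refine and_congr_right fun _ => ?_
  have h4 : ∀ u, toCoker (E.W₁.φ i (γ.z τ)) (γ.w τ) u = 0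
      ↔ (E.W₁.pullCof γ τ).mulVec u = 0 := by
    intro u
    rw [← map_zero (toCoker (E.W₁.φ i (γ.z τ)) (γ.w τ)), h₁.toCoker_eq_iff hp (γ.onCurve τ hτr),
      Matrix.mulVec_zero]
    rfl
  simp only [h4, Matrix.mulVec_mulVec]
  constructor
  · intro h
    exact Matrix.ext_of_mulVec_single fun j => by rw [h, Matrix.zero_mulVec]
  · intro h v
    rw [h, Matrix.zero_mulVec]

/-- Near the centre of a local parametrization, `Hom(L₂, L₁)` has a holomorphic frame.  It is the
product of a smooth frame with the exponential of a solution of an inhomogeneous Cauchy-Riemann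
equation; every holomorphic section is a holomorphic multiple of it. -/
lemma Extension.exists_frame (hp : p.Smooth) (h₁ : E.W₁.HasSpectralPoly p)
    (h₂ : E.W₂.HasSpectralPoly p) (γ : p.LocalParam i) :
    ∃ ε : ℝ, 0 < ε ∧ ε ≤ γ.r ∧ ∃ N : ℂ → Matrix (Fin m) (Fin m) ℂ,
      MSmoothOn N (Metric.ball 0 ε) ∧ ∀ L : ℂ → Matrix (Fin m) (Fin m) ℂ,
      (L = fun τ => E.W₁.pullCof γ τ * N τ) →
      (∀ τ ∈ Metric.ball (0 : ℂ) ε, L τ ≠ 0 ∧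
        N τ * (E.W₂.φ i (γ.z τ) - γ.w τ • (1 : Matrix (Fin m) (Fin m) ℂ)) = 0 ∧
        cov (E.W₁.pullA γ) (E.W₂.pullA γ) L τ = 0) ∧
      ∀ M : ℂ → Matrix (Fin m) (Fin m) ℂ, MSmoothOn M (Metric.ball 0 ε) →
        (∀ τ ∈ Metric.ball (0 : ℂ) ε, cov (E.W₁.pullA γ) (E.W₂.pullA γ) M τ = 0 ∧
          (E.W₁.φ i (γ.z τ) - γ.w τ • (1 : Matrix (Fin m) (Fin m) ℂ)) * M τ = 0 ∧
          M τ * (E.W₂.φ i (γ.z τ) - γ.w τ • (1 : Matrix (Fin m) (Fin m) ℂ)) = 0) →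
        ∃ F : ℂ → ℂ, DifferentiableOn ℂ F (Metric.ball 0 ε) ∧
          ∀ τ ∈ Metric.ball (0 : ℂ) ε, M τ = F τ • L τ := by
  set J₁ := E.W₁.pullCof γ with hJ₁
  set J₂ := E.W₂.pullCof γ with hJ₂
  set A₁ := E.W₁.pullA γ
  set A₂ := E.W₂.pullA γ
  have hJ₁s : MSmoothOn J₁ (Metric.ball 0 γ.r) := E.W₁.pullCof_smooth γ
  have hJ₂s : MSmoothOn J₂ (Metric.ball 0 γ.r) := E.W₂.pullCof_smooth γ
  have hex : ∀ J : Matrix (Fin m) (Fin m) ℂ, J ≠ 0 → ∃ a b, J a b ≠ 0 := by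
    intro J hJ
    by_contra! h
    exact hJ (Matrix.ext h)
  obtain ⟨a, b, hab⟩ := hex (J₁ 0) (h₁.cof_ne_zero hp (γ.onCurve 0 γ.zero_mem))
  obtain ⟨c, d, hcd⟩ := hex (J₂ 0) (h₂.cof_ne_zero hp (γ.onCurve 0 γ.zero_mem))
  have hcont : ∀ {J : ℂ → Matrix (Fin m) (Fin m) ℂ}, MSmoothOn J (Metric.ball 0 γ.r) → ∀ x y,
      ContinuousAt (fun τ => J τ x y) 0 := fun hJ x y =>
    ((hJ x y).contDiffAt γ.ball_mem).continuousAt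
  obtain ⟨ε, hε, hball⟩ := Metric.eventually_nhds_iff_ball.1
    (((hcont hJ₁s a b).eventually_ne hab).and (((hcont hJ₂s c d).eventually_ne hcd).and γ.ball_mem))
  have hsub : Metric.ball (0 : ℂ) ε ⊆ Metric.ball 0 γ.r := fun τ hτ => (hball τ hτ).2.2
  -- with this right-hand side, `exp h • J₁ S J₂` is holomorphic for an elementary matrix `S`
  obtain ⟨h, hh, hhd⟩ := exists_dbar_eq hε
    (μ := fun τ => (A₂ τ * J₂ τ) c d / J₂ τ c d - (J₁ τ * A₁ τ) a b / J₁ τ a b) (by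
      simp only [div_eq_mul_inv]
      refine ContDiffOn.sub
        (ContDiffOn.mul ?_ (((hJ₂s.mono hsub) c d).inv fun τ hτ => (hball τ hτ).2.1))
        (ContDiffOn.mul ?_ (((hJ₁s.mono hsub) a b).inv fun τ hτ => (hball τ hτ).1))
      · exact (((E.W₂.pullA_smooth γ).mul hJ₂s).mono hsub) c d
      · exact ((hJ₁s.mul (E.W₁.pullA_smooth γ)).mono hsub) a b)
  set S : Matrix (Fin m) (Fin m) ℂ := Matrix.single b c 1 with hS
  have hJS : ∀ τ x y, (J₁ τ * S * J₂ τ) x y = J₁ τ x b * J₂ τ c y := by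
    intro τ x y
    rw [Matrix.mul_apply, Finset.sum_eq_single c]
    · simp [hS]
    · intro k _ hk
      rw [hS, Matrix.mul_single_apply_of_ne _ _ _ _ _ hk]
      simp
    · simp
  have hε3 : ε / 3 ≤ ε := by linarith
  have hsub3 : Metric.ball (0 : ℂ) (ε / 3) ⊆ Metric.ball 0 ε := Metric.ball_subset_ball hε3
  have hεr : ε / 3 ≤ γ.r := by
    by_contra hlt
    rw [not_le] at hlt
    have h1 : (γ.r : ℂ) ∈ Metric.ball (0 : ℂ) (ε / 3) := by
      rw [mem_ball_zero_iff, norm_real, Real.norm_of_nonneg γ.r_pos.le]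
      exact hlt
    have h2 := hsub (hsub3 h1)
    rw [mem_ball_zero_iff, norm_real, Real.norm_of_nonneg γ.r_pos.le] at h2
    exact lt_irrefl _ h2
  have hexp : ContDiff ℝ ∞ fun τ => exp (h τ) := Complex.contDiff_exp.comp hh
  have hexps : ContDiffOn ℝ ∞ (fun τ => exp (h τ)) (Metric.ball 0 (ε / 3)) := hexp.contDiffOn
  have hNs : MSmoothOn (fun τ => exp (h τ) • (S * J₂ τ)) (Metric.ball 0 (ε / 3)) :=
    MSmoothOn.smul hexps ((msmoothOn_const S _).mul (hJ₂s.mono (hsub3.trans hsub)))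
  refine ⟨ε / 3, by positivity, hεr, _, hNs, ?_⟩
  rintro L hLdef
  have hLeq : ∀ τ, L τ = exp (h τ) • (J₁ τ * S * J₂ τ) := by
    intro τ
    simp only [hLdef, Matrix.mul_smul, Matrix.mul_assoc]
  have hLs : MSmoothOn L (Metric.ball 0 (ε / 3)) := by
    rw [hLdef]
    exact (hJ₁s.mono (hsub3.trans hsub)).mul hNs
  have hLad : ∀ τ ∈ Metric.ball (0 : ℂ) (ε / 3), L τ a d ≠ 0 := by
    intro τ hτ
    obtain ⟨e1, e2, -⟩ := hball τ (hsub3 hτ)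
    rw [hLeq, Matrix.smul_apply, hJS, smul_eq_mul]
    exact mul_ne_zero (exp_ne_zero _) (mul_ne_zero e1 e2)
  have hcovL : ∀ τ ∈ Metric.ball (0 : ℂ) (ε / 3), cov A₁ A₂ L τ = 0 := by
    intro τ hτ
    obtain ⟨e1, e2, hτr⟩ := hball τ (hsub3 hτ)
    have hJ₁d := hJ₁s.mdiffAt_ball hτr
    have hJ₂d := hJ₂s.mdiffAt_ball hτr
    have hSd : MDiffAt (fun _ : ℂ => S) τ := fun _ _ => differentiableAt_const _
    have hroot := γ.onCurve τ hτr
    rw [funext hLeq, cov_smul (hexp.differentiable (by simp) τ) ((hJ₁d.mul hSd).mul hJ₂d),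
      cov_mul (B := A₂) (hJ₁d.mul hSd) hJ₂d, cov_mul (B := A₁) hJ₁d hSd,
      h₁.cov_pullCof γ hτr, h₂.cov_pullCof γ hτr, dbar_exp (hh.differentiable (by simp) τ),
      hhd τ hτ]
    have hcovS : cov A₁ A₂ (fun _ => S) τ = A₁ τ * S - S * A₂ τ := by
      rw [cov, mdbar_const, zero_add]
    rw [hcovS, Matrix.zero_mul, zero_add, Matrix.mul_zero, add_zero, mul_smul, ← smul_add,
      Matrix.mul_sub, Matrix.sub_mul]
    refine smul_eq_zero_of_right _ ?_
    ext x y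
    have f1 : (J₁ τ * (A₁ τ * S) * J₂ τ) x y = (J₁ τ * A₁ τ) x b * J₂ τ c y := by
      rw [← Matrix.mul_assoc, Matrix.mul_apply, Finset.sum_eq_single c]
      · simp [hS]
      · intro k _ hk
        rw [hS, Matrix.mul_single_apply_of_ne _ _ _ _ _ hk]
        simp
      · simp
    have f2 : (J₁ τ * (S * A₂ τ) * J₂ τ) x y = J₁ τ x b * (A₂ τ * J₂ τ) c y := by
      rw [Matrix.mul_assoc, Matrix.mul_assoc, ← Matrix.mul_assoc, Matrix.mul_apply,
        Finset.sum_eq_single c]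
      · simp [hS]
      · intro k _ hk
        rw [hS, Matrix.mul_single_apply_of_ne _ _ _ _ _ hk]
        simp
      · simp
    have g1 : (J₁ τ * A₁ τ) x b * J₁ τ a b = J₁ τ x b * (J₁ τ * A₁ τ) a b := by
      simp only [Matrix.mul_apply, Finset.sum_mul, Finset.mul_sum]
      refine Finset.sum_congr rfl fun k _ => ?_
      have := cof_apply_mul_apply (h₁.eval_charpoly hroot) a b x k
      simp only [hJ₁, CoHiggs.pullCof]
      linear_combination A₁ τ k b * this
    have g2 : (A₂ τ * J₂ τ) c y * J₂ τ c d = J₂ τ c y * (A₂ τ * J₂ τ) c d := by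
      simp only [Matrix.mul_apply, Finset.sum_mul, Finset.mul_sum]
      refine Finset.sum_congr rfl fun k _ => ?_
      have := cof_apply_mul_apply (h₂.eval_charpoly hroot) c d k y
      simp only [hJ₂, CoHiggs.pullCof]
      linear_combination A₂ τ c k * this
    simp only [Matrix.add_apply, Matrix.sub_apply, Matrix.smul_apply, smul_eq_mul, hJS, f1, f2,
      Matrix.zero_apply]
    have g1' : (J₁ τ * A₁ τ) x b = J₁ τ x b * (J₁ τ * A₁ τ) a b / J₁ τ a b :=
      eq_div_of_mul_eq e1 g1
    have g2' : (A₂ τ * J₂ τ) c y = J₂ τ c y * (A₂ τ * J₂ τ) c d / J₂ τ c d :=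
      eq_div_of_mul_eq e2 g2
    rw [g1', g2']
    ring
  refine ⟨fun τ hτ => ⟨fun h0 => hLad τ hτ (by rw [h0]; rfl), ?_, hcovL τ hτ⟩, ?_⟩
  · have hroot := γ.onCurve τ (hsub (hsub3 hτ))
    have := cof_mul_sub (h₂.eval_charpoly hroot)
    rw [Matrix.smul_mul, Matrix.mul_assoc, hJ₂, CoHiggs.pullCof, this, Matrix.mul_zero, smul_zero]
  · intro M hM hMc
    have hprop : ∀ τ ∈ Metric.ball (0 : ℂ) (ε / 3), M τ = (M τ a d / L τ a d) • L τ := by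
      intro τ hτ
      obtain ⟨e1, e2, hτr⟩ := hball τ (hsub3 hτ)
      have hroot := γ.onCurve τ hτr
      obtain ⟨-, m1, m2⟩ := hMc τ hτ
      -- the columns of `M` are eigenvectors of `φ₁`
      have k1 : ∀ x y, M τ x y * J₁ τ a b = J₁ τ x b * M τ a y := by
        intro x y
        obtain ⟨u, f, -, -, hJf, -, hker⟩ :=
          exists_cof_eq_vecMulVec (h₁.eval_charpoly hroot) (h₁.cof_ne_zero hp hroot)
        obtain ⟨t, ht⟩ := hker (fun x => M τ x y) (by
          have m3 : (E.W₁.φ i (γ.z τ) - γ.w τ • (1 : Matrix (Fin m) (Fin m) ℂ)).mulVec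
              (fun x => M τ x y) = 0 := by
            ext x
            exact congrFun (congrFun m1 x) y
          rwa [Matrix.sub_mulVec, Matrix.smul_mulVec, Matrix.one_mulVec, sub_eq_zero] at m3)
        have ht' : ∀ x, M τ x y = t * u x := fun x => congrFun ht x
        rw [ht' x, ht' a]
        simp only [hJ₁, CoHiggs.pullCof, hJf, Matrix.vecMulVec_apply]
        ring
      -- the rows of `M` vanish on the image of `φ₂ - w`
      have k2 : ∀ y, M τ a y * J₂ τ c d = M τ a d * J₂ τ c y := by
        intro y
        have hv : (cof (E.W₂.φ i (γ.z τ)) (γ.w τ)).mulVec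
            (J₂ τ c d • Pi.single y 1 - J₂ τ c y • Pi.single d 1) = 0 := by
          ext x
          rw [Matrix.mulVec_sub, Matrix.mulVec_smul, Matrix.mulVec_smul]
          simp only [Matrix.mulVec_single_one, Pi.sub_apply, Pi.smul_apply, smul_eq_mul,
            Matrix.col_apply, Pi.zero_apply]
          have := cof_apply_mul_apply (h₂.eval_charpoly hroot) c d x y
          simp only [hJ₂, CoHiggs.pullCof]
          linear_combination this
        obtain ⟨u, hu⟩ := (mem_range_iff_cof_mulVec_eq_zero (h₂.eval_charpoly hroot)
          (h₂.cof_ne_zero hp hroot) _).2 hv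
        have hMv := congrArg (M τ).mulVec hu
        rw [Matrix.mulVecLin_apply, Matrix.mulVec_mulVec, m2, Matrix.zero_mulVec,
          Matrix.mulVec_sub, Matrix.mulVec_smul, Matrix.mulVec_smul] at hMv
        have := congrFun hMv a
        simp only [Matrix.mulVec_single_one, Pi.sub_apply, Pi.smul_apply, smul_eq_mul,
          Matrix.col_apply, Pi.zero_apply] at this
        linear_combination -this
      ext x y
      rw [Matrix.smul_apply, smul_eq_mul, div_mul_eq_mul_div, eq_div_iff (hLad τ hτ), hLeq,
        Matrix.smul_apply, Matrix.smul_apply, hJS, hJS, smul_eq_mul, smul_eq_mul]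
      linear_combination (exp (h τ) * J₂ τ c d) * k1 x y + (exp (h τ) * J₁ τ x b) * k2 y
    refine ⟨fun τ => M τ a d / L τ a d, fun τ hτ => ?_, hprop⟩
    have hnhds : Metric.ball (0 : ℂ) (ε / 3) ∈ 𝓝 τ := Metric.isOpen_ball.mem_nhds hτ
    have hFd : DifferentiableAt ℝ (fun τ => M τ a d / L τ a d) τ :=
      (hM.mdiffAt_ball hτ a d).fun_mul ((hLs.mdiffAt_ball hτ a d).inv (hLad τ hτ))
    refine (differentiableAt_of_dbar_eq_zero hFd ?_).differentiableWithinAt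
    have h1 : cov A₁ A₂ M τ = cov A₁ A₂ (fun τ => (M τ a d / L τ a d) • L τ) τ :=
      cov_congr (by filter_upwards [hnhds] with t ht using hprop t ht)
    rw [(hMc τ hτ).1, cov_smul hFd (hLs.mdiffAt_ball hτ), hcovL τ hτ, smul_zero, add_zero] at h1
    refine (smul_eq_zero.1 h1.symm).resolve_right fun h0 => hLad τ hτ (by rw [h0]; rfl)

end Frame

open Asymptotics

/-! ### Vanishing orders -/

section Order

open scoped Matrix.Norms.Operator

/-- A matrix-valued function on the curve vanishes to order exactly `k` at `x`, measured by the
distance to `x` in the affine chart. -/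
def SpectralPoly.VanishesToOrder {m k : ℕ} (p : SpectralPoly m) (i : Bool)
    (M : ℂ × ℂ → Matrix (Fin k) (Fin k) ℂ) (x : ℂ × ℂ) (n : ℕ) : Prop :=
  M =Θ[𝓝[p.curve i] x] fun y => ‖y - x‖ ^ n

variable {m k : ℕ} {p : SpectralPoly m} {i : Bool} {M M' : ℂ × ℂ → Matrix (Fin k) (Fin k) ℂ}
  {x : ℂ × ℂ} {n : ℕ}

lemma SpectralPoly.VanishesToOrder.congr (h : p.VanishesToOrder i M x n)
    (hM : M' =Θ[𝓝[p.curve i] x] M) : p.VanishesToOrder i M' x n := hM.trans h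

lemma SpectralPoly.VanishesToOrder.eventually_ne (h : p.VanishesToOrder i M x n) :
    ∀ᶠ y in 𝓝[p.curve i] x, y ≠ x → M y ≠ 0 := by
  filter_upwards [h.eq_zero_iff] with y hy hyx h0
  exact hyx (sub_eq_zero.1 (norm_eq_zero.1 (eq_zero_of_pow_eq_zero (hy.1 h0))))

lemma SpectralPoly.VanishesToOrder.ne_zero_iff (h : p.VanishesToOrder i M x n)
    (hx : x ∈ p.curve i) : n ≠ 0 ↔ M x = 0 := by
  rw [h.eq_zero_iff.self_of_nhdsWithin hx]
  simp

lemma isTheta_one_of_tendsto {α : Type*} {l : Filter α} {H : α → Matrix (Fin k) (Fin k) ℂ}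
    {H₀ : Matrix (Fin k) (Fin k) ℂ} (hH : Tendsto H l (𝓝 H₀)) (h₀ : H₀ ≠ 0) :
    H =Θ[l] fun _ => (1 : ℂ) := by
  refine ⟨hH.isBigO_one ℂ, ?_⟩
  rw [isBigO_iff]
  have hpos : 0 < ‖H₀‖ := norm_pos_iff.2 h₀
  refine ⟨2 / ‖H₀‖, ?_⟩
  filter_upwards [hH.norm.eventually_const_lt (half_lt_self hpos)] with y hy
  rw [norm_one, div_mul_eq_mul_div, le_div_iff₀ hpos]
  linarith

/-- The vanishing order can be read off from a local coordinate. -/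
lemma SpectralPoly.LocalParam.IsCoordinate.vanishesToOrder_iff {γ : p.LocalParam i}
    (hγ : γ.IsCoordinate) :
    p.VanishesToOrder i M (γ.pt 0) n ↔ (fun τ => M (γ.pt τ)) =Θ[𝓝 0] fun τ => τ ^ n := by
  have h0 : p.VanishesToOrder i M (γ.pt 0) n
      ↔ (fun τ => M (γ.pt τ)) =Θ[𝓝 0] fun τ => ‖γ.pt τ - γ.pt 0‖ ^ n := by
    rw [SpectralPoly.VanishesToOrder, ← hγ.map_nhds, IsTheta, IsTheta, isBigO_map, isBigO_map]
    rfl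
  rw [h0]
  have h1 : (fun τ => ‖γ.pt τ - γ.pt 0‖ ^ n) =Θ[𝓝 0] fun τ : ℂ => τ ^ n :=
    hγ.isTheta.norm_left.pow n
  exact h1.isTheta_congr_right

lemma SpectralPoly.VanishesToOrder.unique (hp : p.Smooth) (hx : x ∈ p.curve i) {n' : ℕ}
    (h : p.VanishesToOrder i M x n) (h' : p.VanishesToOrder i M x n') : n = n' := by
  obtain ⟨γ, hw, hz, hγ⟩ := SpectralPoly.exists_localParam hp hx
  have hpt : γ.pt 0 = x := Prod.ext hw hz
  subst hpt
  rw [hγ.vanishesToOrder_iff] at h h'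
  have key : ∀ a b : ℕ, a < b → ¬ (fun τ : ℂ => τ ^ a) =Θ[𝓝 0] fun τ : ℂ => τ ^ b := by
    intro a b hab hth
    have h1 := hth.1.trans_isLittleO (isLittleO_pow_pow hab)
    have h2 : ∃ᶠ τ : ℂ in 𝓝 0, τ ^ a ≠ 0 := by
      have : ∃ᶠ τ : ℂ in 𝓝[≠] 0, τ ^ a ≠ 0 :=
        Eventually.frequently (by
          filter_upwards [self_mem_nhdsWithin] with τ hτ using pow_ne_zero a hτ)
      exact this.filter_mono nhdsWithin_le_nhds
    exact isLittleO_irrefl h2 h1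
  by_contra hne
  rcases lt_or_gt_of_ne hne with hlt | hlt
  · exact key _ _ hlt (h.symm.trans h')
  · exact key _ _ hlt (h'.symm.trans h)

lemma isBigO_chartChange (hx : x.2 ≠ 0) :
    (fun y => chartChange y - chartChange x) =O[𝓝 x] fun y => y - x := by
  have h2 : x.2 ^ 2 ≠ 0 := pow_ne_zero 2 hx
  have h : DifferentiableAt ℂ chartChange x := by
    unfold chartChange
    fun_prop (disch := assumption)
  exact h.isBigO_sub

lemma chartChange_snd_ne (hx : x.2 ≠ 0) : (chartChange x).2 ≠ 0 := inv_ne_zero hx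

lemma eventually_chartChange_chartChange (hx : x.2 ≠ 0) :
    ∀ᶠ y in 𝓝 x, chartChange (chartChange y) = y := by
  filter_upwards [continuous_snd.continuousAt.eventually_ne hx] with y hy
  exact chartChange_chartChange hy

lemma isTheta_chartChange (hx : x.2 ≠ 0) :
    (fun y => chartChange y - chartChange x) =Θ[𝓝 x] fun y => y - x := by
  refine ⟨isBigO_chartChange hx, ?_⟩
  have h := (isBigO_chartChange (chartChange_snd_ne hx)).comp_tendsto (continuousAt_chartChange hx)
  rw [chartChange_chartChange hx] at h
  refine h.congr' ?_ EventuallyEq.rfl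
  filter_upwards [eventually_chartChange_chartChange hx] with y hy
  simp [hy]

/-- Vanishing orders are the same in both charts. -/
lemma SpectralPoly.VanishesToOrder.comp_chartChange (hx : x.2 ≠ 0)
    (h : p.VanishesToOrder (!i) M' (chartChange x) n)
    (hM : (fun y => M' (chartChange y)) =Θ[𝓝[p.curve i] x] M) : p.VanishesToOrder i M x n := by
  have h1 : (fun y => M' (chartChange y)) =Θ[𝓝[p.curve i] x]
      fun y => ‖chartChange y - chartChange x‖ ^ n :=
    ⟨h.1.comp_tendsto (tendsto_chartChange hx), h.2.comp_tendsto (tendsto_chartChange hx)⟩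
  refine hM.symm.trans (h1.trans ?_)
  exact ((isTheta_chartChange hx).mono nhdsWithin_le_nhds).norm_left.norm_right.pow n

lemma isBigO_mul_mul {α : Type*} {l : Filter α} {A B M : α → Matrix (Fin k) (Fin k) ℂ}
    {A₀ B₀ : Matrix (Fin k) (Fin k) ℂ} (hA : Tendsto A l (𝓝 A₀)) (hB : Tendsto B l (𝓝 B₀)) :
    (fun y => A y * M y * B y) =O[l] M := by
  have h := ((hA.isBigO_one ℝ).mul (isBigO_refl M l).norm_right).mul (hB.isBigO_one ℝ)
  simpa using h

end Order

/-! ### The zeros of the section -/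

section Zeros

variable {m : ℕ} {p : SpectralPoly m} {E : Extension m} {i : Bool}

variable (p) in
variable (E) in
/-- The section induced by `p(φ)`, as a map of the fibres of `W₂` to the fibres of `W₁`: its
composition with the embedding of `L₁` given by the cofactor matrix. -/
def Extension.secMap (i : Bool) (x : ℂ × ℂ) : Matrix (Fin m) (Fin m) ℂ :=
  cof (E.W₁.φ i x.2) x.1 * E.polyMap p i x.2

variable (hp : p.Smooth) (h₁ : E.W₁.HasSpectralPoly p) (h₂ : E.W₂.HasSpectralPoly p)

include h₁ h₂ in
lemma Extension.secMap_eq (i : Bool) (x : ℂ × ℂ) :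
    E.secMap p i x = E.polyMap p i x.2 * cof (E.W₂.φ i x.2) x.1 :=
  (mul_cof_eq_cof_mul (E.polyMap_comm h₁ h₂ i x.2) ((h₂ i x.2).trans (h₁ i x.2).symm) x.1).symm

include h₁ h₂ in
lemma Extension.sec_apply {w z : ℂ} (v : Fin m → ℂ) :
    E.sec p i w z (toCoker _ _ v) = toCoker _ _ ((E.polyMap p i z).mulVec v) := by
  refine E.fibreOf_apply (X := E.polyMap p i z) ?_ v
  rw [Matrix.mul_sub, Matrix.sub_mul, E.polyMap_comm h₁ h₂, Matrix.mul_smul, Matrix.smul_mul,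
    Matrix.mul_one, Matrix.one_mul]

open scoped Matrix.Norms.Operator in
include hp h₁ h₂ in
/-- Near a point of the curve, the section vanishes identically or is `τ ^ n` times a holomorphic
frame, where `τ` is a local coordinate. -/
lemma Extension.secMap_eq_zero_or_hasOrder {x : ℂ × ℂ} (hx : x ∈ p.curve i) :
    (∀ᶠ y in 𝓝[p.curve i] x, E.secMap p i y = 0) ∨
      ∃ n, p.VanishesToOrder i (E.secMap p i) x n ∧ E.HasOrder p (E.sec p) i x.1 x.2 n := by
  obtain ⟨γ, hw, hz, hγ⟩ := SpectralPoly.exists_localParam hp hx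
  have hpt : γ.pt 0 = x := Prod.ext hw hz
  obtain ⟨ε, hε, hεr, N, hN, hframe⟩ := E.exists_frame hp h₁ h₂ γ
  obtain ⟨hL, hfr⟩ := hframe _ rfl
  set L : ℂ → Matrix (Fin m) (Fin m) ℂ := fun τ => E.W₁.pullCof γ τ * N τ with hLdef
  have hsub : Metric.ball (0 : ℂ) ε ⊆ Metric.ball 0 γ.r := Metric.ball_subset_ball hεr
  have hRs := (E.polyMap_smooth (p := p) i).pull γ
  have hMs : MSmoothOn (fun τ => E.secMap p i (γ.pt τ)) (Metric.ball 0 ε) :=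
    ((E.W₁.pullCof_smooth γ).mul hRs).mono hsub
  obtain ⟨F, hF, hFL⟩ := hfr _ hMs (fun τ hτ => by
    have hroot := γ.onCurve τ (hsub hτ)
    refine ⟨?_, ?_, ?_⟩
    · have := cov_mul (A := E.W₁.pullA γ) (B := E.W₁.pullA γ) (C := E.W₂.pullA γ)
        ((E.W₁.pullCof_smooth γ).mdiffAt_ball (hsub hτ)) (hRs.mdiffAt_ball (hsub hτ))
      rw [h₁.cov_pullCof γ (hsub hτ), cov_pull γ (E.polyMap_smooth i) (hsub hτ)
        (E.cov_polyMap h₁ h₂ i _), Matrix.zero_mul, Matrix.mul_zero, add_zero] at this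
      exact this
    · change (E.W₁.φ i (γ.z τ) - γ.w τ • (1 : Matrix (Fin m) (Fin m) ℂ)) *
        (cof (E.W₁.φ i (γ.z τ)) (γ.w τ) * _) = 0
      rw [← Matrix.mul_assoc, sub_mul_cof (h₁.eval_charpoly hroot), Matrix.zero_mul]
    · rw [E.secMap_eq h₁ h₂]
      change _ * cof (E.W₂.φ i (γ.z τ)) (γ.w τ) * _ = 0
      rw [Matrix.mul_assoc, cof_mul_sub (h₂.eval_charpoly hroot), Matrix.mul_zero])
  have hball : Metric.ball (0 : ℂ) ε ∈ 𝓝 (0 : ℂ) := Metric.ball_mem_nhds 0 hε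
  have hFan : AnalyticAt ℂ F 0 := hF.analyticAt hball
  by_cases hF0 : ∀ᶠ τ in 𝓝 (0 : ℂ), F τ = 0
  · left
    rw [← hpt, ← hγ.map_nhds, eventually_map]
    filter_upwards [hF0, hball] with τ h0 hτ
    rw [hFL τ hτ, h0, zero_smul]
  · right
    obtain ⟨n, G, hG, hG0, hFG⟩ := hFan.exists_eventuallyEq_pow_smul_nonzero_iff.2 hF0
    simp only [sub_zero, smul_eq_mul] at hFG
    have hLs : MSmoothOn L (Metric.ball 0 ε) := ((E.W₁.pullCof_smooth γ).mono hsub).mul hN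
    refine ⟨n, ?_, γ, hw, hz, fun τ => E.fibreOf i (γ.w τ) (γ.z τ) (G τ • N τ), ?_, ?_, ?_⟩
    · rw [← hpt, hγ.vanishesToOrder_iff]
      have hLc : ContinuousAt L 0 := by
        refine continuousAt_pi.2 fun a => continuousAt_pi.2 fun b => ?_
        exact ((hLs a b).contDiffAt hball).continuousAt
      have h1 := isTheta_one_of_tendsto (hG.continuousAt.smul hLc).tendsto
        (smul_ne_zero hG0 (hL 0 (Metric.mem_ball_self hε)).1)
      have h2 := (isTheta_refl (fun τ : ℂ => τ ^ n) (𝓝 0)).smul h1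
      have h3 : (fun τ => τ ^ n • (G τ • L τ)) =Θ[𝓝 0] fun τ => τ ^ n := by simpa using h2
      refine EventuallyEq.trans_isTheta ?_ h3
      filter_upwards [hFG, hball] with τ h3 hτ
      rw [hFL τ hτ, h3, mul_smul]
    · obtain ⟨ε', hε', hball'⟩ := Metric.eventually_nhds_iff_ball.1
        (hG.eventually_analyticAt.and hball)
      have hsub' : Metric.ball (0 : ℂ) ε' ⊆ Metric.ball 0 ε := fun τ hτ => (hball' τ hτ).2
      have hle : ε' ≤ ε := by
        by_contra hlt
        rw [not_le] at hlt
        have h1 : (ε : ℂ) ∈ Metric.ball (0 : ℂ) ε' := by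
          rwa [mem_ball_zero_iff, norm_real, Real.norm_of_nonneg hε.le]
        have h2 := hsub' h1
        rw [mem_ball_zero_iff, norm_real, Real.norm_of_nonneg hε.le] at h2
        exact lt_irrefl _ h2
      have hGd : DifferentiableOn ℂ G (Metric.ball 0 ε') := fun τ hτ =>
        (hball' τ hτ).1.differentiableAt.differentiableWithinAt
      refine (E.holAlong_iff hp h₁ γ _).2 ⟨ε', hε', hle.trans hεr, fun τ => G τ • N τ,
        MSmoothOn.smul ((hGd.contDiffOn Metric.isOpen_ball).restrict_scalars ℝ) (hN.mono hsub'),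
        fun τ hτ => ⟨fun v => E.fibreOf_apply (X := 0) ?_ v, ?_⟩⟩
      · rw [Matrix.smul_mul, (hL τ (hsub' hτ)).2.1, smul_zero, Matrix.mul_zero]
      · have hGτ : DifferentiableAt ℂ G τ := (hball' τ hτ).1.differentiableAt
        simp only [Matrix.mul_smul]
        change cov _ _ (fun τ => G τ • L τ) τ = 0
        rw [cov_smul (hGτ.restrictScalars ℝ) (hLs.mdiffAt_ball (hsub' hτ)),
          dbar_eq_zero_of_differentiableAt hGτ, (hL τ (hsub' hτ)).2.2, zero_smul, smul_zero,
          add_zero]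
    · intro h0
      change E.fibreOf i (γ.w 0) (γ.z 0) (G 0 • N 0) = 0 at h0
      have h0mem := Metric.mem_ball_self (x := (0 : ℂ)) hε
      refine smul_ne_zero hG0 (hL 0 h0mem).1 (Matrix.ext_of_mulVec_single fun j => ?_)
      have h3 := E.fibreOf_apply (i := i) (w := γ.w 0) (z := γ.z 0) (N := G 0 • N 0) (X := 0)
        (by rw [Matrix.smul_mul, (hL 0 h0mem).2.1, smul_zero, Matrix.mul_zero]) (Pi.single j 1)
      rw [h0, LinearMap.zero_apply, ← map_zero (toCoker (E.W₁.φ i (γ.z 0)) (γ.w 0)),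
        h₁.toCoker_eq_iff hp (γ.onCurve 0 γ.zero_mem), Matrix.mulVec_zero, Matrix.mulVec_mulVec,
        Matrix.mul_smul] at h3
      rw [Matrix.zero_mulVec]
      exact h3.symm
    · obtain ⟨ε', hε', hball'⟩ := Metric.eventually_nhds_iff_ball.1 (hFG.and hball)
      refine ⟨ε', hε', fun τ hτ => E.fibre_ext fun v => ?_⟩
      obtain ⟨hFGτ, hτε⟩ := hball' τ hτ
      have hroot := γ.onCurve τ (hsub hτε)
      rw [E.sec_apply h₁ h₂, LinearMap.smul_apply, E.fibreOf_apply (X := 0), ← map_smul,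
        h₁.toCoker_eq_iff hp hroot, Matrix.mulVec_mulVec, Matrix.mulVec_smul, Matrix.mulVec_mulVec,
        Matrix.mul_smul, ← Matrix.smul_mulVec, smul_smul, ← hFGτ]
      · exact congrArg (fun X => Matrix.mulVec X v) (hFL τ hτε)
      · rw [Matrix.smul_mul, (hL τ hτε).2.1, smul_zero, Matrix.mul_zero]

lemma CoHiggs.cof_glue (W : CoHiggs m) (i : Bool)
    (w : ℂ) {z : ℂ} (hz : z ≠ 0) :
    cof (W.φ (!i) z⁻¹) (-(z ^ 2)⁻¹ * w) * W.g i z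
      = (-(z ^ 2)⁻¹) ^ (m - 1) • (W.g i z * cof (W.φ i z) w) := by
  have h1 : W.g i z * ((-(z ^ 2)⁻¹) • W.φ i z) = W.φ (!i) z⁻¹ * W.g i z := by
    rw [W.φ_glue i z hz, Matrix.mul_smul]
  have hu : IsUnit (W.g i z) := by
    rw [Matrix.isUnit_iff_isUnit_det]
    exact Matrix.isUnit_det_of_left_inverse (W.g_inv i z hz)
  have h2 : ((-(z ^ 2)⁻¹) • W.φ i z).charpoly = (W.φ (!i) z⁻¹).charpoly := by
    obtain ⟨u, hu⟩ := hu
    have h3 : W.φ (!i) z⁻¹ = u.val * ((-(z ^ 2)⁻¹) • W.φ i z) * (u⁻¹).val := by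
      rw [hu, h1, Matrix.mul_assoc, ← hu, Units.mul_inv, Matrix.mul_one]
    rw [h3, Matrix.coe_units_inv, Matrix.charpoly_units_conj]
  rw [← mul_cof_eq_cof_mul h1 h2, cof, cof, mul_smul, ← smul_sub, Matrix.adjugate_smul,
    Fintype.card_fin, Matrix.mul_smul]

include h₁ h₂ in
/-- The scalar has a factor `(-z⁻²) ^ m` from the twist of the section by `𝒪(2m)`, and a factor
`(-z⁻²) ^ (m - 1)` from the cofactor matrix, which has degree `m - 1` in the Higgs field. -/
lemma Extension.secMap_chartChange (i : Bool) {x : ℂ × ℂ} (hx : x.2 ≠ 0) :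
    E.secMap p (!i) (chartChange x) = ((-(x.2 ^ 2)⁻¹) ^ m * (-(x.2 ^ 2)⁻¹) ^ (m - 1)) •
      (E.W₁.g i x.2 * E.secMap p i x * E.W₂.g (!i) x.2⁻¹) := by
  have h3 : E.W₂.g i x.2 * E.W₂.g (!i) x.2⁻¹ = 1 := E.W₂.g_mul_g_inv i hx
  calc E.secMap p (!i) (chartChange x)
      = cof (E.W₁.φ (!i) x.2⁻¹) (-(x.2 ^ 2)⁻¹ * x.1)
          * (E.polyMap p (!i) x.2⁻¹ * E.W₂.g i x.2) * E.W₂.g (!i) x.2⁻¹ := by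
        rw [Matrix.mul_assoc, Matrix.mul_assoc, h3, Matrix.mul_one]
        rfl
    _ = _ := by
        rw [E.polyMap_glue h₁ h₂ i hx, Matrix.mul_smul, ← Matrix.mul_assoc, E.W₁.cof_glue i _ hx,
          Matrix.smul_mul, Matrix.smul_mul, Matrix.smul_mul, smul_smul, Extension.secMap]
        simp only [Matrix.mul_assoc]

lemma CoHiggs.continuousAt_g {n : ℕ} (W : CoHiggs n) (i : Bool) {z : ℂ} (hz : z ≠ 0) :
    ContinuousAt (W.g i) z :=
  continuousAt_pi.2 fun a => continuousAt_pi.2 fun b =>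
    ((W.g_smooth i a b).contDiffAt (isOpen_compl_singleton.mem_nhds hz)).continuousAt

open scoped Matrix.Norms.Operator in
include h₁ h₂ in
lemma Extension.secMap_chartChange_isBigO {x : ℂ × ℂ} (hx : x.2 ≠ 0) :
    (fun y => E.secMap p (!i) (chartChange y)) =O[𝓝[p.curve i] x] E.secMap p i := by
  have hA : ContinuousAt (fun y : ℂ × ℂ =>
      ((-(y.2 ^ 2)⁻¹) ^ m * (-(y.2 ^ 2)⁻¹) ^ (m - 1)) • E.W₁.g i y.2) x := by
    have h2 : x.2 ^ 2 ≠ 0 := pow_ne_zero 2 hx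
    have hc : ContinuousAt (fun y : ℂ × ℂ => -(y.2 ^ 2)⁻¹) x := by fun_prop (disch := assumption)
    refine ContinuousAt.smul ((hc.pow m).mul (hc.pow (m - 1))) ?_
    exact ContinuousAt.comp (g := E.W₁.g i) (E.W₁.continuousAt_g i hx) continuous_snd.continuousAt
  have hB : ContinuousAt (fun y : ℂ × ℂ => E.W₂.g (!i) y.2⁻¹) x :=
    ContinuousAt.comp (g := E.W₂.g (!i)) (E.W₂.continuousAt_g (!i) (inv_ne_zero hx))
      (continuous_snd.continuousAt.inv₀ hx)
  refine (isBigO_mul_mul (hA.tendsto.mono_left nhdsWithin_le_nhds)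
    (hB.tendsto.mono_left nhdsWithin_le_nhds)).congr' ?_ EventuallyEq.rfl
  filter_upwards [nhdsWithin_le_nhds (continuous_snd.continuousAt.eventually_ne hx)] with y hy
  rw [E.secMap_chartChange h₁ h₂ i hy, Matrix.smul_mul, Matrix.smul_mul]

open scoped Matrix.Norms.Operator in
include h₁ h₂ in
lemma Extension.secMap_chartChange_isTheta {x : ℂ × ℂ} (hx : x.2 ≠ 0) :
    (fun y => E.secMap p (!i) (chartChange y)) =Θ[𝓝[p.curve i] x] E.secMap p i := by
  refine ⟨E.secMap_chartChange_isBigO h₁ h₂ hx, ?_⟩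
  have h := (E.secMap_chartChange_isBigO (i := !i) h₁ h₂ (chartChange_snd_ne hx)).comp_tendsto
    (tendsto_chartChange (p := p) (i := i) hx)
  refine h.congr' ?_ EventuallyEq.rfl
  filter_upwards [nhdsWithin_le_nhds (eventually_chartChange_chartChange hx)] with y hy
  simp only [Function.comp, Bool.not_not, hy]

include hp h₁ h₂ in
/-- At a generic point `z` near a point where `p(φ) ≠ 0`, the section is not zero at some point of
the fibre. -/
lemma Extension.exists_secMap_ne_zero
    (hne : ∃ i z, aeval (E.V.φ i z) (p.poly i z) ≠ 0) :
    ∃ i, ∃ x ∈ p.curve i, E.secMap p i x ≠ 0 := by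
  obtain ⟨i, z₀, h0⟩ := hne
  have hR : E.polyMap p i z₀ ≠ 0 := by
    intro hR
    rw [← E.ι_mul_polyMap_mul_q h₁ h₂, hR, Matrix.mul_zero, Matrix.zero_mul] at h0
    exact h0 rfl
  have hRc : Continuous (E.polyMap p i) := (E.polyMap_smooth i).continuous
  obtain ⟨z, hz, hs⟩ := ((eventually_nhdsWithin_of_eventually_nhds
    (hRc.continuousAt.eventually_ne hR)).and (p.eventually_separable hp i z₀)).exists
  by_contra! hcon
  refine hz ?_
  rw [← h₂ i z] at hs
  rw [← Matrix.mul_one (E.polyMap p i z), ← sum_inv_derivative_smul_cof hs, Matrix.mul_sum]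
  refine Finset.sum_eq_zero fun v hv => ?_
  rw [h₂ i z, p.mem_roots_iff] at hv
  rw [Matrix.mul_smul, ← E.secMap_eq h₁ h₂ i (v, z), hcon i _ hv, smul_zero]

open scoped Matrix.Norms.Operator in
include hp h₁ h₂ in
/-- Since the curve is connected, the section has a finite vanishing order at every point. -/
lemma Extension.exists_order (hne : ∃ i z, aeval (E.V.φ i z) (p.poly i z) ≠ 0) {x : ℂ × ℂ}
    (hx : x ∈ p.curve i) :
    ∃ n, p.VanishesToOrder i (E.secMap p i) x n ∧ E.HasOrder p (E.sec p) i x.1 x.2 n := by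
  refine (E.secMap_eq_zero_or_hasOrder hp h₁ h₂ hx).resolve_left fun hzero => ?_
  obtain ⟨j, y, hy, hne⟩ := E.exists_secMap_ne_zero hp h₁ h₂ hne
  have key := p.curve_connected hp
    (Q := fun i x => ∀ᶠ y in 𝓝[p.curve i] x, E.secMap p i y = 0) ?_ ?_ hx hzero j y hy
  · exact hne (key.self_of_nhdsWithin hy)
  · intro i x hx
    rcases E.secMap_eq_zero_or_hasOrder hp h₁ h₂ hx with h | ⟨n, hn, -⟩
    · filter_upwards [eventually_eventually_nhdsWithin.2 h] with y hy
      exact ⟨fun _ => h, fun _ => hy⟩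
    · filter_upwards [hn.eventually_ne, self_mem_nhdsWithin] with y hy hyc
      by_cases hyx : y = x
      · rw [hyx]
      · refine ⟨fun h => absurd (h.self_of_nhdsWithin hyc) (hy hyx), fun h => ?_⟩
        have hbad : ∀ᶠ y in 𝓝[p.curve i] x, y = x := by
          filter_upwards [h, hn.eventually_ne] with y h0 h1
          by_contra h2
          exact h1 h2 h0
        obtain ⟨γ, hw, hz, hγ⟩ := SpectralPoly.exists_localParam hp hx
        have hpt : γ.pt 0 = x := Prod.ext hw hz
        rw [← hpt, ← hγ.map_nhds, eventually_map] at hbad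
        simp only [hγ.pt_eq_iff] at hbad
        obtain ⟨τ, hτ, hτ0⟩ := ((eventually_nhdsWithin_of_eventually_nhds hbad).and
          (self_mem_nhdsWithin : ({0}ᶜ : Set ℂ) ∈ 𝓝[≠] 0)).exists
        exact absurd hτ hτ0
  · intro i x hx hx0
    constructor
    · intro h
      filter_upwards [(tendsto_chartChange hx0).eventually h,
        (E.secMap_chartChange_isTheta h₁ h₂ hx0).eq_zero_iff] with y hy hy'
      exact hy'.1 hy
    · intro h
      have h3 := (tendsto_chartChange (p := p) (i := !i) (chartChange_snd_ne hx0)).eventually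
        (by rwa [chartChange_chartChange hx0, Bool.not_not])
      filter_upwards [h3, (E.secMap_chartChange_isTheta (i := !i) h₁ h₂
        (chartChange_snd_ne hx0)).eq_zero_iff] with y hy hy'
      rw [Bool.not_not] at hy'
      exact hy'.1 hy

include hp h₁ h₂ in
/-- The section has finitely many zeros over every disc. -/
lemma Extension.finite_zeros (hne : ∃ i z, aeval (E.V.φ i z) (p.poly i z) ≠ 0) (i : Bool) (z₀ : ℂ)
    (r : ℝ) :
    ((p.curve i ∩ {x | x.2 ∈ Metric.closedBall z₀ r}) ∩ {x | E.secMap p i x = 0}).Finite := by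
  refine finite_inter_of_isolated (p.isCompact_curve_inter i z₀ r) fun x hx => ?_
  obtain ⟨n, hn, -⟩ := E.exists_order hp h₁ h₂ hne hx.1
  have h := hn.eventually_ne
  rw [eventually_nhdsWithin_iff] at h ⊢
  filter_upwards [h] with y hy hyx hyK
  exact hy hyK.1 hyx

include hp h₁ h₂ in
/-- The map `p(φ)` from `W₂` to `W₁` is an isomorphism over a punctured neighbourhood of every
point. -/
lemma Extension.eventually_isUnit_polyMap (hne : ∃ i z, aeval (E.V.φ i z) (p.poly i z) ≠ 0)
    (i : Bool) (z₀ : ℂ) : ∀ᶠ z in 𝓝[≠] z₀, IsUnit (E.polyMap p i z) := by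
  have hfin := (E.finite_zeros hp h₁ h₂ hne i z₀ 1).image Prod.snd
  have h1 : ((Prod.snd '' ((p.curve i ∩ {x | x.2 ∈ Metric.closedBall z₀ 1}) ∩
      {x | E.secMap p i x = 0})) \ {z₀})ᶜ ∈ 𝓝 z₀ :=
    (hfin.subset Set.sdiff_subset).isClosed.isOpen_compl.mem_nhds (by simp)
  filter_upwards [nhdsWithin_le_nhds h1, nhdsWithin_le_nhds (Metric.closedBall_mem_nhds z₀ one_pos),
    self_mem_nhdsWithin] with z hz hzb hz0
  by_contra hu
  obtain ⟨w, hw, hRw⟩ := exists_mul_cof_eq_zero (E.polyMap_comm h₁ h₂ i z)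
    (fun w hw => h₂.cof_ne_zero hp (i := i) (z := z) (by rwa [h₂ i z] at hw)) hu
  rw [h₂ i z] at hw
  have h0 : E.secMap p i (w, z) = 0 := by
    rw [E.secMap_eq h₁ h₂]
    exact hRw
  exact hz ⟨⟨(w, z), ⟨⟨hw, hzb⟩, h0⟩, rfl⟩, hz0⟩

end Zeros

/-! ### The section dual to the off-diagonal Higgs term -/

section Dual

variable {m : ℕ} {p : SpectralPoly m} {E : Extension m} {i : Bool}
  (hp : p.Smooth) (h₁ : E.W₁.HasSpectralPoly p) (h₂ : E.W₂.HasSpectralPoly p)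

include hp h₁ h₂ in
lemma Extension.isHolSection_sec : E.IsHolSection p (E.sec p) where
  glue i w z hz u v huv := by
    have hc : -(z ^ 2)⁻¹ ≠ 0 := neg_ne_zero.2 (inv_ne_zero (pow_ne_zero 2 hz))
    rw [E.sec_apply h₁ h₂, Submodule.mkQ_apply, Submodule.mkQ_apply, Submodule.Quotient.eq] at huv
    obtain ⟨x, hx⟩ := huv
    rw [E.sec_apply h₁ h₂, Matrix.mulVec_mulVec, E.polyMap_glue h₁ h₂ i hz, ← map_smul,
      Submodule.mkQ_apply, Submodule.mkQ_apply, Submodule.Quotient.eq, Matrix.smul_mulVec,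
      ← smul_sub]
    refine Submodule.smul_mem _ _ ⟨(-(z ^ 2)⁻¹)⁻¹ • (E.W₁.g i z).mulVec x, ?_⟩
    rw [Matrix.mulVecLin_apply] at hx ⊢
    rw [← Matrix.mulVec_mulVec, ← Matrix.mulVec_sub, ← hx, Matrix.mulVec_smul,
      Matrix.mulVec_mulVec, Matrix.mulVec_mulVec, Matrix.sub_mul, E.W₁.φ_glue i z hz, mul_smul,
      Matrix.smul_mul, Matrix.smul_mul, Matrix.one_mul, ← smul_sub, Matrix.smul_mulVec, smul_smul,
      inv_mul_cancel₀ hc, one_smul, Matrix.mul_sub, Matrix.mul_smul, Matrix.mul_one]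
  hol i γ := by
    refine (E.holAlong_iff hp h₁ γ _).2 ⟨γ.r, γ.r_pos, le_rfl, fun τ => E.polyMap p i (γ.z τ),
      (E.polyMap_smooth i).pull γ, fun τ hτ => ⟨fun v => E.sec_apply h₁ h₂ v, ?_⟩⟩
    have := cov_mul (A := E.W₁.pullA γ) (B := E.W₁.pullA γ) (C := E.W₂.pullA γ)
      ((E.W₁.pullCof_smooth γ).mdiffAt_ball hτ)
      (((E.polyMap_smooth (p := p) i).pull γ).mdiffAt_ball hτ)
    rw [h₁.cov_pullCof γ hτ, cov_pull γ (E.polyMap_smooth i) hτ (E.cov_polyMap h₁ h₂ i _),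
      Matrix.zero_mul, Matrix.mul_zero, add_zero] at this
    exact this

include hp h₁ h₂ in
/-- The section induced by `p(φ)` is dual to the off-diagonal Higgs term: this is Lagrange
interpolation for `φ₁` at the points of an unramified fibre. -/
lemma Extension.isDualSection_sec (σ : E.Splitting) :
    E.IsDualSection p σ.higgsTerm (E.sec p) := by
  intro i z hs θ hθ
  refine ⟨fun w => (σ.higgsTerm i z * θ * cof (E.W₁.φ i z) w).trace, fun w hw u => ?_, ?_⟩
  · have hθJ := mul_cof_eq_cof_mul hθ ((h₁ i z).trans (h₂ i z).symm) w
    rw [E.sec_apply h₁ h₂, ← map_smul, h₁.toCoker_eq_iff hp hw, Matrix.mulVec_smul,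
      Matrix.mulVec_mulVec, Matrix.mulVec_mulVec, ← Matrix.smul_mulVec,
      ← cof_mul_mul_cof (h₁.eval_charpoly hw)]
    refine congrArg (fun M => Matrix.mulVec M u) ?_
    have h3 := E.secMap_eq h₁ h₂ i (w, z)
    rw [E.polyMap_mul_cof σ h₁ h₂ i hw, Extension.secMap] at h3
    simp only at h3
    rw [← Matrix.mul_assoc, h3, Matrix.mul_assoc, ← hθJ]
    simp only [Matrix.mul_assoc]
  · have hs₁ := hs
    rw [← h₁ i z] at hs₁
    rw [← h₁ i z]
    conv_lhs => rw [← Matrix.mul_one (σ.higgsTerm i z * θ), ← sum_inv_derivative_smul_cof hs₁]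
    rw [Matrix.mul_sum, Matrix.trace_sum]
    refine Finset.sum_congr rfl fun v _ => ?_
    rw [Matrix.mul_smul, Matrix.trace_smul, smul_eq_mul, div_eq_inv_mul]

include hp h₁ in
lemma Extension.exists_toCoker_ne_zero {w z : ℂ} (hw : p.OnCurve i w z) :
    ∃ u, toCoker (E.W₁.φ i z) w u ≠ 0 := by
  by_contra! h
  refine h₁.cof_ne_zero hp hw (Matrix.ext_of_mulVec_single fun j => ?_)
  have := h (Pi.single j 1)
  rwa [← map_zero (toCoker (E.W₁.φ i z) w), h₁.toCoker_eq_iff hp hw, Matrix.mulVec_zero,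
    ← Matrix.zero_mulVec (Pi.single j 1)] at this

include hp h₁ h₂ in
/-- A dual section is determined on unramified fibres: test it with the maps `θ` that factor
through the `w`-eigenlines. -/
lemma Extension.IsDualSection.apply_cof {ψ : Bool → ℂ → Matrix (Fin m) (Fin m) ℂ}
    {s : ∀ (i : Bool) (w z : ℂ), E.Fibre i w z} (hs : E.IsDualSection p ψ s) {w z : ℂ}
    (hsep : (p.poly i z).Separable) (hw : p.OnCurve i w z) (T : Matrix (Fin m) (Fin m) ℂ)
    (u : Fin m → ℂ) :
    s i w z (toCoker _ _ ((cof (E.W₂.φ i z) w * T * cof (E.W₁.φ i z) w).mulVec u))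
      = ((ψ i z * (cof (E.W₂.φ i z) w * T * cof (E.W₁.φ i z) w)).trace
          * (p.poly i z).derivative.eval w) • toCoker _ _ u := by
  set J₁ := cof (E.W₁.φ i z) w
  set J₂ := cof (E.W₂.φ i z) w
  have e₁ : J₁ * E.W₁.φ i z = w • J₁ := by
    have := cof_mul_sub (h₁.eval_charpoly hw)
    rwa [Matrix.mul_sub, Matrix.mul_smul, Matrix.mul_one, sub_eq_zero] at this
  have e₂ : E.W₂.φ i z * J₂ = w • J₂ := by
    have := sub_mul_cof (h₂.eval_charpoly hw)
    rwa [Matrix.sub_mul, Matrix.smul_mul, Matrix.one_mul, sub_eq_zero] at this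
  obtain ⟨c, hc, hsum⟩ := hs i z hsep (J₂ * T * J₁) (by
    rw [Matrix.mul_assoc, e₁, ← Matrix.mul_assoc, ← Matrix.mul_assoc, e₂, Matrix.mul_smul,
      Matrix.smul_mul, Matrix.smul_mul])
  have hd : (p.poly i z).derivative.eval w ≠ 0 := by
    have := hsep.aeval_derivative_ne_zero (x := w) (by rw [coe_aeval_eq_eval]; exact hw)
    rwa [coe_aeval_eq_eval] at this
  -- the image of the test map is the `w`-eigenline, which is zero in the other cokernels
  have hc0 : ∀ v ∈ (p.poly i z).roots.toFinset, v ≠ w → c v = 0 := by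
    intro v hv hvw
    have hv' : p.OnCurve i v z := p.mem_roots_iff.1 hv
    obtain ⟨u, hu⟩ := E.exists_toCoker_ne_zero hp h₁ hv'
    have h3 := hc v hv' u
    have h4 : toCoker (E.W₂.φ i z) v ((J₂ * T * J₁).mulVec u) = 0 := by
      rw [Submodule.mkQ_apply, Submodule.Quotient.mk_eq_zero]
      refine ⟨(w - v)⁻¹ • (J₂ * T * J₁).mulVec u, ?_⟩
      rw [Matrix.mulVecLin_apply, Matrix.mulVec_smul, Matrix.mulVec_mulVec, ← Matrix.mul_assoc,
        ← Matrix.mul_assoc, Matrix.sub_mul, e₂, Matrix.smul_mul, Matrix.one_mul, ← sub_smul,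
        Matrix.smul_mul, Matrix.smul_mul, Matrix.smul_mulVec, smul_smul,
        inv_mul_cancel₀ (sub_ne_zero.2 hvw.symm), one_smul]
    rw [h4, map_zero] at h3
    exact (smul_eq_zero.1 h3.symm).resolve_right hu
  rw [hc w hw, hsum, Finset.sum_eq_single w (fun v hv hvw => by rw [hc0 v hv hvw, zero_div])
    (fun h => absurd (p.mem_roots_iff.2 hw) h), div_mul_cancel₀ _ hd]

include hp h₁ h₂ in
lemma Extension.IsDualSection.eq_of_separable {ψ : Bool → ℂ → Matrix (Fin m) (Fin m) ℂ}
    {s s' : ∀ (i : Bool) (w z : ℂ), E.Fibre i w z} (hs : E.IsDualSection p ψ s)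
    (hs' : E.IsDualSection p ψ s') {w z : ℂ} (hsep : (p.poly i z).Separable)
    (hw : p.OnCurve i w z) : s i w z = s' i w z := by
  set J₁ := cof (E.W₁.φ i z) w with hJ₁
  set J₂ := cof (E.W₂.φ i z) w with hJ₂
  obtain ⟨a, b, hab⟩ : ∃ a b, J₁ a b ≠ 0 := by
    by_contra! h
    exact h₁.cof_ne_zero hp hw (Matrix.ext h)
  have hJ : ∀ x, s i w z (toCoker _ _ (J₂.mulVec x)) = s' i w z (toCoker _ _ (J₂.mulVec x)) := by
    intro x
    have hT : (J₂ * Matrix.vecMulVec x (Pi.single a (J₁ a b)⁻¹) * J₁).mulVec (Pi.single b 1)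
        = J₂.mulVec x := by
      rw [← Matrix.mulVec_mulVec, ← Matrix.mulVec_mulVec]
      congr 1
      ext k
      simp [Matrix.vecMulVec, Matrix.mulVec, dotProduct, Pi.single_apply, hab]
    rw [← hT, hs.apply_cof hp h₁ h₂ hsep hw, hs'.apply_cof hp h₁ h₂ hsep hw]
  refine E.fibre_ext fun v => ?_
  have hs₂ := hsep
  rw [← h₂ i z] at hs₂
  have hv : toCoker (E.W₂.φ i z) w v
      = toCoker (E.W₂.φ i z) w (J₂.mulVec (((p.poly i z).derivative.eval w)⁻¹ • v)) := by
    rw [h₂.toCoker_eq_iff hp hw]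
    conv_lhs => rw [← Matrix.one_mulVec v, ← sum_inv_derivative_smul_cof hs₂, Matrix.sum_mulVec,
      Matrix.mulVec_sum]
    rw [Finset.sum_eq_single w]
    · simp only [Matrix.smul_mulVec, Matrix.mulVec_smul, h₂ i z, hJ₂]
    · intro x hx hxw
      rw [h₂ i z, p.mem_roots_iff] at hx
      rw [Matrix.smul_mulVec, Matrix.mulVec_smul,
        cof_mulVec_eq_zero_of_mem_range (h₂.eval_charpoly hw), smul_zero]
      refine ⟨(x - w)⁻¹ • (cof (E.W₂.φ i z) x).mulVec v, ?_⟩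
      have e₂ := sub_mul_cof (h₂.eval_charpoly (z := z) (w := x) hx)
      rw [Matrix.sub_mul, Matrix.smul_mul, Matrix.one_mul, sub_eq_zero] at e₂
      rw [Matrix.mulVecLin_apply, Matrix.mulVec_smul, Matrix.mulVec_mulVec, Matrix.sub_mul, e₂,
        Matrix.smul_mul, Matrix.one_mul, ← sub_smul, Matrix.smul_mulVec, smul_smul,
        inv_mul_cancel₀ (sub_ne_zero.2 hxw), one_smul]
    · intro h
      rw [h₂ i z] at h
      exact absurd (p.mem_roots_iff.2 hw) h
  rw [hv, hJ]

include hp h₁ h₂ in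
/-- There is at most one holomorphic section dual to `ψ`: it is determined on unramified fibres, and
by continuity on the others. -/
lemma Extension.IsHolSection.eq {ψ : Bool → ℂ → Matrix (Fin m) (Fin m) ℂ}
    {s s' : ∀ (i : Bool) (w z : ℂ), E.Fibre i w z}
    (hs : E.IsHolSection p s ∧ E.IsDualSection p ψ s)
    (hs' : E.IsHolSection p s' ∧ E.IsDualSection p ψ s') : s = s' := by
  funext i w z
  by_cases hw : p.OnCurve i w z
  · obtain ⟨γ, rfl, rfl, -⟩ := SpectralPoly.exists_localParam hp hw
    obtain ⟨ε, hε, hεr, N, hN, hNs⟩ := hs.1.hol i γ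
    obtain ⟨ε', hε', hεr', N', hN', hNs'⟩ := hs'.1.hol i γ
    have hball := Metric.ball_mem_nhds (0 : ℂ) hε
    have hball' := Metric.ball_mem_nhds (0 : ℂ) hε'
    have hcont : ∀ {ε : ℝ} {M : ℂ → Matrix (Fin m) (Fin m) ℂ}, MSmoothOn M (Metric.ball 0 ε) →
        Metric.ball (0 : ℂ) ε ∈ 𝓝 0 → ContinuousAt M 0 := fun hM hb =>
      continuousAt_pi.2 fun a => continuousAt_pi.2 fun b => ((hM a b).contDiffAt hb).continuousAt
    set F : ℂ → Matrix (Fin m) (Fin m) ℂ := fun τ => E.W₁.pullCof γ τ * (N τ - N' τ)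
    have hF : ContinuousAt F 0 :=
      (hcont (E.W₁.pullCof_smooth γ) γ.ball_mem).mul ((hcont hN hball).sub (hcont hN' hball'))
    have hF0 : ∀ᶠ τ in 𝓝[≠] (0 : ℂ), F τ = 0 := by
      filter_upwards [γ.eventually_separable hp, nhdsWithin_le_nhds hball,
        nhdsWithin_le_nhds hball', nhdsWithin_le_nhds γ.ball_mem] with τ hsep hτ hτ' hτr
      refine Matrix.ext_of_mulVec_single fun j => ?_
      have h3 := congrArg (fun f => f (toCoker _ _ (Pi.single j 1)))
        (hs.2.eq_of_separable hp h₁ h₂ hs'.2 hsep.1 (γ.onCurve τ hτr))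
      rw [(hNs τ hτ _).1, (hNs' τ hτ' _).1, h₁.toCoker_eq_iff hp (γ.onCurve τ hτr)] at h3
      rw [Matrix.zero_mulVec, ← Matrix.mulVec_mulVec, Matrix.sub_mulVec, Matrix.mulVec_sub,
        sub_eq_zero]
      exact h3
    have hF00 : F 0 = 0 :=
      tendsto_nhds_unique (hF.tendsto.mono_left nhdsWithin_le_nhds)
        (tendsto_const_nhds.congr' (hF0.mono fun τ h => h.symm))
    refine E.fibre_ext fun v => ?_
    rw [(hNs 0 (Metric.mem_ball_self hε) v).1, (hNs' 0 (Metric.mem_ball_self hε') v).1,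
      h₁.toCoker_eq_iff hp (γ.onCurve 0 γ.zero_mem), ← sub_eq_zero, ← Matrix.mulVec_sub,
      ← Matrix.sub_mulVec, Matrix.mulVec_mulVec]
    exact (congrArg (fun M => Matrix.mulVec M v) hF00).trans (Matrix.zero_mulVec v)
  · have := h₁.subsingleton_coker hw
    exact LinearMap.ext fun x => Subsingleton.elim _ _

include hp h₁ h₂ in
lemma Extension.sec_ne_zero (hne : ∃ i z, aeval (E.V.φ i z) (p.poly i z) ≠ 0) :
    E.sec p ≠ 0 := by
  obtain ⟨i, x, hx, h⟩ := E.exists_secMap_ne_zero hp h₁ h₂ hne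
  intro h0
  refine h (Matrix.ext_of_mulVec_single fun j => ?_)
  have h3 := E.sec_apply (i := i) (w := x.1) (z := x.2) h₁ h₂ (Pi.single j 1)
  rw [h0] at h3
  change 0 = _ at h3
  rw [← map_zero (toCoker (E.W₁.φ i x.2) x.1), h₁.toCoker_eq_iff hp hx, Matrix.mulVec_zero,
    Matrix.mulVec_mulVec] at h3
  rw [Matrix.zero_mulVec]
  exact h3.symm

end Dual

/-! ### The zero divisor -/

section Divisor

open scoped Matrix.Norms.Operator

variable {m : ℕ} {p : SpectralPoly m} {E : Extension m} {i : Bool}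
  (hp : p.Smooth) (h₁ : E.W₁.HasSpectralPoly p) (h₂ : E.W₂.HasSpectralPoly p)

include hp h₁ h₂ in
/-- The vanishing orders of the section form an effective divisor. -/
lemma Extension.exists_divisor (hne : ∃ i z, aeval (E.V.φ i z) (p.poly i z) ≠ 0) :
    ∃ D : p.Divisor, ∀ i, ∀ x ∈ p.curve i,
      p.VanishesToOrder i (E.secMap p i) x (D.mult i x.1 x.2) := by
  classical
  have hord : ∀ i (x : ℂ × ℂ), ∃ n, x ∈ p.curve i → p.VanishesToOrder i (E.secMap p i) x n := by
    intro i x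
    by_cases hx : x ∈ p.curve i
    · obtain ⟨n, hn, -⟩ := E.exists_order hp h₁ h₂ hne hx
      exact ⟨n, fun _ => hn⟩
    · exact ⟨0, fun h => absurd h hx⟩
  choose ord hord using hord
  set mult : Bool → ℂ × ℂ → ℕ := fun i x => if x ∈ p.curve i then ord i x else 0 with hmult
  have hm : ∀ {i x}, x ∈ p.curve i → p.VanishesToOrder i (E.secMap p i) x (mult i x) := by
    intro i x hx
    rw [hmult]
    simp only [if_pos hx]
    exact hord i x hx
  have hsupp : ∀ {i x}, mult i x ≠ 0 → x ∈ p.curve i := by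
    intro i x h
    by_contra hx
    exact h (if_neg hx)
  have hglue : ∀ i x, x.2 ≠ 0 → mult (!i) (chartChange x) = mult i x := by
    intro i x hx0
    by_cases hx : x ∈ p.curve i
    · have h3 := hm ((chartChange_mem_curve (p := p) hx0).2 hx)
      exact (h3.comp_chartChange hx0 (E.secMap_chartChange_isTheta h₁ h₂ hx0)).unique hp hx (hm hx)
    · rw [hmult]
      simp only [if_neg hx, if_neg (mt (chartChange_mem_curve (p := p) hx0).1 hx)]
  have hfin : ∀ i, ({x | x.2 ∈ Metric.closedBall (0 : ℂ) 1} ∩ {x | mult i x ≠ 0}).Finite := by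
    intro i
    refine (E.finite_zeros hp h₁ h₂ hne i 0 1).subset fun x hx => ?_
    have hxc := hsupp hx.2
    exact ⟨⟨hxc, hx.1⟩, ((hm hxc).ne_zero_iff hxc).1 hx.2⟩
  refine ⟨⟨fun i w z => mult i (w, z), fun i w z h => hsupp h, fun i w z hz => hglue i (w, z) hz,
    fun i => ?_⟩, fun i x hx => hm hx⟩
  -- the two closed unit discs cover the projective line
  refine ((hfin i).union ((hfin (!i)).image chartChange)).subset fun x hx => ?_
  by_cases hx1 : x.2 ∈ Metric.closedBall (0 : ℂ) 1
  · exact Or.inl ⟨hx1, hx⟩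
  · rw [mem_closedBall_zero_iff, not_le] at hx1
    have hx0 : x.2 ≠ 0 := fun h => by
      rw [h, norm_zero] at hx1
      exact absurd hx1 (by norm_num)
    refine Or.inr ⟨chartChange x, ⟨?_, ?_⟩, chartChange_chartChange hx0⟩
    · rw [Set.mem_ofPred_eq, mem_closedBall_zero_iff]
      simp only [chartChange, norm_inv]
      exact inv_le_one_of_one_le₀ hx1.le
    · rw [Set.mem_ofPred_eq, hglue i x hx0]
      exact hx

include hp h₁ h₂ in
lemma Extension.hasZeroDivisor (hne : ∃ i z, aeval (E.V.φ i z) (p.poly i z) ≠ 0) {D : p.Divisor}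
    (hD : ∀ i, ∀ x ∈ p.curve i, p.VanishesToOrder i (E.secMap p i) x (D.mult i x.1 x.2)) :
    E.HasZeroDivisor p D := by
  refine ⟨E.nonempty_splitting, fun σ => ⟨σ.higgsTerm, σ.dbarTerm, σ.isHiggsTerm_higgsTerm,
    σ.isDbarTerm_dbarTerm, σ.homDbar_higgsTerm_add, E.sec p,
    ⟨E.isHolSection_sec hp h₁ h₂, E.isDualSection_sec hp h₁ h₂ σ⟩, fun s' hs' => ?_,
    E.sec_ne_zero hp h₁ h₂ hne, fun i w z hw => ?_⟩⟩
  · exact Extension.IsHolSection.eq hp h₁ h₂ hs'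
      ⟨E.isHolSection_sec hp h₁ h₂, E.isDualSection_sec hp h₁ h₂ σ⟩
  · obtain ⟨n, hn, hn'⟩ := E.exists_order (x := (w, z)) hp h₁ h₂ hne hw
    rwa [hn.unique hp hw (hD i (w, z) hw)] at hn'

end Divisor

/-! ### Isomorphic middle terms -/

section Iso

open scoped Matrix.Norms.Operator

variable {m : ℕ} {p : SpectralPoly m} {E E' : Extension m} {i : Bool} (hp : p.Smooth)
  (h₁ : E.W₁.HasSpectralPoly p) (h₂ : E.W₂.HasSpectralPoly p)
  (h₁' : E'.W₁.HasSpectralPoly p) (h₂' : E'.W₂.HasSpectralPoly p)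
  (f : E.V.Hom E'.V) (hf : f.IsIso)

lemma CoHiggs.Hom.aeval_comm {k l : ℕ} {V : CoHiggs k} {W : CoHiggs l} (f : V.Hom W) (i : Bool)
    (z : ℂ) (P : ℂ[X]) : f.mat i z * aeval (V.φ i z) P = aeval (W.φ i z) P * f.mat i z :=
  mul_aeval_eq_aeval_mul (f.comm i z).symm P

include hf in
lemma CoHiggs.Hom.aeval_ne_zero (hne : ∃ i z, aeval (E.V.φ i z) (p.poly i z) ≠ 0) :
    ∃ i z, aeval (E'.V.φ i z) (p.poly i z) ≠ 0 := by
  obtain ⟨i, z, h⟩ := hne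
  refine ⟨i, z, fun h0 => h ?_⟩
  have h3 := f.aeval_comm i z (p.poly i z)
  rw [h0, Matrix.zero_mul] at h3
  exact (hf i z).mul_right_eq_zero.1 h3

include hp h₁ h₂ h₁' h₂' hf in
/-- An isomorphism of the middle terms respects the subbundles: over a generic point the subbundle
is the kernel of `p(φ)`. -/
lemma Extension.q_mul_mul_ι (hne : ∃ i z, aeval (E.V.φ i z) (p.poly i z) ≠ 0) (i : Bool) (z : ℂ) :
    E'.q.mat i z * f.mat i z * E.ι.mat i z = 0 := by
  have hc : Continuous fun z => E'.q.mat i z * f.mat i z * E.ι.mat i z :=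
    (((E'.q.smooth i).mul (f.smooth i)).mul (E.ι.smooth i)).continuous
  have hgen : ∀ᶠ x in 𝓝[≠] z, E'.q.mat i x * f.mat i x * E.ι.mat i x = 0 := by
    filter_upwards [E'.eventually_isUnit_polyMap hp h₁' h₂' (f.aeval_ne_zero hf hne) i z] with x hu
    have h3 : E'.ι.mat i x * (E'.polyMap p i x * (E'.q.mat i x * f.mat i x * E.ι.mat i x)) = 0 := by
      calc E'.ι.mat i x * (E'.polyMap p i x * (E'.q.mat i x * f.mat i x * E.ι.mat i x))
          = E'.ι.mat i x * E'.polyMap p i x * E'.q.mat i x * f.mat i x * E.ι.mat i x := by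
            simp only [Matrix.mul_assoc]
        _ = f.mat i x * (E.ι.mat i x * E.polyMap p i x * E.q.mat i x) * E.ι.mat i x := by
            rw [E'.ι_mul_polyMap_mul_q h₁' h₂', E.ι_mul_polyMap_mul_q h₁ h₂, f.aeval_comm]
        _ = 0 := by
            simp only [Matrix.mul_assoc, E.q_mul_ι, Matrix.mul_zero]
    have h4 : E'.polyMap p i x * (E'.q.mat i x * f.mat i x * E.ι.mat i x) = 0 :=
      E'.ι_cancel (h3.trans (Matrix.mul_zero _).symm)
    exact hu.mul_right_eq_zero.1 h4
  exact tendsto_nhds_unique (hc.continuousAt.tendsto.mono_left nhdsWithin_le_nhds)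
    (tendsto_const_nhds.congr' (hgen.mono fun τ h => h.symm))

include hp h₁ h₂ h₁' h₂' hf in
/-- The maps induced by `p(φ)` for two extensions with isomorphic middle terms differ by
isomorphisms of the subbundles and of the quotients. -/
lemma Extension.secMap_isTheta (hne : ∃ i z, aeval (E.V.φ i z) (p.poly i z) ≠ 0) (i : Bool)
    (x₀ : ℂ × ℂ) : E'.secMap p i =Θ[𝓝[p.curve i] x₀] E.secMap p i := by
  set a : ℂ → Matrix (Fin m) (Fin m) ℂ :=
    fun z => leftInv (E'.ι.mat i z) * (f.mat i z * E.ι.mat i z) with ha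
  set b : ℂ → Matrix (Fin m) (Fin m) ℂ :=
    fun z => E'.q.mat i z * f.mat i z * rightInv (E.q.mat i z) with hb
  have hιa : ∀ z, E'.ι.mat i z * a z = f.mat i z * E.ι.mat i z := by
    intro z
    refine E'.ι_mul_leftInv_mul ?_
    rw [← Matrix.mul_assoc]
    exact E.q_mul_mul_ι hp h₁ h₂ h₁' h₂' f hf hne i z
  have hbq : ∀ z, b z * E.q.mat i z = E'.q.mat i z * f.mat i z := by
    intro z
    have h5 : E.ι.mat i z * (leftInv (E.ι.mat i z) * (1 - rightInv (E.q.mat i z) * E.q.mat i z))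
        = 1 - rightInv (E.q.mat i z) * E.q.mat i z := by
      refine E.ι_mul_leftInv_mul ?_
      rw [Matrix.mul_sub, ← Matrix.mul_assoc, mul_rightInv (E.surj i z), Matrix.mul_one,
        Matrix.one_mul, sub_self]
    have h6 : E'.q.mat i z * f.mat i z * (1 - rightInv (E.q.mat i z) * E.q.mat i z) = 0 := by
      rw [← h5, ← Matrix.mul_assoc, E.q_mul_mul_ι hp h₁ h₂ h₁' h₂' f hf hne i z, Matrix.zero_mul]
    rw [Matrix.mul_sub, Matrix.mul_one, sub_eq_zero] at h6
    rw [h6, hb]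
    simp only [Matrix.mul_assoc]
  have hau : ∀ z, IsUnit (a z) := by
    intro z
    refine Matrix.mulVec_injective_iff_isUnit.1 fun u v huv => E.inj i z ?_
    refine Matrix.mulVec_injective_iff_isUnit.2 (hf i z) ?_
    have h3 := congrArg (E'.ι.mat i z).mulVec huv
    rwa [Matrix.mulVec_mulVec, Matrix.mulVec_mulVec, hιa, ← Matrix.mulVec_mulVec,
      ← Matrix.mulVec_mulVec] at h3
  have hbu : ∀ z, IsUnit (b z) := by
    intro z
    refine Matrix.mulVec_surjective_iff_isUnit.1 fun v => ?_
    obtain ⟨u, rfl⟩ := E'.surj i z v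
    obtain ⟨t, rfl⟩ := Matrix.mulVec_surjective_iff_isUnit.2 (hf i z) u
    refine ⟨(E.q.mat i z).mulVec t, ?_⟩
    rw [Matrix.mulVec_mulVec, hbq, ← Matrix.mulVec_mulVec]
  have has : MSmoothOn a Set.univ :=
    (E'.leftInv_ι_smooth i).mul ((f.smooth i).mul (E.ι.smooth i))
  have hbs : MSmoothOn b Set.univ :=
    ((E'.q.smooth i).mul (f.smooth i)).mul ((E.q.smooth i).rightInv fun z _ => E.surj i z)
  have hRab : ∀ z, E'.polyMap p i z * b z = a z * E.polyMap p i z := by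
    intro z
    refine E'.ι_cancel (i := i) (z := z) (E.q_cancel (i := i) (z := z) ?_)
    calc E'.ι.mat i z * (E'.polyMap p i z * b z) * E.q.mat i z
        = E'.ι.mat i z * E'.polyMap p i z * E'.q.mat i z * f.mat i z := by
          simp only [Matrix.mul_assoc, hbq]
      _ = f.mat i z * (E.ι.mat i z * E.polyMap p i z * E.q.mat i z) := by
          rw [E'.ι_mul_polyMap_mul_q h₁' h₂', E.ι_mul_polyMap_mul_q h₁ h₂, f.aeval_comm]
      _ = E'.ι.mat i z * (a z * E.polyMap p i z) * E.q.mat i z := by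
          rw [← Matrix.mul_assoc (E'.ι.mat i z), hιa]
          simp only [Matrix.mul_assoc]
  have haφ : ∀ z, a z * E.W₁.φ i z = E'.W₁.φ i z * a z := by
    intro z
    refine E'.ι_cancel (i := i) (z := z) ?_
    rw [← Matrix.mul_assoc, hιa, ← Matrix.mul_assoc, ← E'.ι.comm, Matrix.mul_assoc, ← E.ι.comm,
      Matrix.mul_assoc, hιa, ← Matrix.mul_assoc, ← Matrix.mul_assoc, f.comm]
  have hM : ∀ x : ℂ × ℂ, E'.secMap p i x * b x.2 = a x.2 * E.secMap p i x := by
    intro x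
    rw [Extension.secMap, Matrix.mul_assoc, hRab, ← Matrix.mul_assoc,
      ← mul_cof_eq_cof_mul (haφ x.2) ((h₁ i x.2).trans (h₁' i x.2).symm), Matrix.mul_assoc]
    rfl
  have hinv : ∀ {A : ℂ → Matrix (Fin m) (Fin m) ℂ}, MSmoothOn A Set.univ → (∀ z, IsUnit (A z)) →
      Tendsto (fun x : ℂ × ℂ => (A x.2)⁻¹) (𝓝[p.curve i] x₀) (𝓝 (A x₀.2)⁻¹) := by
    intro A hA hAu
    have h3 : MSmoothOn (fun z => (A z)⁻¹) Set.univ := hA.inv fun z _ => hAu z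
    exact ((h3.continuous.comp continuous_snd).tendsto x₀).mono_left nhdsWithin_le_nhds
  have hten : ∀ {A : ℂ → Matrix (Fin m) (Fin m) ℂ}, MSmoothOn A Set.univ →
      Tendsto (fun x : ℂ × ℂ => A x.2) (𝓝[p.curve i] x₀) (𝓝 (A x₀.2)) := fun hA =>
    ((hA.continuous.comp continuous_snd).tendsto x₀).mono_left nhdsWithin_le_nhds
  constructor
  · refine (isBigO_mul_mul (hten has) (hinv hbs hbu)).congr_left fun x => ?_
    rw [← hM, Matrix.mul_nonsing_inv_cancel_right _ _ ((Matrix.isUnit_iff_isUnit_det _).1 (hbu _))]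
  · refine (isBigO_mul_mul (hinv has hau) (hten hbs)).congr_left fun x => ?_
    rw [Matrix.mul_assoc, hM,
      Matrix.nonsing_inv_mul_cancel_left _ _ ((Matrix.isUnit_iff_isUnit_det _).1 (hau _))]

end Iso

/-! ### Eigenspaces at the zeros -/

section Eigen

variable {m : ℕ} {p : SpectralPoly m} {E : Extension m} {i : Bool}
  (hp : p.Smooth) (h₁ : E.W₁.HasSpectralPoly p) (h₂ : E.W₂.HasSpectralPoly p)

include hp h₁ h₂ in
/-- At a zero of the section, the eigenvector of `φ₂` lifts to an eigenvector of `φ`. -/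
lemma Extension.finrank_eigenspace {w z : ℂ} (hw : p.OnCurve i w z)
    (h0 : E.secMap p i (w, z) = 0) :
    Module.finrank ℂ (Module.End.eigenspace (Matrix.toLin' (E.V.φ i z)) w) = 2 := by
  obtain ⟨σ⟩ := E.nonempty_splitting
  obtain ⟨y₁, f₁, hy₁, -, -, hey₁, hker₁⟩ :=
    exists_cof_eq_vecMulVec (h₁.eval_charpoly hw) (h₁.cof_ne_zero hp hw)
  obtain ⟨y₂, f₂, hy₂, hf₂, hJ₂, hey₂, hker₂⟩ :=
    exists_cof_eq_vecMulVec (h₂.eval_charpoly hw) (h₂.cof_ne_zero hp hw)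
  -- `ψ y₂` is in the image of `φ₁ - w`
  have hψ : (cof (E.W₁.φ i z) w).mulVec ((σ.higgsTerm i z).mulVec y₂) = 0 := by
    have h3 := E.polyMap_mul_cof σ h₁ h₂ i hw
    rw [← E.secMap_eq h₁ h₂ i (w, z), h0, hJ₂, Matrix.mul_vecMulVec] at h3
    obtain ⟨k, hk⟩ := Function.ne_iff.1 hf₂
    rw [Matrix.mulVec_mulVec]
    funext l
    have h4 := congrFun (congrFun h3 l) k
    rw [Matrix.vecMulVec_apply] at h4
    exact (mul_eq_zero.1 h4.symm).resolve_right hk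
  obtain ⟨x, hx⟩ := (mem_range_iff_cof_mulVec_eq_zero (h₁.eval_charpoly hw)
    (h₁.cof_ne_zero hp hw) _).2 hψ
  rw [Matrix.mulVecLin_apply, Matrix.sub_mulVec, Matrix.smul_mulVec, Matrix.one_mulVec] at hx
  set e₁ := (E.ι.mat i z).mulVec y₁ with he₁
  set e₂ := (σ.mat i z).mulVec y₂ - (E.ι.mat i z).mulVec x with he₂
  have hqι : ∀ u, (E.q.mat i z).mulVec ((E.ι.mat i z).mulVec u) = 0 := fun u => by
    rw [Matrix.mulVec_mulVec, E.q_mul_ι, Matrix.zero_mulVec]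
  have hφι : ∀ u, (E.V.φ i z).mulVec ((E.ι.mat i z).mulVec u)
      = (E.ι.mat i z).mulVec ((E.W₁.φ i z).mulVec u) := fun u => by
    rw [Matrix.mulVec_mulVec, Matrix.mulVec_mulVec, E.ι.comm]
  have hqe₂ : (E.q.mat i z).mulVec e₂ = y₂ := by
    rw [he₂, Matrix.mulVec_sub, hqι, sub_zero, Matrix.mulVec_mulVec, σ.sect, Matrix.one_mulVec]
  have heig₁ : (E.V.φ i z).mulVec e₁ = w • e₁ := by
    rw [he₁, hφι, hey₁, Matrix.mulVec_smul]
  have heig₂ : (E.V.φ i z).mulVec e₂ = w • e₂ := by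
    have h3 := (σ.isHiggsTerm_higgsTerm i).2 z
    rw [he₂, Matrix.mulVec_sub, hφι, Matrix.mulVec_mulVec, h3, Matrix.add_mulVec,
      ← Matrix.mulVec_mulVec, ← Matrix.mulVec_mulVec, hey₂, ← hx, Matrix.mulVec_sub,
      Matrix.mulVec_smul, Matrix.mulVec_smul, smul_sub]
    abel
  have hspan : Module.End.eigenspace (Matrix.toLin' (E.V.φ i z)) w
      = Submodule.span ℂ (Set.range ![e₁, e₂]) := by
    refine le_antisymm (fun v hv => ?_) ?_
    · rw [Module.End.mem_eigenspace_iff, Matrix.toLin'_apply] at hv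
      obtain ⟨c, hc⟩ := hker₂ ((E.q.mat i z).mulVec v) (by
        rw [Matrix.mulVec_mulVec, E.q.comm, ← Matrix.mulVec_mulVec, hv, Matrix.mulVec_smul])
      obtain ⟨u, hu⟩ := (E.exact i z (v - c • e₂)).1 (by
        rw [Matrix.mulVec_sub, Matrix.mulVec_smul, hqe₂, hc, sub_self])
      obtain ⟨d, rfl⟩ := hker₁ u (E.inj i z (by
        rw [← hφι, hu, Matrix.mulVec_sub, Matrix.mulVec_smul, hv, heig₂, Matrix.mulVec_smul, hu,
          smul_comm c w e₂, ← smul_sub]))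
      rw [Matrix.range_cons_cons_empty, Submodule.mem_span_pair]
      refine ⟨d, c, ?_⟩
      rw [he₁, ← Matrix.mulVec_smul, hu, sub_add_cancel]
    · rw [Submodule.span_le]
      rintro _ ⟨j, rfl⟩
      rw [SetLike.mem_coe, Module.End.mem_eigenspace_iff, Matrix.toLin'_apply]
      fin_cases j
      · exact heig₁
      · exact heig₂
  have hli : LinearIndependent ℂ ![e₁, e₂] := by
    rw [LinearIndependent.pair_iff]
    intro c d h
    have h3 := congrArg (E.q.mat i z).mulVec h
    rw [Matrix.mulVec_add, Matrix.mulVec_smul, Matrix.mulVec_smul, hqe₂, he₁, hqι, smul_zero,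
      zero_add, Matrix.mulVec_zero] at h3
    have hd := (smul_eq_zero.1 h3).resolve_right hy₂
    rw [hd, zero_smul, add_zero, he₁, ← Matrix.mulVec_smul,
      ← Matrix.mulVec_zero (E.ι.mat i z)] at h
    exact ⟨(smul_eq_zero.1 (E.inj i z h)).resolve_right hy₁, hd⟩
  rw [hspan, finrank_span_eq_card hli, Fintype.card_fin]

end Eigen

end NahmRibbon

end

open NahmRibbon in
theorem mainTheorem3 (m : ℕ) (p : NahmRibbon.SpectralPoly m) (hp : p.Smooth)
    (E : NahmRibbon.Extension m)
    (h₁ : E.W₁.HasSpectralPoly p) (h₂ : E.W₂.HasSpectralPoly p)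
    (hne : ∃ i z, Polynomial.aeval (E.V.φ i z) (p.poly i z) ≠ 0) :
    ∃ D : p.Divisor,
      E.HasZeroDivisor p D ∧
      (∀ (B : NahmRibbon.Form11) (t : ℂ), (E.bField B t).HasZeroDivisor p D) ∧
      (∀ (B : NahmRibbon.Form11) (t : ℂ) (E' : NahmRibbon.Extension m)
        (f : (E.V.bField B t).Hom E'.V), f.IsIso →
          E'.W₁.HasSpectralPoly p → E'.W₂.HasSpectralPoly p → E'.HasZeroDivisor p D) ∧
      (∀ i w z, D.mult i w z ≠ 0 →
        Module.finrank ℂ (Module.End.eigenspace (Matrix.toLin' (E.V.φ i z)) w) = 2) := by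
  obtain ⟨D, hD⟩ := E.exists_divisor hp h₁ h₂ hne
  refine ⟨D, E.hasZeroDivisor hp h₁ h₂ hne hD, fun B t => ?_, fun B t E' f hf h₁' h₂' => ?_,
    fun i w z h => ?_⟩
  · exact (E.bField B t).hasZeroDivisor hp h₁ h₂ hne hD
  · refine E'.hasZeroDivisor hp h₁' h₂' (CoHiggs.Hom.aeval_ne_zero (E := E.bField B t) f hf hne)
      fun i x hx => ?_
    exact SpectralPoly.VanishesToOrder.congr (hD i x hx)
      (Extension.secMap_isTheta (E := E.bField B t) hp h₁ h₂ h₁' h₂' f hf hne i x)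
  · have hw := D.supp i w z h
    exact E.finrank_eigenspace hp h₁ h₂ hw (((hD i (w, z) hw).ne_zero_iff hw).1 h)
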